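/- Let $\frac12<\beta_0\le 1$, $L_0>0$, $0<c_0$, $C_0\in\mathbb R$, and for $\beta\in[\beta_0,1]$ let $\mathcal H^\beta(L_0)$ be the set of probability densities $p$ on $[0,1]$ with $c_0\le p\le C_0$ and $|p(x)-p(y)|\le L_0|x-y|^\beta$ for all $x,y$. One observes $\mathbf Y=(Y_1,\dots,Y_n)$, i.i.d. from a density $p_0$; write $P_{p_0}^{(n)}$ for the law of $\mathbf Y$. Let $h(p,q)=\big(\int_0^1(\sqrt p-\sqrt q)^2\big)^{1/2}$ be the Hellinger distance. *Models and priors.* For $k\ge1$ and $\theta$ in the simplex $\mathcal S_k=\{\theta\in[0,1]^k:\sum_j\theta_j=1\}$ let $p_\theta=k\sum_{j=1}^k\theta_j\mathbf 1_{[(j-1)/k,\,j/k)}$. Fix the smallest number of bins in use, an integer $\kappa\ge1$. Given $k\geq\kappa$, let $\theta\mid k\sim\mathcal D(\alpha_{1,k},\dots,\alpha_{k,k})$ (Dirichlet) with $c_1k^{-a}\le\alpha_{j,k}\le C_1$ for all $j\le k$, where $a\ge0$ and $c_1>0$. In the hierarchical Bayes approach $k$ has a geometric prior (parameter in $(0,1)$)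 or a Poisson prior (parameter $\lambda>0$), conditioned on $k\ge\kappa$. In the empirical Bayes approach $k$ is replaced by a maximiser $\hat k_n$ of the marginal likelihood $k\mapsto\int_{\mathcal S_k}\prod_{i=1}^n p_\theta(Y_i)\,d\pi_{|k}(\theta)$ over $\kappa\le k\le\bar K_n$, where $\pi_{|k}$ is the above Dirichlet prior. *Bias and polished tails.* For a density $p_0$ let $b(k)=\inf_{\theta\in\mathcal S_k}h^2(p_0,p_\theta)$, $\varepsilon_n^2(k)=b(k)+\frac{k\log n}{n}$ and $k_n=\inf\{k\ge\kappa: b(k)\le k\log n/n\}$. For integers $R_0>1$, $k_0\ge1$ and $0<\tau<1$ let $\Theta_0=\Theta_0(R_0,k_0,\tau)$ be the set of densities $p_0$ such that, for all sufficiently large $n$, $b(kR_0)\le\tau b(k)$ for every $k_0\le k\le k_n$. In the empirical Bayes case assume that for all large $n$ one has $\bar K_n\le n^H$, for some $H<\frac12$, and $\bar K_n\ge k_n$ for all $p_0\in\mathcal H^{\beta_0}(L_0)$. *Credible sets.* Let $\alpha\in(0,1)$ and let $\hat p_n$ be an estimator whose values are probability densities on $[0,1]$. Let $r_\alpha$ be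 the infimum of all $r$ for which the (hierarchical or empirical Bayes) posterior probability of $\{\theta:h(p_\theta,\hat p_n)\le r\}$ is at least $1-\alpha$, and let $\hat C_n(L,\alpha)$ be the set of densities $q$ on $[0,1]$ with $h(q,\hat p_n)\le L\,r_\alpha$. We say that $\hat p_n$ is rate-centered on a class $\mathcal F$ if for every $\varepsilon>0$ there is $M_\varepsilon>0$ with $\inf_{p_0\in\mathcal F}P_{p_0}^{(n)}\big(h(p_0,\hat p_n)\le M_\varepsilon\varepsilon_n(k_n)\big)\ge1-\varepsilon$ for all large $n$. Then, for both the hierarchical and the empirical Bayes posterior: (i) (Coverage.) Let $R_0,k_0,\tau$ be as above and $\delta\ge0$, with $\delta>0$ if $\kappa=1$. Put $\mathcal F=\{p_0\in\Theta_0\cap\mathcal H^{\beta_0}(L_0): h(p_0,1)\ge\delta\}$; so $\mathcal F=\Theta_0\cap\mathcal H^{\beta_0}(L_0)$ if $\delta=0$. If $\hat p_n$ is rate-centered on $\mathcal F$, then for every $\varepsilon>0$ there is $L>0$ with $$\liminf_n\inf_{p_0\in\mathcal F}P_{p_0}^{(n)}\big(p_0\in\hat C_n(L\sqrt{\log n},\alpha)\big)\ge1-\varepsilon.$$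 (ii) (Size.) If $\hat p_n$ is rate-centered on $\mathcal H^{\beta_0}(L_0)$, then for every $\varepsilon>0$ there is $C>0$ with $$\liminf_n\inf_{\beta\in[\beta_0,1]}\inf_{p_0\in\mathcal H^\beta(L_0)}P_{p_0}^{(n)}\Big(\operatorname{diam}\big(\hat C_n(1,\alpha),h\big)\le C\big(\tfrac{n}{\log n}\big)^{-\frac{\beta}{1+2\beta}}\Big)\ge1-\varepsilon.$$ -/

import Mathlib

open MeasureTheory ProbabilityTheory Filter Set
open scoped ENNReal NNReal unitInterval

noncomputable section

/-- `p` is a probability density on `[0,1]` with respect to Lebesgue measure. -/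
def IsDensity (p : I → ℝ) : Prop :=
  Measurable p ∧ (∀ x, 0 ≤ p x) ∧ ∫⁻ x, ENNReal.ofReal (p x) = 1

/-- The densities on `[0,1]` with values in `[c₀, C₀]` that belong to the Hölder ball
`H^β(L₀)`, `0 < β ≤ 1`. -/
def holderDensities (β L₀ c₀ C₀ : ℝ) : Set (I → ℝ) :=
  {p | IsDensity p ∧ (∀ x, c₀ ≤ p x ∧ p x ≤ C₀) ∧
    ∀ x y : I, |p x - p y| ≤ L₀ * |(x : ℝ) - y| ^ β}

/-- The Hellinger distance `h(p, q) = (∫ (√p - √q)²)^{1/2}`. -/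
def hellinger (p q : I → ℝ) : ℝ :=
  √(∫ x, (√(p x) - √(q x)) ^ 2)

/-- The Hellinger diameter of a set of functions. -/
def hellingerDiam (S : Set (I → ℝ)) : ℝ≥0∞ :=
  ⨆ p ∈ S, ⨆ q ∈ S, ENNReal.ofReal (hellinger p q)

/-- The law of `n` independent observations with density `p`. -/
def sampleLaw (p : I → ℝ) (n : ℕ) : Measure (Fin n → I) :=
  Measure.pi fun _ => (volume : Measure I).withDensity fun x => ENNReal.ofReal (p x)

/-- The inner probability `1 - P(Eᶜ)` of an event under a probability measure. It is `P E` for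
measurable `E`; estimators need then not be assumed measurable, and a lower bound on it is
never weaker than the same lower bound on `P E`. -/
def innerProb {Ω : Type*} [MeasurableSpace Ω] (P : Measure Ω) (E : Set Ω) : ℝ≥0∞ :=
  1 - P Eᶜ

/-! ### Histograms -/

/-- A number of bins together with a vector of that length of bin probabilities. -/
abbrev HistParam : Type := Σ k : ℕ, (Fin k → ℝ)

/-- The regular histogram `p_θ = k ∑_j θ_j 1_{I_j}`, whose bins are `I_j = [j/k, (j+1)/k)`
for `j = 0, …, k - 1`. -/
def histDensity (θ : HistParam) (x : I) : ℝ :=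
  θ.1 * ∑ j : Fin θ.1,
    if (j : ℝ) / θ.1 ≤ x ∧ (x : ℝ) < ((j : ℝ) + 1) / θ.1 then θ.2 j else 0

/-- The squared Hellinger distance `b(k)` of `p` from the `k`-bin histograms (`k ≥ 1`). -/
def bias (p : I → ℝ) (k : ℕ) : ℝ :=
  ⨅ θ : stdSimplex ℝ (Fin k), hellinger p (histDensity ⟨k, θ.1⟩) ^ 2

/-- `k_n = inf {k ≥ κ : b(k) ≤ k log n / n}`, where `κ` is the smallest number of bins in use. -/
def oracleBins (κ : ℕ) (p : I → ℝ) (n : ℕ) : ℕ :=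
  sInf {k | κ ≤ k ∧ bias p k ≤ k * Real.log n / n}

/-- `ε_n(k) = (b(k) + k log n / n)^{1/2}`. -/
def rate (p : I → ℝ) (n k : ℕ) : ℝ :=
  √(bias p k + k * Real.log n / n)

/-- The class `Θ_{0,n}(R₀, k₀, τ)` of densities with a polished tail up to `k_n`. -/
def polishedTailAt (κ R₀ k₀ : ℕ) (τ : ℝ) (n : ℕ) : Set (I → ℝ) :=
  {p | IsDensity p ∧
    ∀ k, k₀ ≤ k → k ≤ oracleBins κ p n → bias p (k * R₀) ≤ τ * bias p k}

/-- The limit `Θ_0(R₀, k₀, τ)` of the classes `Θ_{0,n}(R₀, k₀, τ)`, which decrease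
for `n ≥ 3`. -/
def polishedTail (κ R₀ k₀ : ℕ) (τ : ℝ) : Set (I → ℝ) :=
  {p | ∀ᶠ n in atTop, p ∈ polishedTailAt κ R₀ k₀ τ n}

/-- The polished tail densities in the Hölder class at Hellinger distance at least `δ` from the
uniform density. -/
def coverageClass (κ R₀ k₀ : ℕ) (τ β L₀ c₀ C₀ δ : ℝ) : Set (I → ℝ) :=
  {p | p ∈ polishedTail κ R₀ k₀ τ ∧ p ∈ holderDensities β L₀ c₀ C₀ ∧
    δ ≤ hellinger p (fun _ => 1)}

/-! ### Priors and posteriors -/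

/-- The Dirichlet distribution with parameters `a_1, …, a_k > 0`: the law of
`(G_1, …, G_k) / (G_1 + ⋯ + G_k)` for independent `G_j ∼ Gamma(a_j, 1)`. -/
def dirichlet {k : ℕ} (a : Fin k → ℝ) : Measure (Fin k → ℝ) :=
  (Measure.pi fun j => gammaMeasure (a j) 1).map fun g j => g j / ∑ i, g i

/-- The Dirichlet prior on the histograms with `k` bins. -/
def binPrior (a : (k : ℕ) → Fin k → ℝ) (k : ℕ) : Measure HistParam :=
  (dirichlet (a k)).map (Sigma.mk k)

/-- The hierarchical prior: `k ∼ ν`, and given `k` the Dirichlet prior on `k` bins. -/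
def hierPrior (ν : Measure ℕ) (a : (k : ℕ) → Fin k → ℝ) : Measure HistParam :=
  Measure.sum fun k => ν {k} • binPrior a k

/-- A geometric or Poisson prior on the number of bins, conditioned on `k ≥ κ`. -/
def IsBinNumberPrior (κ : ℕ) (ν : Measure ℕ) : Prop :=
  (∃ q : I, q ≠ 0 ∧ q ≠ 1 ∧ ν = cond (geometricMeasure q) (Set.Ici κ)) ∨
    ∃ r : ℝ≥0, 0 < r ∧ ν = cond (poissonMeasure r) (Set.Ici κ)

/-- The likelihood of `θ` at the observations `y`. -/
def likelihood {n : ℕ} (y : Fin n → I) (θ : HistParam) : ℝ≥0∞ :=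
  ∏ i, ENNReal.ofReal (histDensity θ (y i))

/-- The marginal likelihood of the observations `y` under the prior `π`. -/
def marginal {n : ℕ} (π : Measure HistParam) (y : Fin n → I) : ℝ≥0∞ :=
  ∫⁻ θ, likelihood y θ ∂π

/-- The posterior distribution for the prior `π`, given the observations `y`. -/
def histPosterior {n : ℕ} (π : Measure HistParam) (y : Fin n → I) : Measure HistParam :=
  (marginal π y)⁻¹ • π.withDensity (likelihood y)

/-- `khat n y` maximises the marginal likelihood over `κ ≤ k ≤ Kbar n`, for all large `n`. -/
def IsMMLE (κ : ℕ) (a : (k : ℕ) → Fin k → ℝ) (Kbar : ℕ → ℕ)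
    (khat : (n : ℕ) → (Fin n → I) → ℕ) : Prop :=
  ∀ᶠ n in atTop, ∀ y : Fin n → I, khat n y ∈ Set.Icc κ (Kbar n) ∧
    ∀ k ∈ Set.Icc κ (Kbar n), marginal (binPrior a k) y ≤ marginal (binPrior a (khat n y)) y

/-- `Kbar` is an admissible upper end of the range of the empirical Bayes estimator over the
class `F`: it is at most `n^H` for some `H < 1/2`, and at least `k_n` for all densities in `F`. -/
def AdmissibleRange (κ : ℕ) (F : Set (I → ℝ)) (Kbar : ℕ → ℕ) : Prop :=
  (∃ H : ℝ, H < 1 / 2 ∧ ∀ᶠ n : ℕ in atTop, (Kbar n : ℝ) ≤ (n : ℝ) ^ H) ∧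
    ∀ᶠ n in atTop, ∀ p ∈ F, oracleBins κ p n ≤ Kbar n

/-- `post` is the hierarchical Bayes posterior. -/
def IsHierarchicalPosterior (κ : ℕ) (a : (k : ℕ) → Fin k → ℝ)
    (post : (n : ℕ) → (Fin n → I) → Measure HistParam) : Prop :=
  ∃ ν : Measure ℕ, IsBinNumberPrior κ ν ∧ ∀ n y, post n y = histPosterior (hierPrior ν a) y

/-- `post` is the empirical Bayes posterior, with the number of bins estimated by a maximum
marginal likelihood estimator. -/
def IsEmpiricalPosterior (κ : ℕ) (a : (k : ℕ) → Fin k → ℝ) (F : Set (I → ℝ))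
    (post : (n : ℕ) → (Fin n → I) → Measure HistParam) : Prop :=
  ∃ (Kbar : ℕ → ℕ) (khat : (n : ℕ) → (Fin n → I) → ℕ), AdmissibleRange κ F Kbar ∧
    IsMMLE κ a Kbar khat ∧ ∀ n y, post n y = histPosterior (binPrior a (khat n y)) y

/-! ### Credible sets -/

/-- The radius `r_α`: the infimum of the `r` for which the Hellinger ball of radius `r` around
`c` has posterior mass at least `1 - α`. -/
def credibleRadius (μ : Measure HistParam) (c : I → ℝ) (α : ℝ) : ℝ :=
  sInf {r : ℝ | ENNReal.ofReal (1 - α) ≤ μ {θ | hellinger (histDensity θ) c ≤ r}}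

/-- The credible set inflated by the factor `L`: the densities `q` with `h(q, c) ≤ L r_α`. -/
def credibleSet (μ : Measure HistParam) (c : I → ℝ) (L α : ℝ) : Set (I → ℝ) :=
  {q | IsDensity q ∧ hellinger q c ≤ L * credibleRadius μ c α}

/-- The estimator `phat` attains the rate `ε_n(k_n)` uniformly over the class `F`. -/
def CentersAtRate (κ : ℕ) (F : Set (I → ℝ)) (phat : (n : ℕ) → (Fin n → I) → (I → ℝ)) : Prop :=
  ∀ ε : ℝ, 0 < ε → ∃ M : ℝ, 0 < M ∧ ∀ᶠ n in atTop, ENNReal.ofReal (1 - ε) ≤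
    ⨅ p ∈ F, innerProb (sampleLaw p n)
      {y | hellinger p (phat n y) ≤ M * rate p n (oracleBins κ p n)}

end

/-! Write `K` for the oracle number of bins `k_n` and `T = K log n`. The inequalities on the sample
that are needed (`SampleBounds`, `RegularSample`) fail with probability `O(1/n)`, uniformly over the
Hölder class; given them, the argument is deterministic. They yield two facts. The posterior
concentrates on histograms with at most `M K` bins at Hellinger distance at most a multiple of
`√(T/n)` from `p`. Under polished tails, no ball of radius `t √(K/n)`, with `t` small, carries
posterior mass `1 - α`. The first fact gives the size of the credible set. The second bounds its
radius from below, and the two scales differ by the factor `√(log n)` by which the set is inflated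
for coverage.

Contraction. Model `K` has marginal likelihood at least `exp(-E T)` times that of `p`: the Dirichlet
prior gives mass `exp(-O(T))` to weights near the bin probabilities of `p`
(`exists_dirichlet_lower`), and the χ²-distance of `p` to its bin averages is `O(b(K))`
(`integral_sq_sub_binMass_le`, `measure_likelihood_lt_le`). Far from `p`, all histogram likelihoods
are exponentially small, by a covering and the Hellinger affinity
(`measure_exists_likelihood_gt_le`). For `k > M K` it is the prior that penalises: up to factors
`C^k`, a Hellinger ball of squared radius of order `k log n / n` has Dirichlet mass at most `(k
√(log n / n))^(k-1)`, which is a power `n^(-ck)` as long as `k ≤ n^H` with `H < 1/2`. This is where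
`β₀ > 1/2` enters: it makes `T` of smaller order than `n^H` for some such `H`. Beyond `n^H` the
exponential tails of the geometric or Poisson prior take over. The same comparison shows that the
maximiser of the marginal likelihood is at most `M K`, so the empirical posterior is handled as a
hierarchical one whose prior on `k` is a point mass.

Lower bound on the radius. For a set of Hellinger diameter `d` in model `k`, the numerator of the
posterior mass is at most the maximal likelihood times the prior mass. The denominator is at least
the integral over a Euclidean ball of radius `1/√n` around the maximum likelihood weights, where the
likelihood is still `exp(-O(k))` times its maximum (`exists_mle`). A dilation of the simplex
compares the two prior masses (`dirichlet_ball_le`), and the posterior mass is at most `C^k (d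
√(n/k))^(k-1)`. With `d` of order `t √(K/n)` and `K ≤ N k` this is at most `A^k (b t)^(k-1)`, which
is small for small `t` as soon as `k ≥ 2`. The polished tail supplies `K ≤ N k`: the bias of a model
on which the posterior concentrates is `O(T/n)`, and with far fewer than `K` bins this would
contradict the geometric decay of the bias (`exists_oracleBins_le_mul`). The value `k = 1` is
excluded by `κ ≥ 2` or by the distance of `p` from the uniform density. -/

noncomputable section

/-! ### Bins -/

/-- The `j`-th of the `k` regular bins of the unit interval. -/
def bin (k : ℕ) (j : Fin k) : Set I :=
  {x | (j : ℝ) / k ≤ x ∧ (x : ℝ) < ((j : ℝ) + 1) / k}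

lemma measurableSet_bin (k : ℕ) (j : Fin k) : MeasurableSet (bin k j) :=
  (measurableSet_le measurable_const measurable_subtype_coe).inter
    (measurableSet_lt measurable_subtype_coe measurable_const)

lemma volume_bin (k : ℕ) (j : Fin k) : volume (bin k j) = ENNReal.ofReal (1 / k) := by
  have hk : (0 : ℝ) < k := by exact_mod_cast j.pos
  have hj : ((j : ℝ) + 1) / k ≤ 1 := by
    rw [div_le_one hk]; exact_mod_cast j.2
  have : Subtype.val '' bin k j = Ico ((j : ℝ) / k) (((j : ℝ) + 1) / k) := by
    ext x
    simp only [bin, mem_image, mem_ofPred_eq, Subtype.exists, mem_Ico]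
    constructor
    · rintro ⟨y, hy, h, rfl⟩; exact h
    · intro h
      exact ⟨x, ⟨le_trans (by positivity) h.1, h.2.le.trans hj⟩, h, rfl⟩
  rw [unitInterval.volume_apply, this, Real.volume_Ico]
  congr 1; ring

lemma bin_disjoint (k : ℕ) : Pairwise (Function.onFun Disjoint (bin k)) := by
  intro i j hij
  have hk : (0 : ℝ) < k := by exact_mod_cast i.pos
  refine Set.disjoint_left.2 fun x hi hj => hij ?_
  have h1 : (i : ℝ) < j + 1 := by
    have := hi.1.trans_lt hj.2; rwa [div_lt_div_iff_of_pos_right hk] at this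
  have h2 : (j : ℝ) < i + 1 := by
    have := hj.1.trans_lt hi.2; rwa [div_lt_div_iff_of_pos_right hk] at this
  have h1' : (i : ℕ) < j + 1 := by exact_mod_cast h1
  have h2' : (j : ℕ) < i + 1 := by exact_mod_cast h2
  exact Fin.ext (by omega)

lemma exists_mem_bin {k : ℕ} (hk : 0 < k) {x : I} (hx : (x : ℝ) < 1) : ∃ j, x ∈ bin k j := by
  have hk' : (0 : ℝ) < k := by exact_mod_cast hk
  have h0 : 0 ≤ (k : ℝ) * x := mul_nonneg hk'.le x.2.1
  have hlt : ⌊(k : ℝ) * x⌋₊ < k := by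
    rw [Nat.floor_lt h0]; nlinarith
  refine ⟨⟨_, hlt⟩, ?_, ?_⟩
  · rw [div_le_iff₀' hk']; exact Nat.floor_le h0
  · rw [lt_div_iff₀' hk']; exact Nat.lt_floor_add_one _

/-- The bins are half-open, so the endpoint `1` lies in no bin and every histogram vanishes there.
Statements about bins and samples therefore hold only off this null set. -/
lemma ae_coe_lt_one : ∀ᵐ x : I, (x : ℝ) < 1 := by
  have : ∀ᵐ x : I, x ≠ 1 := by simp [ae_iff]
  filter_upwards [this] with x hx
  exact lt_of_le_of_ne x.2.2 fun h => hx (Subtype.ext h)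

lemma iUnion_bin_ae {k : ℕ} (hk : 0 < k) : (⋃ j, bin k j) =ᵐ[volume] (univ : Set I) := by
  filter_upwards [ae_coe_lt_one] with x hx
  exact propext ⟨fun _ => trivial, fun _ => mem_iUnion.2 (exists_mem_bin hk hx)⟩

lemma integral_eq_sum_bin {k : ℕ} (hk : 0 < k) {f : I → ℝ} (hf : Integrable f) :
    ∫ x, f x = ∑ j, ∫ x in bin k j, f x := by
  rw [← setIntegral_univ, ← setIntegral_congr_set (iUnion_bin_ae hk),
    integral_iUnion (measurableSet_bin k) (bin_disjoint k) hf.integrableOn, tsum_fintype]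

lemma setIntegral_bin_const (k : ℕ) (j : Fin k) (c : ℝ) : ∫ _ in bin k j, c = c / k := by
  rw [setIntegral_const, Measure.real, volume_bin, ENNReal.toReal_ofReal (by positivity),
    smul_eq_mul]
  ring

lemma histDensity_of_mem {k : ℕ} (θ : Fin k → ℝ) {j : Fin k} {x : I} (hx : x ∈ bin k j) :
    histDensity ⟨k, θ⟩ x = k * θ j := by
  unfold histDensity
  congr 1
  rw [Finset.sum_eq_single j]
  · exact if_pos hx
  · intro i _ hij
    refine if_neg fun h => ?_
    exact Set.disjoint_left.1 (bin_disjoint k hij) h hx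
  · simp

lemma histDensity_of_one_le (θ : HistParam) {x : I} (hx : ¬ (x : ℝ) < 1) :
    histDensity θ x = 0 := by
  unfold histDensity
  rw [Finset.sum_eq_zero, mul_zero]
  intro j _
  refine if_neg fun h => hx ?_
  have hk : (0 : ℝ) < θ.1 := by exact_mod_cast j.pos
  refine h.2.trans_le ?_
  rw [div_le_one hk]; exact_mod_cast j.2

lemma measurable_histDensity_uncurry (k : ℕ) :
    Measurable fun z : (Fin k → ℝ) × I => histDensity ⟨k, z.1⟩ z.2 := by
  have h (j : Fin k) : Measurable fun z : (Fin k → ℝ) × I =>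
      if (j : ℝ) / k ≤ z.2 ∧ (z.2 : ℝ) < ((j : ℝ) + 1) / k then z.1 j else 0 := by
    refine Measurable.ite ?_ (by fun_prop) measurable_const
    exact (measurableSet_bin k j).preimage measurable_snd
  exact (Finset.measurable_fun_sum Finset.univ fun j _ => h j).const_mul (k : ℝ)

lemma measurable_histDensity (θ : HistParam) : Measurable (histDensity θ) :=
  (measurable_histDensity_uncurry θ.1).comp (measurable_const.prodMk measurable_id)

lemma histDensity_nonneg {k : ℕ} {θ : Fin k → ℝ} (hθ : ∀ j, 0 ≤ θ j) (x : I) :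
    0 ≤ histDensity ⟨k, θ⟩ x := by
  unfold histDensity
  refine mul_nonneg (Nat.cast_nonneg _) (Finset.sum_nonneg fun j _ => ?_)
  split_ifs
  exacts [hθ j, le_rfl]

lemma histDensity_mono {k : ℕ} {θ θ' : Fin k → ℝ} (h : ∀ j, θ j ≤ θ' j) (x : I) :
    histDensity ⟨k, θ⟩ x ≤ histDensity ⟨k, θ'⟩ x := by
  unfold histDensity
  refine mul_le_mul_of_nonneg_left (Finset.sum_le_sum fun j _ => ?_) (Nat.cast_nonneg _)
  dsimp only
  split_ifs
  exacts [h j, le_rfl]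

lemma abs_histDensity_le {k : ℕ} (θ : Fin k → ℝ) (x : I) :
    |histDensity ⟨k, θ⟩ x| ≤ k * ∑ j, |θ j| := by
  unfold histDensity
  rw [abs_mul, Nat.abs_cast]
  refine mul_le_mul_of_nonneg_left ((Finset.abs_sum_le_sum_abs _ _).trans
    (Finset.sum_le_sum fun j _ => ?_)) (Nat.cast_nonneg _)
  dsimp only
  split_ifs
  exacts [le_rfl, by simp]

lemma integrable_histDensity {k : ℕ} (θ : Fin k → ℝ) : Integrable (histDensity ⟨k, θ⟩) :=
  Integrable.of_bound (measurable_histDensity _).aestronglyMeasurable (k * ∑ j, |θ j|)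
    (.of_forall fun x => abs_histDensity_le θ x)

lemma integral_histDensity {k : ℕ} (hk : 0 < k) (θ : Fin k → ℝ) :
    ∫ x, histDensity ⟨k, θ⟩ x = ∑ j, θ j := by
  rw [integral_eq_sum_bin hk (integrable_histDensity θ)]
  refine Finset.sum_congr rfl fun j _ => ?_
  rw [setIntegral_congr_fun (measurableSet_bin k j) fun x hx => histDensity_of_mem θ hx,
    setIntegral_bin_const]
  field_simp

/-! ### The Hellinger distance -/

/-- The square root of `p` is square integrable. -/
abbrev RootL2 (p : I → ℝ) : Prop := MemLp (fun x => √(p x)) 2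

lemma rootL2_of_integrable {p : I → ℝ} (hp : Measurable p) (h0 : ∀ x, 0 ≤ p x)
    (hi : Integrable p) : RootL2 p := by
  refine (memLp_two_iff_integrable_sq hp.sqrt.aestronglyMeasurable).2 ?_
  simpa only [Real.sq_sqrt (h0 _)] using hi

lemma IsDensity.integrable {p : I → ℝ} (hp : IsDensity p) : Integrable p := by
  refine ⟨hp.1.aestronglyMeasurable, ?_⟩
  rw [hasFiniteIntegral_iff_ofReal (.of_forall hp.2.1), hp.2.2]
  exact ENNReal.one_lt_top

lemma IsDensity.integral_eq_one {p : I → ℝ} (hp : IsDensity p) : ∫ x, p x = 1 := by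
  rw [integral_eq_lintegral_of_nonneg_ae (.of_forall hp.2.1) hp.1.aestronglyMeasurable, hp.2.2]
  rfl

lemma IsDensity.rootL2 {p : I → ℝ} (hp : IsDensity p) : RootL2 p :=
  rootL2_of_integrable hp.1 hp.2.1 hp.integrable

lemma rootL2_histDensity {k : ℕ} (θ : Fin k → ℝ) : RootL2 (histDensity ⟨k, θ⟩) := by
  refine MemLp.of_bound (measurable_histDensity _).sqrt.aestronglyMeasurable
    (√(k * ∑ j, |θ j|)) (.of_forall fun x => ?_)
  rw [Real.norm_of_nonneg (Real.sqrt_nonneg _)]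
  exact Real.sqrt_le_sqrt ((le_abs_self _).trans (abs_histDensity_le θ x))

lemma RootL2.integrable_sq_sub {p q : I → ℝ} (hp : RootL2 p) (hq : RootL2 q) :
    Integrable fun x => (√(p x) - √(q x)) ^ 2 :=
  (MemLp.sub hp hq).integrable_sq

lemma hellinger_nonneg (p q : I → ℝ) : 0 ≤ hellinger p q := Real.sqrt_nonneg _

lemma hellinger_sq (p q : I → ℝ) : hellinger p q ^ 2 = ∫ x, (√(p x) - √(q x)) ^ 2 :=
  Real.sq_sqrt (integral_nonneg fun _ => sq_nonneg _)

lemma hellinger_comm (p q : I → ℝ) : hellinger p q = hellinger q p := by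
  unfold hellinger
  congr 2 with x
  ring

lemma hellinger_eq_norm {p q : I → ℝ} (hp : RootL2 p) (hq : RootL2 q) :
    hellinger p q = ‖hp.toLp _ - hq.toLp _‖ := by
  rw [← MemLp.toLp_sub, Lp.norm_toLp,
    MemLp.eLpNorm_eq_integral_rpow_norm (by norm_num) (by norm_num) (MemLp.sub hp hq),
    ENNReal.toReal_ofReal (by positivity)]
  unfold hellinger
  rw [Real.sqrt_eq_rpow]
  simp

lemma hellinger_triangle {p q r : I → ℝ} (hp : RootL2 p) (hq : RootL2 q) (hr : RootL2 r) :
    hellinger p r ≤ hellinger p q + hellinger q r := by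
  rw [hellinger_eq_norm hp hq, hellinger_eq_norm hq hr, hellinger_eq_norm hp hr]
  exact norm_sub_le_norm_sub_add_norm_sub _ _ _

lemma hellinger_hist_sq {k : ℕ} (hk : 0 < k) (θ θ' : Fin k → ℝ) :
    hellinger (histDensity ⟨k, θ⟩) (histDensity ⟨k, θ'⟩) ^ 2 = ∑ j, (√(θ j) - √(θ' j)) ^ 2 := by
  rw [hellinger_sq, integral_eq_sum_bin hk
    ((rootL2_histDensity θ).integrable_sq_sub (rootL2_histDensity θ'))]
  refine Finset.sum_congr rfl fun j _ => ?_
  have hk' : (0 : ℝ) < k := by exact_mod_cast hk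
  have : ∀ x ∈ bin k j, (√(histDensity ⟨k, θ⟩ x) - √(histDensity ⟨k, θ'⟩ x)) ^ 2 =
      k * (√(θ j) - √(θ' j)) ^ 2 := by
    intro x hx
    rw [histDensity_of_mem θ hx, histDensity_of_mem θ' hx, Real.sqrt_mul hk'.le,
      Real.sqrt_mul hk'.le, ← mul_sub, mul_pow, Real.sq_sqrt hk'.le]
  rw [setIntegral_congr_fun (measurableSet_bin k j) this, setIntegral_bin_const]
  field_simp

lemma measurable_hellinger_hist {q : I → ℝ} (hq : Measurable q) (k : ℕ) :
    Measurable fun θ : Fin k → ℝ => hellinger (histDensity ⟨k, θ⟩) q := by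
  unfold hellinger
  refine Measurable.sqrt (StronglyMeasurable.measurable ?_)
  have h : Measurable fun z : (Fin k → ℝ) × I => (√(histDensity ⟨k, z.1⟩ z.2) - √(q z.2)) ^ 2 :=
    ((measurable_histDensity_uncurry k).sqrt.sub (hq.comp measurable_snd).sqrt).pow_const 2
  exact h.stronglyMeasurable.integral_prod_right'

lemma integrable_sqrt_mul_sqrt {p q : I → ℝ} (hp : RootL2 p) (hq : RootL2 q) :
    Integrable fun x => √(p x) * √(q x) :=
  MemLp.integrable_mul hp hq

lemma integral_sqrt_mul_sqrt {p q : I → ℝ} (hp : Measurable p) (hp0 : ∀ x, 0 ≤ p x)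
    (hpi : Integrable p) (hq : Measurable q) (hq0 : ∀ x, 0 ≤ q x) (hqi : Integrable q) :
    ∫ x, √(p x) * √(q x) = ((∫ x, p x) + (∫ x, q x) - hellinger p q ^ 2) / 2 := by
  have h1 := rootL2_of_integrable hp hp0 hpi
  have h2 := rootL2_of_integrable hq hq0 hqi
  have : ∀ x, √(p x) * √(q x) = (p x + q x - (√(p x) - √(q x)) ^ 2) / 2 := by
    intro x
    have a := Real.sq_sqrt (hp0 x)
    have b := Real.sq_sqrt (hq0 x)
    nlinarith
  rw [hellinger_sq]
  simp_rw [this]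
  have h3 : Integrable fun x => p x + q x := hpi.add hqi
  rw [integral_div, integral_sub h3 (h1.integrable_sq_sub h2), integral_add hpi hqi]

lemma isDensity_histDensity {k : ℕ} {θ : Fin k → ℝ} (hθ : θ ∈ stdSimplex ℝ (Fin k)) :
    IsDensity (histDensity ⟨k, θ⟩) := by
  have hk : 0 < k := by
    rcases Nat.eq_zero_or_pos k with rfl | h
    · simpa using hθ.2
    · exact h
  refine ⟨measurable_histDensity _, histDensity_nonneg hθ.1, ?_⟩
  rw [← ofReal_integral_eq_lintegral_ofReal (integrable_histDensity θ)
    (.of_forall (histDensity_nonneg hθ.1)), integral_histDensity hk, hθ.2, ENNReal.ofReal_one]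

/-! ### Products over the sample -/

lemma IsDensity.isProbabilityMeasure {p : I → ℝ} (hp : IsDensity p) :
    IsProbabilityMeasure ((volume : Measure I).withDensity fun x => ENNReal.ofReal (p x)) :=
  ⟨by rw [withDensity_apply _ MeasurableSet.univ, setLIntegral_univ, hp.2.2]⟩

lemma IsDensity.isProbabilityMeasure_sampleLaw {p : I → ℝ} (hp : IsDensity p) (n : ℕ) :
    IsProbabilityMeasure (sampleLaw p n) := by
  have := hp.isProbabilityMeasure
  unfold sampleLaw
  infer_instance

lemma lintegral_prod_pi {Ω : Type*} [MeasurableSpace Ω] (μ : Measure Ω) [IsProbabilityMeasure μ]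
    (n : ℕ) {f : Ω → ℝ≥0∞} (hf : Measurable f) :
    ∫⁻ y : Fin n → Ω, ∏ i, f (y i) ∂(Measure.pi fun _ => μ) = (∫⁻ x, f x ∂μ) ^ n := by
  have h := iIndepFun_pi (μ := fun _ : Fin n => μ) (X := fun _ => f) fun _ => hf.aemeasurable
  rw [lintegral_prod_eq_prod_lintegral_of_indepFun Finset.univ _ h fun i => by fun_prop]
  have h2 (i : Fin n) : ∫⁻ y : Fin n → Ω, f (y i) ∂(Measure.pi fun _ => μ) = ∫⁻ x, f x ∂μ :=
    (measurePreserving_eval (fun _ : Fin n => μ) i).lintegral_comp hf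
  simp [h2]

lemma lintegral_prod_sampleLaw {p : I → ℝ} (hp : IsDensity p) (n : ℕ) {f : I → ℝ≥0∞}
    (hf : Measurable f) :
    ∫⁻ y, ∏ i, f (y i) ∂(sampleLaw p n) = (∫⁻ x, ENNReal.ofReal (p x) * f x) ^ n := by
  have := hp.isProbabilityMeasure
  unfold sampleLaw
  rw [lintegral_prod_pi _ _ hf, lintegral_withDensity_eq_lintegral_mul _ hp.1.ennreal_ofReal hf]
  rfl

lemma ae_sampleLaw_lt_one {p : I → ℝ} (hp : IsDensity p) (n : ℕ) :
    ∀ᵐ y ∂(sampleLaw p n), ∀ i, (y i : ℝ) < 1 := by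
  have := hp.isProbabilityMeasure
  rw [ae_all_iff]
  intro i
  have h : ∀ᵐ x : I ∂((volume : Measure I).withDensity fun x => ENNReal.ofReal (p x)), (x : ℝ) < 1 :=
    (withDensity_absolutelyContinuous _ _).ae_le ae_coe_lt_one
  exact (Measure.tendsto_eval_ae_ae (μ := fun _ : Fin n =>
    (volume : Measure I).withDensity fun x => ENNReal.ofReal (p x)) (i := i)).eventually h

/-- The joint density of a sample. -/
def jointDensity (p : I → ℝ) {n : ℕ} (y : Fin n → I) : ℝ := ∏ i, p (y i)

lemma likelihood_eq {n k : ℕ} (y : Fin n → I) {θ : Fin k → ℝ} (hθ : ∀ j, 0 ≤ θ j) :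
    likelihood y ⟨k, θ⟩ = ENNReal.ofReal (jointDensity (histDensity ⟨k, θ⟩) y) :=
  (ENNReal.ofReal_prod_of_nonneg fun _ _ => histDensity_nonneg hθ _).symm

lemma jointDensity_nonneg {p : I → ℝ} (hp : ∀ x, 0 ≤ p x) {n : ℕ} (y : Fin n → I) :
    0 ≤ jointDensity p y := Finset.prod_nonneg fun _ _ => hp _

lemma jointDensity_pos {p : I → ℝ} (hp : ∀ x, 0 < p x) {n : ℕ} (y : Fin n → I) :
    0 < jointDensity p y := Finset.prod_pos fun _ _ => hp _

lemma measurable_likelihood_uncurry (n k : ℕ) :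
    Measurable fun z : (Fin n → I) × (Fin k → ℝ) => likelihood z.1 ⟨k, z.2⟩ := by
  unfold likelihood
  refine Finset.measurable_fun_prod _ fun i _ => Measurable.ennreal_ofReal ?_
  exact (measurable_histDensity_uncurry k).comp
    (measurable_snd.prodMk ((measurable_pi_apply i).comp measurable_fst))

lemma measurable_likelihood {n : ℕ} (y : Fin n → I) (k : ℕ) :
    Measurable fun θ : Fin k → ℝ => likelihood y ⟨k, θ⟩ := by
  unfold likelihood
  refine Finset.measurable_fun_prod _ fun i _ => Measurable.ennreal_ofReal ?_
  exact (measurable_histDensity_uncurry k).comp (measurable_id.prodMk measurable_const)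

lemma measurable_jointDensity {p : I → ℝ} (hp : Measurable p) (n : ℕ) :
    Measurable fun y : Fin n → I => jointDensity p y :=
  Finset.measurable_fun_prod (f := fun (i : Fin n) (y : Fin n → I) => p (y i)) Finset.univ
    fun i _ => hp.comp (measurable_pi_apply i)

/-! ### Uniform upper bound on the likelihood ratio away from the truth -/

lemma sq_sqrt_sub_sqrt_le {a b : ℝ} (ha : 0 ≤ a) (hab : a ≤ b) : (√a - √b) ^ 2 ≤ b - a := by
  have h1 := Real.sq_sqrt ha
  have h2 := Real.sq_sqrt (ha.trans hab)
  have h3 := Real.sqrt_le_sqrt hab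
  nlinarith [Real.sqrt_nonneg a]

/-- Under `p` the root of `q / p` has mean `∫ √(pq)`, the Hellinger affinity, and means of products
over the sample factorise. The mass of `q` is left free because the result is applied to histograms
with rounded-up weights. -/
lemma lintegral_sqrt_ratio {p q : I → ℝ} (hp : IsDensity p) (hp0 : ∀ x, 0 < p x)
    (hq : Measurable q) (hq0 : ∀ x, 0 ≤ q x) (hqi : Integrable q) (n : ℕ) :
    ∫⁻ y, ∏ i, ENNReal.ofReal √(q (y i) / p (y i)) ∂(sampleLaw p n) =
      ENNReal.ofReal (((∫ x, q x) + 1 - hellinger q p ^ 2) / 2) ^ n := by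
  have hm : Measurable fun x => ENNReal.ofReal √(q x / p x) :=
    (hq.div hp.1).sqrt.ennreal_ofReal
  rw [lintegral_prod_sampleLaw hp n hm, ← hp.integral_eq_one,
    ← integral_sqrt_mul_sqrt hq hq0 hqi hp.1 hp.2.1 hp.integrable,
    ofReal_integral_eq_lintegral_ofReal
      (integrable_sqrt_mul_sqrt (rootL2_of_integrable hq hq0 hqi) hp.rootL2)
      (.of_forall fun x => by positivity)]
  congr 2 with x
  rw [← ENNReal.ofReal_mul (hp0 x).le]
  congr 1
  rw [Real.sqrt_div (hq0 x)]
  have := Real.sq_sqrt (hp0 x).le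
  have h2 := Real.sqrt_pos.2 (hp0 x)
  field_simp
  rw [this, mul_comm]

/-- Each weight vector is rounded up to a finite grid. Rounding up only increases the likelihood, so
Markov's inequality for the root likelihood ratios of the at most `(nk+1)^k` grid points controls
the supremum over the simplex. -/
lemma measure_exists_likelihood_gt_le {p : I → ℝ} (hp : IsDensity p) (hp0 : ∀ x, 0 < p x)
    {n k : ℕ} (hn : 0 < n) (hk : 0 < k) {r : ℝ} (hr : 0 ≤ r) (hnr : 4 ≤ n * r ^ 2) :
    sampleLaw p n {y | ∃ θ ∈ stdSimplex ℝ (Fin k), r ≤ hellinger (histDensity ⟨k, θ⟩) p ∧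
        Real.exp (-(n * r ^ 2 / 8)) * jointDensity p y < jointDensity (histDensity ⟨k, θ⟩) y} ≤
      ENNReal.ofReal (((n * k + 1 : ℕ) : ℝ) ^ k * Real.exp (1 / 2 - n * r ^ 2 / 16)) := by
  classical
  have hn' : (0 : ℝ) < n := by exact_mod_cast hn
  have hk' : (0 : ℝ) < k := by exact_mod_cast hk
  have hnk : (0 : ℝ) < n * k := by positivity
  -- With mesh `1/(nk)`, rounding up `k` weights adds at most `1/n` to the total mass, which costs
  -- only a constant factor after taking `n`-th powers.
  let G (g : Fin k → Fin (n * k + 1)) : Fin k → ℝ := fun j => (g j : ℕ) / (n * k : ℝ)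
  have hG0 (g) (j) : 0 ≤ G g j := by simp only [G]; positivity
  let A : Finset (Fin k → Fin (n * k + 1)) := Finset.univ.filter fun g =>
    ∑ j, G g j ≤ 1 + 1 / n ∧ r / 2 ≤ hellinger (histDensity ⟨k, G g⟩) p
  let F (y : Fin n → I) : ℝ≥0∞ :=
    ∑ g ∈ A, ∏ i, ENNReal.ofReal √(histDensity ⟨k, G g⟩ (y i) / p (y i))
  have hF : Measurable F := by
    refine Finset.measurable_fun_sum _ fun g _ => Finset.measurable_fun_prod _ fun i _ => ?_
    refine (Measurable.sqrt ?_).ennreal_ofReal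
    exact ((measurable_histDensity _).comp (measurable_pi_apply i)).div
      (hp.1.comp (measurable_pi_apply i))
  have hEF : ∫⁻ y, F y ∂(sampleLaw p n) ≤
      ENNReal.ofReal (((n * k + 1 : ℕ) : ℝ) ^ k * Real.exp (1 / 2 - n * r ^ 2 / 8)) := by
    rw [lintegral_finsetSum]
    swap
    · intro g _
      refine Finset.measurable_fun_prod _ fun i _ => ?_
      refine (Measurable.sqrt ?_).ennreal_ofReal
      exact ((measurable_histDensity _).comp (measurable_pi_apply i)).div
        (hp.1.comp (measurable_pi_apply i))
    have hb : ∀ g ∈ A, ∫⁻ y, ∏ i, ENNReal.ofReal √(histDensity ⟨k, G g⟩ (y i) / p (y i))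
        ∂(sampleLaw p n) ≤ ENNReal.ofReal (Real.exp (1 / 2 - n * r ^ 2 / 8)) := by
      intro g hg
      obtain ⟨hg1, hg2⟩ := (Finset.mem_filter.1 hg).2
      rw [lintegral_sqrt_ratio hp hp0 (measurable_histDensity _) (histDensity_nonneg (hG0 g))
        (integrable_histDensity _), integral_histDensity hk]
      -- Mass at most `1 + 1/n` and distance at least `r/2` bound the affinity by `1 + 1/(2n) -
      -- r²/8`.
      have hle : (∑ j, G g j + 1 - hellinger (histDensity ⟨k, G g⟩) p ^ 2) / 2 ≤
          Real.exp (1 / (2 * n) - r ^ 2 / 8) := by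
        have h1 : (r / 2) ^ 2 ≤ hellinger (histDensity ⟨k, G g⟩) p ^ 2 :=
          pow_le_pow_left₀ (by positivity) hg2 2
        have h2 := Real.add_one_le_exp (1 / (2 * n) - r ^ 2 / 8 : ℝ)
        have h3 : (1 : ℝ) / (2 * n) = 1 / n / 2 := by field_simp
        rw [h3] at h2 ⊢
        nlinarith
      refine (pow_le_pow_left₀ (by positivity) (ENNReal.ofReal_le_ofReal hle) n).trans ?_
      rw [← ENNReal.ofReal_pow (Real.exp_pos _).le, ← Real.exp_nat_mul]
      refine le_of_eq ?_
      congr 2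
      field_simp
    refine (Finset.sum_le_card_nsmul A _ _ hb).trans ?_
    rw [nsmul_eq_mul, ENNReal.ofReal_mul (by positivity)]
    refine mul_le_mul_left ?_ _
    have hc : A.card ≤ (n * k + 1) ^ k := by
      refine (Finset.card_le_univ A).trans ?_
      simp
    rw [← Nat.cast_pow, ENNReal.ofReal_natCast]
    exact_mod_cast hc
  have hsub : {y : Fin n → I | ∃ θ ∈ stdSimplex ℝ (Fin k),
      r ≤ hellinger (histDensity ⟨k, θ⟩) p ∧ Real.exp (-(n * r ^ 2 / 8)) * jointDensity p y <
        jointDensity (histDensity ⟨k, θ⟩) y} ⊆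
      {y | ENNReal.ofReal (Real.exp (-(n * r ^ 2 / 16))) ≤ F y} := by
    rintro y ⟨θ, hθ, hrθ, hy⟩
    have hθ1 (j) : θ j ≤ 1 := by
      rw [← hθ.2]; exact Finset.single_le_sum (fun i _ => hθ.1 i) (Finset.mem_univ j)
    let g : Fin k → Fin (n * k + 1) := fun j => ⟨⌈(n * k : ℝ) * θ j⌉₊, by
      rw [Nat.lt_succ_iff, Nat.ceil_le]
      push_cast
      nlinarith [hθ1 j]⟩
    have hg1 (j) : θ j ≤ G g j := by
      simp only [G, g]
      rw [le_div_iff₀ hnk, mul_comm]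
      exact Nat.le_ceil _
    have hg2 (j) : G g j ≤ θ j + 1 / (n * k) := by
      simp only [G, g]
      rw [div_le_iff₀ hnk]
      have := (Nat.ceil_lt_add_one (mul_nonneg hnk.le (hθ.1 j))).le
      have h2 : (θ j + 1 / (n * k)) * (n * k) = n * k * θ j + 1 := by field_simp
      rw [h2]; exact this
    have hs : ∑ j, G g j ≤ 1 + 1 / n := by
      refine (Finset.sum_le_sum fun j _ => hg2 j).trans ?_
      rw [Finset.sum_add_distrib, hθ.2]
      simp only [Finset.sum_const, Finset.card_univ, Fintype.card_fin, nsmul_eq_mul]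
      refine le_of_eq ?_
      field_simp
    -- The squared distance is at most the added mass `1/n`, which is at most `(r/2)²` by `hnr`; so
    -- the rounded histogram is still at distance `r/2` from `p`.
    have hh : hellinger (histDensity ⟨k, θ⟩) (histDensity ⟨k, G g⟩) ≤ r / 2 := by
      refine abs_le_of_sq_le_sq' ?_ (by positivity) |>.2
      rw [hellinger_hist_sq hk]
      calc ∑ j, (√(θ j) - √(G g j)) ^ 2 ≤ ∑ j, (G g j - θ j) :=
            Finset.sum_le_sum fun j _ => sq_sqrt_sub_sqrt_le (hθ.1 j) (hg1 j)
        _ ≤ 1 / n := by rw [Finset.sum_sub_distrib, hθ.2]; linarith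
        _ ≤ (r / 2) ^ 2 := by rw [div_le_iff₀ hn']; nlinarith
    have hA : g ∈ A := by
      refine Finset.mem_filter.2 ⟨Finset.mem_univ _, hs, ?_⟩
      have := hellinger_triangle (rootL2_histDensity θ) (rootL2_histDensity (G g)) hp.rootL2
      linarith
    refine le_trans ?_ (Finset.single_le_sum
      (f := fun g => ∏ i, ENNReal.ofReal √(histDensity ⟨k, G g⟩ (y i) / p (y i)))
      (fun _ _ => zero_le) hA)
    rw [← ENNReal.ofReal_prod_of_nonneg fun _ _ => Real.sqrt_nonneg _]
    refine ENNReal.ofReal_le_ofReal ?_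
    rw [← Real.sqrt_prod _ fun i _ => div_nonneg (histDensity_nonneg (hG0 g) _) (hp0 _).le]
    refine Real.le_sqrt_of_sq_le ?_
    have hpp : 0 < ∏ i, p (y i) := jointDensity_pos hp0 y
    rw [← Real.exp_nat_mul, Finset.prod_div_distrib, le_div_iff₀ hpp]
    have he : ((2 : ℕ) : ℝ) * -(n * r ^ 2 / 16) = -(n * r ^ 2 / 8) := by push_cast; ring
    rw [he]
    refine hy.le.trans ?_
    exact Finset.prod_le_prod (fun i _ => histDensity_nonneg hθ.1 _)
      fun i _ => histDensity_mono hg1 _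
  refine (measure_mono hsub).trans ?_
  refine (meas_ge_le_lintegral_div hF.aemeasurable
    (by simpa using Real.exp_pos _) ENNReal.ofReal_ne_top).trans ?_
  refine (ENNReal.div_le_div_right hEF _).trans ?_
  rw [← ENNReal.ofReal_div_of_pos (Real.exp_pos _), mul_div_assoc, ← Real.exp_sub]
  refine le_of_eq ?_
  congr 3
  ring

/-! ### Lower bound on the likelihood ratio near the truth -/

/-- Markov's inequality for `∏ p / q`, whose mean under `p` is the `n`-th power of `∫ p²/q`. The
identity `p²/q = 2p - q + (p - q)²/q` shows this integral to be one plus a χ²-distance, at most `1 +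
V/c`. -/
lemma measure_likelihood_lt_le {p q : I → ℝ} (hp : IsDensity p) (hq : IsDensity q) {c V : ℝ}
    (hc : 0 < c) (hp0 : ∀ x, 0 < p x) (hqc : ∀ x : I, (x : ℝ) < 1 → c ≤ q x)
    (hi : Integrable fun x => (p x - q x) ^ 2) (hV : ∫ x, (p x - q x) ^ 2 ≤ V) (n : ℕ) (t : ℝ) :
    sampleLaw p n {y | jointDensity q y < Real.exp (-t) * jointDensity p y} ≤
      ENNReal.ofReal (Real.exp (n * V / c - t)) := by
  let f (x : I) : ℝ≥0∞ := ENNReal.ofReal (p x / q x)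
  have hf : Measurable f := (hp.1.div hq.1).ennreal_ofReal
  have hE : ∫⁻ y, ∏ i, f (y i) ∂(sampleLaw p n) ≤ ENNReal.ofReal (Real.exp (n * V / c)) := by
    rw [lintegral_prod_sampleLaw hp n hf]
    have h1 : ∫⁻ x, ENNReal.ofReal (p x) * f x ≤ ENNReal.ofReal (1 + V / c) := by
      have hle : ∀ᵐ x : I, ENNReal.ofReal (p x) * f x ≤
          ENNReal.ofReal (2 * p x - q x + (p x - q x) ^ 2 / c) := by
        filter_upwards [ae_coe_lt_one] with x hx
        have hqx := hqc x hx
        have hq0 : 0 < q x := hc.trans_le hqx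
        rw [← ENNReal.ofReal_mul (hp0 x).le]
        refine ENNReal.ofReal_le_ofReal ?_
        have : p x * (p x / q x) = 2 * p x - q x + (p x - q x) ^ 2 / q x := by
          field_simp; ring
        rw [this]
        gcongr
      refine (lintegral_mono_ae hle).trans ?_
      have hi2 : Integrable fun x => 2 * p x - q x + (p x - q x) ^ 2 / c :=
        ((hp.integrable.const_mul 2).sub hq.integrable).add (hi.div_const c)
      rw [← ofReal_integral_eq_lintegral_ofReal hi2]
      · refine ENNReal.ofReal_le_ofReal ?_
        have hi3 : Integrable fun x => 2 * p x - q x :=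
          (hp.integrable.const_mul 2).sub hq.integrable
        rw [integral_add hi3 (hi.div_const c),
          integral_sub (hp.integrable.const_mul 2) hq.integrable, integral_const_mul,
          integral_div, hp.integral_eq_one, hq.integral_eq_one]
        have : (∫ x, (p x - q x) ^ 2) / c ≤ V / c := by gcongr
        linarith
      · filter_upwards [ae_coe_lt_one] with x hx
        have hqx := hqc x hx
        have hq0 : 0 < q x := hc.trans_le hqx
        have h1 : (p x - q x) ^ 2 / q x ≤ (p x - q x) ^ 2 / c := by gcongr
        have h2 : p x * (p x / q x) = 2 * p x - q x + (p x - q x) ^ 2 / q x := by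
          field_simp; ring
        have h3 : 0 ≤ p x * (p x / q x) := by have := hp0 x; positivity
        simp only [Pi.zero_apply]
        linarith
    refine (pow_le_pow_left₀ (by positivity) h1 n).trans ?_
    have hV0 : 0 ≤ V := (integral_nonneg fun _ => sq_nonneg _).trans hV
    have h2 : 1 + V / c ≤ Real.exp (V / c) := by linarith [Real.add_one_le_exp (V / c)]
    refine (pow_le_pow_left₀ (by positivity) (ENNReal.ofReal_le_ofReal h2) n).trans ?_
    rw [← ENNReal.ofReal_pow (Real.exp_pos _).le, ← Real.exp_nat_mul, mul_div_assoc]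
  have hsub : {y : Fin n → I | jointDensity q y < Real.exp (-t) * jointDensity p y} ≤ᵐ[sampleLaw p n]
      {y | ENNReal.ofReal (Real.exp t) ≤ ∏ i, f (y i)} := by
    filter_upwards [ae_sampleLaw_lt_one hp n] with y hy (hlt : _ < _)
    change _ ≤ _
    have hqp : ∀ i, 0 < q (y i) := fun i => hc.trans_le (hqc _ (hy i))
    rw [← ENNReal.ofReal_prod_of_nonneg fun i _ => div_nonneg (hp0 _).le (hqp i).le]
    refine ENNReal.ofReal_le_ofReal ?_
    have hq' : 0 < ∏ i, q (y i) := Finset.prod_pos fun i _ => hqp i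
    rw [Finset.prod_div_distrib, le_div_iff₀ hq']
    have := mul_le_mul_of_nonneg_left hlt.le (Real.exp_pos t).le
    rw [← mul_assoc, ← Real.exp_add, add_neg_cancel, Real.exp_zero, one_mul] at this
    exact this
  refine (measure_mono_ae hsub).trans ?_
  refine (meas_ge_le_lintegral_div (Finset.measurable_fun_prod _ fun i _ =>
    hf.comp (measurable_pi_apply i)).aemeasurable
    (by simpa using Real.exp_pos _) ENNReal.ofReal_ne_top).trans ?_
  refine (ENNReal.div_le_div_right hE _).trans ?_
  rw [← ENNReal.ofReal_div_of_pos (Real.exp_pos _), ← Real.exp_sub]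

/-! ### Integrated likelihood ratios -/

/-- By Fubini the integrated likelihood ratio over `B` has mean at most `π B`, since each ratio `p_θ
/ p` has mean one under `p`. Markov's inequality then turns small prior mass into small integrated
likelihood. -/
lemma measure_setLIntegral_likelihood_gt_le {p : I → ℝ} (hp : IsDensity p) (hp0 : ∀ x, 0 < p x)
    {n k : ℕ} (π : Measure (Fin k → ℝ)) [SFinite π]
    (hπ : ∀ᵐ θ ∂π, θ ∈ stdSimplex ℝ (Fin k)) (B : Set (Fin k → ℝ)) {s : ℝ} (hs : 0 < s) :
    sampleLaw p n {y | ENNReal.ofReal (s * jointDensity p y) <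
        ∫⁻ θ in B, likelihood y ⟨k, θ⟩ ∂π} ≤ π B / ENNReal.ofReal s := by
  have := hp.isProbabilityMeasure_sampleLaw n
  let f (y : Fin n → I) (θ : Fin k → ℝ) : ℝ≥0∞ :=
    likelihood y ⟨k, θ⟩ * ENNReal.ofReal (jointDensity p y)⁻¹
  have hf : Measurable (Function.uncurry f) :=
    (measurable_likelihood_uncurry n k).mul
      ((measurable_jointDensity hp.1 n).comp measurable_fst).inv.ennreal_ofReal
  have hE : ∫⁻ y, ∫⁻ θ in B, f y θ ∂π ∂(sampleLaw p n) ≤ π B := by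
    rw [lintegral_lintegral_swap hf.aemeasurable]
    have : ∀ᵐ θ ∂(π.restrict B), ∫⁻ y, f y θ ∂(sampleLaw p n) ≤ 1 := by
      filter_upwards [ae_restrict_of_ae hπ] with θ hθ
      have h1 (y : Fin n → I) : f y θ =
          ∏ i, ENNReal.ofReal (histDensity ⟨k, θ⟩ (y i) / p (y i)) := by
        simp only [f]
        rw [likelihood_eq y hθ.1, ← ENNReal.ofReal_mul
          (jointDensity_nonneg (histDensity_nonneg hθ.1) y), ← div_eq_mul_inv,
          ← ENNReal.ofReal_prod_of_nonneg fun i _ =>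
            div_nonneg (histDensity_nonneg hθ.1 _) (hp0 _).le, Finset.prod_div_distrib]
        rfl
      simp_rw [h1]
      have hm : Measurable fun x => ENNReal.ofReal (histDensity ⟨k, θ⟩ x / p x) :=
        ((measurable_histDensity _).div hp.1).ennreal_ofReal
      rw [lintegral_prod_sampleLaw hp n hm]
      refine pow_le_one₀ (by positivity) (le_of_eq ?_)
      rw [← (isDensity_histDensity hθ).2.2]
      congr 1 with x
      rw [← ENNReal.ofReal_mul (hp0 x).le, mul_div_cancel₀ _ (hp0 x).ne']
    refine (lintegral_mono_ae this).trans ?_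
    simp
  have hm : Measurable fun y => ∫⁻ θ in B, f y θ ∂π := hf.lintegral_prod_right'
  have hsub : {y : Fin n → I | ENNReal.ofReal (s * jointDensity p y) <
      ∫⁻ θ in B, likelihood y ⟨k, θ⟩ ∂π} ⊆ {y | ENNReal.ofReal s ≤ ∫⁻ θ in B, f y θ ∂π} := by
    intro y hy
    have hy' : ENNReal.ofReal (s * jointDensity p y) ≤ ∫⁻ θ in B, likelihood y ⟨k, θ⟩ ∂π :=
      le_of_lt hy
    have hj := jointDensity_pos hp0 y
    change ENNReal.ofReal s ≤ ∫⁻ θ in B, f y θ ∂π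
    simp only [f]
    rw [lintegral_mul_const _ (measurable_likelihood y k)]
    refine le_trans (le_of_eq ?_) (mul_le_mul_left hy' _)
    rw [← ENNReal.ofReal_mul (by positivity), mul_assoc, mul_inv_cancel₀ hj.ne', mul_one]
  refine (measure_mono hsub).trans ?_
  refine (meas_ge_le_lintegral_div hm.aemeasurable
    (by simpa using hs) ENNReal.ofReal_ne_top).trans ?_
  exact ENNReal.div_le_div_right hE _

/-! ### The Dirichlet distribution -/

lemma lintegral_fin_prod_eq_prod {n : ℕ} (μ : Fin n → Measure ℝ) [∀ i, SigmaFinite (μ i)]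
    {f : Fin n → ℝ → ℝ≥0∞} (hf : ∀ i, Measurable (f i)) :
    ∫⁻ x, ∏ i, f i (x i) ∂(Measure.pi μ) = ∏ i, ∫⁻ x, f i x ∂(μ i) := by
  induction n with
  | zero => simp
  | succ n ih =>
    have h := (measurePreserving_piFinSuccAbove μ 0).symm
    rw [← h.lintegral_comp_emb (MeasurableEquiv.measurableEmbedding _)]
    simp_rw [Fin.prod_univ_succ]
    simp only [MeasurableEquiv.piFinSuccAbove_symm_apply, Fin.insertNthEquiv,
      Fin.insertNth_zero', Equiv.coe_fn_mk, Fin.cons_zero, Fin.cons_succ]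
    have hm : Measurable fun x : Fin n → ℝ => ∏ i, f (Fin.succ i) (x i) :=
      Finset.measurable_fun_prod _ fun i _ => (hf _).comp (measurable_pi_apply i)
    rw [lintegral_prod_mul (g := fun x : Fin n → ℝ => ∏ i, f (Fin.succ i) (x i))
      (hf 0).aemeasurable hm.aemeasurable]
    congr 1
    exact ih (fun i => μ i.succ) fun i => hf _

lemma pi_gammaMeasure {k : ℕ} (a : Fin k → ℝ) (ha : ∀ j, 0 < a j) :
    (Measure.pi fun j => gammaMeasure (a j) 1) =
      (volume : Measure (Fin k → ℝ)).withDensity fun g => ∏ j, gammaPDF (a j) 1 (g j) := by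
  have : ∀ j, IsProbabilityMeasure (gammaMeasure (a j) 1) := fun j =>
    isProbabilityMeasure_gammaMeasure (ha j) one_pos
  have hm (j) : Measurable (gammaPDF (a j) 1) := (measurable_gammaPDFReal _ _).ennreal_ofReal
  refine Measure.pi_eq fun s hs => ?_
  rw [withDensity_apply _ (MeasurableSet.univ_pi hs), ← lintegral_indicator
    (MeasurableSet.univ_pi hs)]
  have h1 (g : Fin k → ℝ) : (Set.univ.pi s).indicator
      (fun g => ∏ j, gammaPDF (a j) 1 (g j)) g =
      ∏ j, (s j).indicator (gammaPDF (a j) 1) (g j) := by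
    by_cases hg : g ∈ Set.univ.pi s
    · rw [indicator_of_mem hg]
      exact Finset.prod_congr rfl fun j _ => (indicator_of_mem (hg j trivial) _).symm
    · rw [indicator_of_notMem hg]
      simp only [mem_univ_pi, not_forall] at hg
      obtain ⟨j, hj⟩ := hg
      exact (Finset.prod_eq_zero (Finset.mem_univ j) (indicator_of_notMem hj _)).symm
  simp_rw [h1]
  rw [volume_pi, lintegral_fin_prod_eq_prod _ fun j => (hm j).indicator (hs j)]
  refine Finset.prod_congr rfl fun j _ => ?_
  rw [lintegral_indicator (hs j), gammaMeasure, withDensity_apply _ (hs j)]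

lemma measurable_normalize (k : ℕ) :
    Measurable fun (g : Fin k → ℝ) (j : Fin k) => g j / ∑ i, g i := by
  fun_prop

lemma isProbabilityMeasure_dirichlet {k : ℕ} {a : Fin k → ℝ} (ha : ∀ j, 0 < a j) :
    IsProbabilityMeasure (dirichlet a) := by
  have : ∀ j, IsProbabilityMeasure (gammaMeasure (a j) 1) := fun j =>
    isProbabilityMeasure_gammaMeasure (ha j) one_pos
  exact Measure.isProbabilityMeasure_map (measurable_normalize k).aemeasurable

lemma ae_gammaMeasure_pos (a : ℝ) : ∀ᵐ x ∂(gammaMeasure a 1), 0 < x := by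
  rw [ae_iff, gammaMeasure]
  simp only [not_lt]
  rw [show {x : ℝ | x ≤ 0} = Iic 0 from rfl, withDensity_apply _ measurableSet_Iic,
    ← setLIntegral_congr Iio_ae_eq_Iic]
  exact lintegral_gammaPDF_of_nonpos le_rfl

lemma ae_dirichlet_mem_stdSimplex {k : ℕ} (hk : 0 < k) {a : Fin k → ℝ} (ha : ∀ j, 0 < a j) :
    ∀ᵐ θ ∂(dirichlet a), θ ∈ stdSimplex ℝ (Fin k) := by
  have : ∀ j, IsProbabilityMeasure (gammaMeasure (a j) 1) := fun j =>
    isProbabilityMeasure_gammaMeasure (ha j) one_pos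
  have hne : Nonempty (Fin k) := ⟨⟨0, hk⟩⟩
  rw [dirichlet, ae_map_iff (p := fun θ => θ ∈ stdSimplex ℝ (Fin k))
    (measurable_normalize k).aemeasurable (isClosed_stdSimplex ℝ (Fin k)).measurableSet]
  have h : ∀ᵐ g ∂(Measure.pi fun j => gammaMeasure (a j) 1), ∀ j, 0 < g j := by
    rw [ae_all_iff]
    intro j
    exact (Measure.tendsto_eval_ae_ae (μ := fun j => gammaMeasure (a j) 1) (i := j)).eventually
      (ae_gammaMeasure_pos (a j))
  filter_upwards [h] with g hg
  have hS : 0 < ∑ i, g i := Finset.sum_pos (fun i _ => hg i) Finset.univ_nonempty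
  refine ⟨fun j => (div_pos (hg j) hS).le, ?_⟩
  rw [← Finset.sum_div, div_self hS.ne']

lemma prod_gammaPDF_eq {k : ℕ} {a : Fin k → ℝ} {g : Fin k → ℝ} (ha : ∀ j, 0 < a j)
    (hg : ∀ j, 0 ≤ g j) :
    ∏ j, gammaPDF (a j) 1 (g j) = ENNReal.ofReal
      ((∏ j, 1 / Real.Gamma (a j)) * (∏ j, g j ^ (a j - 1)) * Real.exp (-∑ j, g j)) := by
  have h (j) : gammaPDF (a j) 1 (g j) = ENNReal.ofReal
      (1 / Real.Gamma (a j) * g j ^ (a j - 1) * Real.exp (-g j)) := by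
    rw [gammaPDF_of_nonneg (hg j)]
    simp
  simp_rw [h]
  rw [← ENNReal.ofReal_prod_of_nonneg, Finset.prod_mul_distrib, Finset.prod_mul_distrib,
    ← Finset.sum_neg_distrib, Real.exp_sum]
  intro j _
  have h1 := Real.Gamma_pos_of_pos (ha j)
  have h2 := Real.rpow_nonneg (hg j) (a j - 1)
  positivity

/-- Both ratios are needed because the exponent may have either sign: the Dirichlet parameters `a j`
may lie on either side of `1`. -/
lemma div_rpow_le_of_ratio {x y b C : ℝ} (hx : 0 < x) (hy : 0 < y) {K : ℝ}
    (h1 : x ≤ K * y) (h2 : y ≤ K * x) (hb : |b| ≤ C) : x ^ b ≤ K ^ C * y ^ b := by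
  have hK : 1 ≤ K := by
    by_contra hK
    rw [not_le] at hK
    have hK0 : 0 < K := by
      by_contra h; rw [not_lt] at h; nlinarith
    nlinarith
  have hr : (x / y) ^ b ≤ K ^ C := by
    rcases le_total 0 b with hb0 | hb0
    · calc (x / y) ^ b ≤ K ^ b := Real.rpow_le_rpow (by positivity)
            (by rwa [div_le_iff₀ hy]) hb0
        _ ≤ K ^ C := Real.rpow_le_rpow_of_exponent_le hK ((le_abs_self b).trans hb)
    · calc (x / y) ^ b = (y / x) ^ (-b) := by
            rw [Real.rpow_neg (by positivity), ← Real.inv_rpow (by positivity), inv_div]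
        _ ≤ K ^ (-b) := Real.rpow_le_rpow (by positivity)
            (by rwa [div_le_iff₀ hx]) (by linarith)
        _ ≤ K ^ C := Real.rpow_le_rpow_of_exponent_le hK ((neg_le_abs b).trans hb)
  rw [Real.div_rpow hx.le hy.le, div_le_iff₀ (Real.rpow_pos_of_pos hy b)] at hr
  exact hr

/-- The linear map that preserves the coordinate sum and, on the hyperplane where it is `1`,
is the homothety with factor `1 / t` that sends `θ₁` to `θ₂`. -/
def simplexDilation {k : ℕ} (t : ℝ) (θ₁ θ₂ : Fin k → ℝ) : (Fin k → ℝ) →ₗ[ℝ] (Fin k → ℝ) :=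
  Matrix.toLin' (t⁻¹ • (1 + Matrix.replicateCol Unit (t • θ₂ - θ₁) *
    Matrix.replicateRow Unit (1 : Fin k → ℝ)))

lemma simplexDilation_apply {k : ℕ} {t : ℝ} (ht : t ≠ 0) (θ₁ θ₂ g : Fin k → ℝ) (j : Fin k) :
    simplexDilation t θ₁ θ₂ g j = (∑ i, g i) * θ₂ j + (g j - (∑ i, g i) * θ₁ j) / t := by
  simp only [simplexDilation, Matrix.toLin'_apply, Matrix.smul_mulVec, Matrix.add_mulVec,
    Matrix.one_mulVec, Pi.smul_apply, Pi.add_apply, smul_eq_mul]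
  have : ((Matrix.replicateCol Unit (t • θ₂ - θ₁) *
      Matrix.replicateRow Unit (1 : Fin k → ℝ)).mulVec g) j = (t * θ₂ j - θ₁ j) * ∑ i, g i := by
    simp [Matrix.mulVec, dotProduct, Matrix.mul_apply, Finset.mul_sum]
  rw [this]
  field_simp
  ring

/-- The matrix determinant lemma gives `1 + (t - 1) = t` for the rank-one perturbation, and the
scalar `t⁻¹` contributes `t^(-k)`. The exponent is `k - 1`, not `k`, because the coordinate sum is
not scaled: this is the dimension of the simplex. -/
lemma det_simplexDilation {k : ℕ} (hk : 0 < k) {t : ℝ} (ht : t ≠ 0) {θ₁ θ₂ : Fin k → ℝ}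
    (h1 : ∑ j, θ₁ j = 1) (h2 : ∑ j, θ₂ j = 1) :
    LinearMap.det (simplexDilation t θ₁ θ₂) = (t ^ (k - 1))⁻¹ := by
  rw [simplexDilation, LinearMap.det_toLin', Matrix.det_smul,
    Matrix.det_one_add_replicateCol_mul_replicateRow]
  simp only [Fintype.card_fin, dotProduct, Pi.one_apply, one_mul, Pi.sub_apply, Pi.smul_apply,
    smul_eq_mul, Finset.sum_sub_distrib, ← Finset.mul_sum, h1, h2]
  obtain ⟨m, rfl⟩ : ∃ m, k = m + 1 := ⟨k - 1, by omega⟩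
  simp only [Nat.add_sub_cancel, inv_pow, pow_succ]
  field_simp
  ring

/-- The Dirichlet mass of a small ball well inside the simplex, compared to that of a ball around
another center. -/
lemma dirichlet_ball_le {k : ℕ} (hk : 0 < k) {a : Fin k → ℝ} {C₁ : ℝ} (ha : ∀ j, 0 < a j)
    (haC : ∀ j, a j ≤ C₁) {u v t ρ : ℝ} (hu : 0 < u) (ht : 0 < t) (hρ : 0 ≤ ρ) (hρu : ρ ≤ u / k)
    {θ₁ θ₂ : Fin k → ℝ} (h1 : ∑ j, θ₁ j = 1) (h2 : ∑ j, θ₂ j = 1)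
    (h2' : ∀ j, 2 * u / k ≤ θ₂ j ∧ θ₂ j ≤ (v - u) / k) :
    dirichlet a {θ | ∑ j, θ j = 1 ∧ (∀ j, u / k ≤ θ j ∧ θ j ≤ v / k) ∧
        ∑ j, (θ j - θ₁ j) ^ 2 ≤ (t * ρ) ^ 2} ≤
      ENNReal.ofReal ((v / u) ^ ((C₁ + 1) * k) * t ^ (k - 1)) *
        dirichlet a {θ | ∑ j, θ j = 1 ∧ ∑ j, (θ j - θ₂ j) ^ 2 ≤ ρ ^ 2} := by
  have hk' : (0 : ℝ) < k := by exact_mod_cast hk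
  set B₁ : Set (Fin k → ℝ) := {θ | ∑ j, θ j = 1 ∧ (∀ j, u / k ≤ θ j ∧ θ j ≤ v / k) ∧
        ∑ j, (θ j - θ₁ j) ^ 2 ≤ (t * ρ) ^ 2} with hB₁
  set B₂ : Set (Fin k → ℝ) := {θ | ∑ j, θ j = 1 ∧ ∑ j, (θ j - θ₂ j) ^ 2 ≤ ρ ^ 2} with hB₂
  have hall : MeasurableSet {θ : Fin k → ℝ | ∀ j, u / k ≤ θ j ∧ θ j ≤ v / k} := by
    have : {θ : Fin k → ℝ | ∀ j, u / k ≤ θ j ∧ θ j ≤ v / k} =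
        Set.univ.pi fun _ => Icc (u / k) (v / k) := by
      ext θ; simp only [mem_univ_pi, mem_Icc]; rfl
    rw [this]
    exact MeasurableSet.univ_pi fun _ => measurableSet_Icc
  have hmB₁ : MeasurableSet B₁ := by
    refine (measurableSet_eq_fun (f := fun θ : Fin k → ℝ => ∑ j, θ j) (by fun_prop)
      measurable_const).inter (hall.inter
      (measurableSet_le (f := fun θ : Fin k → ℝ => ∑ j, (θ j - θ₁ j) ^ 2) (by fun_prop)
        measurable_const))
  have hmB₂ : MeasurableSet B₂ :=
    (measurableSet_eq_fun (f := fun θ : Fin k → ℝ => ∑ j, θ j) (by fun_prop)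
      measurable_const).inter
      (measurableSet_le (f := fun θ : Fin k → ℝ => ∑ j, (θ j - θ₂ j) ^ 2) (by fun_prop)
        measurable_const)
  have hN := measurable_normalize k
  have hmW : Measurable fun g : Fin k → ℝ => ∏ j, gammaPDF (a j) 1 (g j) :=
    Finset.measurable_fun_prod _ fun j _ =>
      (measurable_gammaPDFReal _ _).ennreal_ofReal.comp (measurable_pi_apply j)
  -- Both masses become Lebesgue integrals of the product gamma density over cones in the full
  -- space, so no density on the simplex is needed and a linear change of variables applies.
  rw [dirichlet, Measure.map_apply hN hmB₁, Measure.map_apply hN hmB₂, pi_gammaMeasure a ha,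
    withDensity_apply _ (hN hmB₁), withDensity_apply _ (hN hmB₂),
    ← lintegral_indicator (hN hmB₁), ← lintegral_indicator (hN hmB₂)]
  set N : (Fin k → ℝ) → (Fin k → ℝ) := fun g j => g j / ∑ i, g i with hNdef
  set W : (Fin k → ℝ) → ℝ≥0∞ := fun g => ∏ j, gammaPDF (a j) 1 (g j) with hW
  set K : ℝ := (v / u) ^ ((C₁ + 1) * k) with hK
  let T := simplexDilation t θ₁ θ₂
  have hT (g : Fin k → ℝ) (j) : T g j =
      (∑ i, g i) * θ₂ j + (g j - (∑ i, g i) * θ₁ j) / t := simplexDilation_apply ht.ne' _ _ _ _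
  have hTs (g : Fin k → ℝ) : ∑ j, T g j = ∑ j, g j := by
    simp_rw [hT]
    rw [Finset.sum_add_distrib, ← Finset.mul_sum, h2, ← Finset.sum_div, Finset.sum_sub_distrib,
      ← Finset.mul_sum, h1]
    simp
  -- The dilation carries the first cone into the second. It preserves coordinate sums, so the
  -- exponential factors of the gamma densities agree and only the powers `g j ^ (a j - 1)` have to
  -- be compared.
  have key (g : Fin k → ℝ) : (N ⁻¹' B₁).indicator W g ≤
      ENNReal.ofReal K * (N ⁻¹' B₂).indicator W (T g) := by
    by_cases hg : g ∈ N ⁻¹' B₁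
    swap
    · rw [indicator_of_notMem hg]; exact zero_le
    obtain ⟨hs, hb, hd⟩ := hg
    rw [indicator_of_mem (show g ∈ N ⁻¹' B₁ from ⟨hs, hb, hd⟩)]
    have hS0 : ∑ i, g i ≠ 0 := by
      intro h0
      simp only [hNdef, h0, div_zero, Finset.sum_const_zero] at hs
      exact zero_ne_one hs
    have hgN (j) : g j = (∑ i, g i) * N g j := by
      simp only [hNdef]; field_simp
    have hNpos (j) : 0 < N g j := (div_pos hu hk').trans_le (hb j).1
    -- A vector with negative sum can also normalise to a point of `B₁`; then all its coordinates
    -- are negative and the gamma density vanishes.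
    rcases lt_or_gt_of_ne hS0 with hS | hS
    · have : W g = 0 := by
        refine Finset.prod_eq_zero (Finset.mem_univ ⟨0, hk⟩) (gammaPDF_of_neg ?_)
        rw [hgN]
        exact mul_neg_of_neg_of_pos hS (hNpos _)
      rw [this]; exact zero_le
    have hNT (j) : N (T g) j = θ₂ j + (N g j - θ₁ j) / t := by
      have : N (T g) j = T g j / ∑ i, g i := by rw [← hTs g]
      rw [this, hT, hgN j, ← mul_sub, mul_div_assoc, ← mul_add, mul_comm, mul_div_assoc,
        div_self hS0, mul_one]
    have hd2 : ∑ j, (N (T g) j - θ₂ j) ^ 2 ≤ ρ ^ 2 := by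
      have : ∑ j, (N (T g) j - θ₂ j) ^ 2 = (∑ j, (N g j - θ₁ j) ^ 2) / t ^ 2 := by
        rw [Finset.sum_div]
        refine Finset.sum_congr rfl fun j _ => ?_
        rw [hNT]; ring
      rw [this, div_le_iff₀ (by positivity)]
      linarith [hd, mul_pow t ρ 2]
    have hmem : T g ∈ N ⁻¹' B₂ := by
      refine ⟨?_, hd2⟩
      have : ∑ j, N (T g) j = (∑ j, T g j) / ∑ j, T g j := by
        simp only [hNdef]; rw [← Finset.sum_div]
      rw [this, hTs, div_self hS0]
    rw [indicator_of_mem hmem]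
    -- The margins of `θ₂` in `h2'` and `ρ ≤ u / k` keep the image in the range `[u/k, v/k]`, so
    -- coordinates before and after the dilation have ratio at most `v / u`.
    have hTb (j) : u / k ≤ N (T g) j ∧ N (T g) j ≤ v / k := by
      have h3 : (N (T g) j - θ₂ j) ^ 2 ≤ ρ ^ 2 :=
        (Finset.single_le_sum (f := fun j => (N (T g) j - θ₂ j) ^ 2)
          (fun i _ => sq_nonneg _) (Finset.mem_univ j)).trans hd2
      have h4 := abs_le_of_sq_le_sq' h3 hρ
      have h5 := h2' j
      have h6 : 2 * u / k = u / k + u / k := by ring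
      have h7 : (v - u) / k = v / k - u / k := by ring
      constructor <;> linarith [h4.1, h4.2, h5.1, h5.2]
    have hTN (j) : T g j = (∑ i, g i) * N (T g) j := by
      have : N (T g) j = T g j / ∑ i, g i := by rw [← hTs g]
      rw [this]; field_simp
    have hg0 (j) : 0 < g j := by rw [hgN]; exact mul_pos hS (hNpos j)
    have hT0 (j) : 0 < T g j := by
      rw [hTN]; exact mul_pos hS ((div_pos hu hk').trans_le (hTb j).1)
    have hratio {x y : ℝ} (hx : u / k ≤ x ∧ x ≤ v / k) (hy : u / k ≤ y ∧ y ≤ v / k) :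
        (∑ i, g i) * x ≤ v / u * ((∑ i, g i) * y) := by
      have hv : 0 ≤ v / u := by
        have : 0 < v / k := (div_pos hu hk').trans_le (hx.1.trans hx.2)
        have hv := (div_pos_iff_of_pos_right hk').1 this
        positivity
      have : x ≤ v / u * y := by
        calc x ≤ v / k := hx.2
          _ = v / u * (u / k) := by field_simp
          _ ≤ v / u * y := mul_le_mul_of_nonneg_left hy.1 hv
      nlinarith
    simp only [hW]
    rw [prod_gammaPDF_eq ha fun j => (hg0 j).le, prod_gammaPDF_eq ha fun j => (hT0 j).le,
      ← ENNReal.ofReal_mul', hTs]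
    swap
    · refine mul_nonneg (mul_nonneg (Finset.prod_nonneg fun j _ => ?_)
        (Finset.prod_nonneg fun j _ => Real.rpow_nonneg (hT0 j).le _)) (Real.exp_pos _).le
      exact div_nonneg zero_le_one (Real.Gamma_pos_of_pos (ha j)).le
    refine ENNReal.ofReal_le_ofReal ?_
    have hprod : ∏ j, g j ^ (a j - 1) ≤ K * ∏ j, T g j ^ (a j - 1) := by
      have hKp : K = ∏ _j : Fin k, (v / u) ^ (C₁ + 1) := by
        have hvu : 0 ≤ v / u := by
          have := (hb ⟨0, hk⟩).1.trans (hb ⟨0, hk⟩).2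
          have hv : u ≤ v := by rwa [div_le_div_iff_of_pos_right hk'] at this
          exact div_nonneg (hu.le.trans hv) hu.le
        rw [Finset.prod_const, Finset.card_univ, Fintype.card_fin, hK, Real.rpow_mul hvu,
          Real.rpow_natCast]
      rw [hKp, ← Finset.prod_mul_distrib]
      refine Finset.prod_le_prod (fun j _ => Real.rpow_nonneg (hg0 j).le _) fun j _ => ?_
      refine div_rpow_le_of_ratio (hg0 j) (hT0 j) ?_ ?_ ?_
      · rw [hgN j, hTN j]; exact hratio (hb j) (hTb j)
      · rw [hgN j, hTN j]; exact hratio (hTb j) (hb j)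
      · rw [abs_le]; constructor <;> linarith [ha j, haC j]
    have hc : 0 ≤ ∏ j, 1 / Real.Gamma (a j) := Finset.prod_nonneg fun j _ =>
      div_nonneg zero_le_one (Real.Gamma_pos_of_pos (ha j)).le
    calc (∏ j, 1 / Real.Gamma (a j)) * (∏ j, g j ^ (a j - 1)) * Real.exp (-∑ j, g j)
        ≤ (∏ j, 1 / Real.Gamma (a j)) * (K * ∏ j, T g j ^ (a j - 1)) *
          Real.exp (-∑ j, g j) := by gcongr
      _ = _ := by ring
  have hdet := det_simplexDilation hk ht.ne' h1 h2
  have htk : 0 < t ^ (k - 1) := pow_pos ht _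
  have hdet0 : LinearMap.det T ≠ 0 := by
    simp only [T]; rw [hdet]; positivity
  have hmap := Real.map_linearMap_volume_pi_eq_smul_volume_pi hdet0
  have hmT : Measurable T := T.continuous_of_finiteDimensional.measurable
  -- The inverse Jacobian of the dilation is `t^(k-1)`, which produces the dimensional factor of the
  -- estimate.
  calc ∫⁻ g, (N ⁻¹' B₁).indicator W g
      ≤ ∫⁻ g, ENNReal.ofReal K * (N ⁻¹' B₂).indicator W (T g) := lintegral_mono key
    _ = ENNReal.ofReal K * ∫⁻ g, (N ⁻¹' B₂).indicator W g ∂(Measure.map T volume) := by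
        rw [lintegral_map (hmW.indicator (hN hmB₂)) hmT,
          lintegral_const_mul (f := fun g => (N ⁻¹' B₂).indicator W (T g)) _
            ((hmW.indicator (hN hmB₂)).comp hmT)]
    _ = _ := by
        rw [hmap, lintegral_smul_measure, smul_eq_mul, ← mul_assoc, ← ENNReal.ofReal_mul' (abs_nonneg _)]
        congr 3
        simp only [T]
        rw [hdet, inv_inv, abs_of_pos htk]

/-- Since `1 / Γ(a) = a / Γ(a + 1)` and `Γ` is bounded on `[1, C₁ + 1]`, the density degenerates
only linearly as `a` tends to `0`. Polynomially small Dirichlet parameters then cost only a power of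
`n` per bin. -/
lemma exists_gammaPDFReal_lower {B : ℝ} (hB : 1 ≤ B) (C₁ : ℝ) :
    ∃ κ₀ : ℝ, 0 < κ₀ ∧ ∀ a, 0 < a → a ≤ C₁ → ∀ y, B⁻¹ ≤ y → y ≤ B →
      κ₀ * a ≤ gammaPDFReal a 1 y := by
  have hB0 : 0 < B := one_pos.trans_le hB
  have hc : ContinuousOn Real.Gamma (Icc 1 (C₁ + 1)) := fun x hx =>
    (Real.differentiableAt_Gamma fun m => by
      have : (0 : ℝ) ≤ m := Nat.cast_nonneg m
      linarith [hx.1]).continuousAt.continuousWithinAt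
  obtain ⟨G, hG⟩ := isCompact_Icc.exists_bound_of_continuousOn hc
  set G' := max G 1
  have hG' : 0 < G' := one_pos.trans_le (le_max_right _ _)
  refine ⟨G'⁻¹ * (B ^ (C₁ + 1))⁻¹ * Real.exp (-B), by positivity, fun a ha haC y hy1 hy2 => ?_⟩
  have hy0 : 0 < y := (inv_pos.2 hB0).trans_le hy1
  rw [gammaPDFReal, if_pos hy0.le, Real.one_rpow, one_mul]
  have hgp := Real.Gamma_pos_of_pos ha
  have h1 : G'⁻¹ * a ≤ 1 / Real.Gamma a := by
    have hg := hG (a + 1) ⟨by linarith, by linarith⟩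
    rw [Real.norm_of_nonneg (Real.Gamma_pos_of_pos (by linarith)).le, Real.Gamma_add_one ha.ne'] at hg
    rw [le_div_iff₀ hgp, mul_assoc, inv_mul_le_iff₀ hG', mul_one]
    exact hg.trans (le_max_left _ _)
  have h2 : (B ^ (C₁ + 1))⁻¹ ≤ y ^ (a - 1) := by
    have h := div_rpow_le_of_ratio (x := 1) (y := y) (b := a - 1) (C := C₁ + 1) (K := B) one_pos hy0
      (by rw [inv_le_iff_one_le_mul₀ hB0] at hy1; linarith) (by linarith)
      (by rw [abs_le]; constructor <;> linarith)
    rw [Real.one_rpow] at h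
    rw [inv_le_iff_one_le_mul₀ (by positivity)]
    linarith
  have h3 : Real.exp (-B) ≤ Real.exp (-y) := Real.exp_le_exp.2 (by linarith)
  calc G'⁻¹ * (B ^ (C₁ + 1))⁻¹ * Real.exp (-B) * a
      = (G'⁻¹ * a) * (B ^ (C₁ + 1))⁻¹ * Real.exp (-B) := by ring
    _ ≤ 1 / Real.Gamma a * y ^ (a - 1) * Real.exp (-y) := by gcongr

/-- In the gamma representation it suffices that each of the `k` independent variables falls in its
own interval of relative length `1/n`, which has at least polynomially small probability. The
one-sided domination of `θ₀` by `(1 + 1/n) θ` is what the likelihood comparison in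
`le_lintegral_likelihood_dirichlet` uses. -/
lemma exists_dirichlet_lower {c C : ℝ} (hc : 0 < c) {C₁ c₁ s : ℝ} (hc₁ : 0 < c₁) (hs : 0 ≤ s) :
    ∃ E : ℝ, 0 < E ∧ ∀ (k n : ℕ), 0 < k → 2 ≤ n → k ≤ n → ∀ a : Fin k → ℝ,
      (∀ j, c₁ * (k : ℝ) ^ (-s) ≤ a j ∧ a j ≤ C₁) → ∀ θ₀ : Fin k → ℝ, ∑ j, θ₀ j = 1 →
      (∀ j, c ≤ k * θ₀ j ∧ k * θ₀ j ≤ C) →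
      ENNReal.ofReal (Real.exp (-(E * (k * Real.log n)))) ≤
        dirichlet a {θ | ∀ j, θ₀ j ≤ (1 + 1 / n) * θ j} := by
  set B : ℝ := max (max c⁻¹ (2 * C)) 1
  have hB : 1 ≤ B := le_max_right _ _
  have hBc : c⁻¹ ≤ B := (le_max_left _ _).trans (le_max_left _ _)
  have hBC : 2 * C ≤ B := (le_max_right _ _).trans (le_max_left _ _)
  obtain ⟨κ₀, hκ₀, hpdf⟩ := exists_gammaPDFReal_lower hB C₁
  set w : ℝ := min (κ₀ * c₁ * c) 1
  have hw : 0 < w := lt_min (by positivity) one_pos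
  have hw1 : w ≤ 1 := min_le_right _ _
  have hlog2 : 0 < Real.log 2 := Real.log_pos (by norm_num)
  -- Per bin, `s` pays for `k^(-s) ≥ n^(-s)`, `1` for the interval length of order `1/n`, and the
  -- last term for the constant `w`, since `log n ≥ log 2`.
  refine ⟨s + 1 + -Real.log w / Real.log 2, ?_, ?_⟩
  · have := Real.log_nonpos hw.le hw1
    have : 0 ≤ -Real.log w / Real.log 2 := div_nonneg (by linarith) hlog2.le
    linarith
  intro k n hk hn hkn a ha θ₀ hθ₀ hθc
  have hk' : (0 : ℝ) < k := by exact_mod_cast hk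
  have hn' : (2 : ℝ) ≤ n := by exact_mod_cast hn
  have hn0 : (0 : ℝ) < n := by linarith
  have hkn' : (k : ℝ) ≤ n := by exact_mod_cast hkn
  have ha0 (j) : 0 < a j := lt_of_lt_of_le (by positivity) (ha j).1
  have : ∀ j, IsProbabilityMeasure (gammaMeasure (a j) 1) := fun j =>
    isProbabilityMeasure_gammaMeasure (ha0 j) one_pos
  have hne : Nonempty (Fin k) := ⟨⟨0, hk⟩⟩
  -- The gamma variables aim at `k θ₀ j` rather than `θ₀ j`: these values stay in a fixed compact
  -- subset of `(0, ∞)`, and normalisation removes the factor `k`.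
  let J (j : Fin k) : Set ℝ := Icc (k * θ₀ j) (k * θ₀ j * (1 + 1 / n))
  have hJ (j) : ENNReal.ofReal (Real.exp (-((s + 1 + -Real.log w / Real.log 2) * Real.log n))) ≤
      gammaMeasure (a j) 1 (J j) := by
    have hx := hθc j
    have hx0 : 0 < k * θ₀ j := hc.trans_le hx.1
    have h1n : 1 / (n : ℝ) ≤ 1 := by rw [div_le_one hn0]; linarith
    have h1 : ENNReal.ofReal (κ₀ * a j) * volume (J j) ≤ gammaMeasure (a j) 1 (J j) := by
      rw [gammaMeasure, withDensity_apply _ measurableSet_Icc, ← setLIntegral_const]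
      refine setLIntegral_mono' measurableSet_Icc fun y hy => ENNReal.ofReal_le_ofReal ?_
      refine hpdf _ (ha0 j) (ha j).2 y ?_ ?_
      · rw [inv_le_comm₀ (one_pos.trans_le hB) (hx0.trans_le hy.1)]
        refine le_trans ?_ hBc
        exact inv_anti₀ hc (hx.1.trans hy.1)
      · refine hy.2.trans (le_trans ?_ hBC)
        nlinarith [hx.2]
    refine le_trans ?_ h1
    rw [Real.volume_Icc, ← ENNReal.ofReal_mul (mul_nonneg hκ₀.le (ha0 j).le)]
    refine ENNReal.ofReal_le_ofReal ?_
    have h2 : Real.exp (-((s + 1 + -Real.log w / Real.log 2) * Real.log n)) ≤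
        w * ((n : ℝ) ^ (-s) * (n : ℝ)⁻¹) := by
      have hl : Real.log 2 ≤ Real.log n := Real.log_le_log (by norm_num) hn'
      have hlw := Real.log_nonpos hw.le hw1
      have e1 : w * ((n : ℝ) ^ (-s) * (n : ℝ)⁻¹) =
          Real.exp (Real.log w - (s + 1) * Real.log n) := by
        rw [sub_eq_add_neg, Real.exp_add, Real.exp_log hw]
        congr 1
        rw [show -((s + 1) * Real.log n) = Real.log n * -s + -Real.log n by ring, Real.exp_add,
          ← Real.rpow_def_of_pos hn0, Real.exp_neg, Real.exp_log hn0]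
      rw [e1]
      refine Real.exp_le_exp.2 ?_
      have : -Real.log w ≤ -Real.log w / Real.log 2 * Real.log n := by
        rw [div_mul_eq_mul_div, le_div_iff₀ hlog2]
        exact mul_le_mul_of_nonneg_left hl (by linarith)
      linarith
    refine h2.trans ?_
    have h3 : (n : ℝ) ^ (-s) ≤ (k : ℝ) ^ (-s) :=
      Real.rpow_le_rpow_of_nonpos hk' hkn' (by linarith)
    calc w * ((n : ℝ) ^ (-s) * (n : ℝ)⁻¹) ≤ (κ₀ * c₁ * c) * ((k : ℝ) ^ (-s) * (n : ℝ)⁻¹) := by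
          gcongr
          exact min_le_left _ _
      _ = κ₀ * (c₁ * (k : ℝ) ^ (-s)) * (c * (n : ℝ)⁻¹) := by ring
      _ ≤ κ₀ * a j * (k * θ₀ j * (n : ℝ)⁻¹) := by
          have h4 := (ha j).1
          have h5 := hx.1
          have := ha0 j
          gcongr
      _ = κ₀ * a j * (k * θ₀ j * (1 + 1 / n) - k * θ₀ j) := by rw [one_div]; ring
  have hset : MeasurableSet {θ : Fin k → ℝ | ∀ j, θ₀ j ≤ (1 + 1 / n) * θ j} := by
    have h (j : Fin k) : MeasurableSet {θ : Fin k → ℝ | θ₀ j ≤ (1 + 1 / n) * θ j} :=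
      measurableSet_le measurable_const (by fun_prop)
    convert MeasurableSet.iInter h using 1
    ext θ
    simp
  rw [dirichlet, Measure.map_apply (measurable_normalize k) hset]
  have hsub : Set.univ.pi J ⊆ (fun (g : Fin k → ℝ) (j : Fin k) => g j / ∑ i, g i) ⁻¹'
      {θ : Fin k → ℝ | ∀ j, θ₀ j ≤ (1 + 1 / n) * θ j} := by
    intro g hg j
    have hg' (i) : k * θ₀ i ≤ g i ∧ g i ≤ k * θ₀ i * (1 + 1 / n) := hg i trivial
    have hg0 (i) : 0 < g i := (hc.trans_le (hθc i).1).trans_le (hg' i).1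
    have hS : 0 < ∑ i, g i := Finset.sum_pos (fun i _ => hg0 i) Finset.univ_nonempty
    have hS2 : ∑ i, g i ≤ k * (1 + 1 / n) := by
      calc ∑ i, g i ≤ ∑ i, k * θ₀ i * (1 + 1 / n) := Finset.sum_le_sum fun i _ => (hg' i).2
        _ = k * (1 + 1 / n) := by rw [← Finset.sum_mul, ← Finset.mul_sum, hθ₀, mul_one]
    change θ₀ j ≤ (1 + 1 / n) * (g j / ∑ i, g i)
    rw [← mul_div_assoc, le_div_iff₀ hS]
    have hθj : 0 ≤ θ₀ j := by
      have := hc.trans_le (hθc j).1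
      exact (pos_of_mul_pos_right this hk'.le).le
    have hn1 : (0 : ℝ) ≤ 1 + 1 / n := by positivity
    calc θ₀ j * ∑ i, g i ≤ θ₀ j * (k * (1 + 1 / n)) := by gcongr
      _ = (1 + 1 / n) * (k * θ₀ j) := by ring
      _ ≤ (1 + 1 / n) * g j := by gcongr; exact (hg' j).1
  refine le_trans ?_ (measure_mono hsub)
  rw [Measure.pi_pi]
  calc ENNReal.ofReal (Real.exp (-((s + 1 + -Real.log w / Real.log 2) * (k * Real.log n))))
      = ∏ _j : Fin k,
        ENNReal.ofReal (Real.exp (-((s + 1 + -Real.log w / Real.log 2) * Real.log n))) := by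
        rw [Finset.prod_const, Finset.card_univ, Fintype.card_fin,
          ← ENNReal.ofReal_pow (Real.exp_pos _).le, ← Real.exp_nat_mul]
        congr 2; ring
    _ ≤ _ := Finset.prod_le_prod' fun j _ => hJ j

/-- On the domination set, the likelihood at `θ` is at least `(1 + 1/n)^(-n) ≥ exp(-1)` times that
at `θ₀`. -/
lemma le_lintegral_likelihood_dirichlet {n k : ℕ} (hn : 0 < n) {a θ₀ : Fin k → ℝ}
    (hθ₀ : ∀ j, 0 ≤ θ₀ j) {x : ℝ}
    (hx : ENNReal.ofReal x ≤ dirichlet a {θ | ∀ j, θ₀ j ≤ (1 + 1 / n) * θ j})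
    (hx0 : 0 ≤ x) (y : Fin n → I) :
    ENNReal.ofReal (x * Real.exp (-1) * jointDensity (histDensity ⟨k, θ₀⟩) y) ≤
      ∫⁻ θ, likelihood y ⟨k, θ⟩ ∂(dirichlet a) := by
  have hn' : (0 : ℝ) < n := by exact_mod_cast hn
  have hset : MeasurableSet {θ : Fin k → ℝ | ∀ j, θ₀ j ≤ (1 + 1 / n) * θ j} := by
    have h (j : Fin k) : MeasurableSet {θ : Fin k → ℝ | θ₀ j ≤ (1 + 1 / n) * θ j} :=
      measurableSet_le measurable_const (by fun_prop)
    convert MeasurableSet.iInter h using 1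
    ext θ
    simp
  rw [mul_assoc, ENNReal.ofReal_mul hx0]
  refine (mul_le_mul_left hx _).trans ?_
  rw [mul_comm, ← setLIntegral_const]
  refine le_trans (setLIntegral_mono' hset fun θ hθ => ?_) (setLIntegral_le_lintegral _ _)
  have h1n : (0 : ℝ) < 1 + 1 / n := by positivity
  have hθ0 (j) : 0 ≤ θ j := by
    have := (hθ₀ j).trans (hθ j)
    exact (mul_nonneg_iff_of_pos_left h1n).1 this
  rw [likelihood_eq y hθ0]
  refine ENNReal.ofReal_le_ofReal ?_
  have h2 : jointDensity (histDensity ⟨k, θ₀⟩) y ≤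
      (1 + 1 / n) ^ n * jointDensity (histDensity ⟨k, θ⟩) y := by
    calc jointDensity (histDensity ⟨k, θ₀⟩) y
        ≤ ∏ i : Fin n, (1 + 1 / n) * histDensity ⟨k, θ⟩ (y i) := by
          refine Finset.prod_le_prod (fun i _ => histDensity_nonneg hθ₀ _) fun i _ => ?_
          refine (histDensity_mono hθ _).trans (le_of_eq ?_)
          unfold histDensity
          simp only
          rw [mul_left_comm]
          congr 1
          rw [Finset.mul_sum]
          refine Finset.sum_congr rfl fun j _ => ?_
          split_ifs <;> simp
      _ = _ := by
          rw [Finset.prod_mul_distrib, Finset.prod_const, Finset.card_univ, Fintype.card_fin]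
          rfl
  have h3 : (1 + 1 / (n : ℝ)) ^ n ≤ Real.exp 1 := by
    calc (1 + 1 / (n : ℝ)) ^ n ≤ Real.exp (1 / n) ^ n := by
          gcongr
          linarith [Real.add_one_le_exp (1 / (n : ℝ))]
      _ = Real.exp 1 := by rw [← Real.exp_nat_mul]; congr 1; field_simp
  have h4 := jointDensity_nonneg (histDensity_nonneg hθ0) y
  calc Real.exp (-1) * jointDensity (histDensity ⟨k, θ₀⟩) y
      ≤ Real.exp (-1) * (Real.exp 1 * jointDensity (histDensity ⟨k, θ⟩) y) := by
        gcongr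
        exact h2.trans (by gcongr)
    _ = jointDensity (histDensity ⟨k, θ⟩) y := by
        rw [← mul_assoc, ← Real.exp_add]; simp

/-! ### The bias of histograms -/

/-- The probabilities of the `k` bins under the density `p`. -/
def binMass (p : I → ℝ) (k : ℕ) (j : Fin k) : ℝ := ∫ x in bin k j, p x

lemma binMass_mem_stdSimplex {p : I → ℝ} (hp : IsDensity p) {k : ℕ} (hk : 0 < k) :
    binMass p k ∈ stdSimplex ℝ (Fin k) :=
  ⟨fun j => setIntegral_nonneg (measurableSet_bin k j) fun x _ => hp.2.1 x, by
    simp only [binMass]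
    rw [← integral_eq_sum_bin hk hp.integrable, hp.integral_eq_one]⟩

lemma binMass_bounds {p : I → ℝ} (hp : IsDensity p) {c C : ℝ} (h : ∀ x, c ≤ p x ∧ p x ≤ C)
    {k : ℕ} (j : Fin k) : c ≤ k * binMass p k j ∧ k * binMass p k j ≤ C := by
  have hk : (0 : ℝ) < k := by exact_mod_cast j.pos
  have h1 : ∫ _ in bin k j, c ≤ binMass p k j :=
    setIntegral_mono (integrable_const _).integrableOn hp.integrable.integrableOn fun x => (h x).1
  have h2 : binMass p k j ≤ ∫ _ in bin k j, C :=
    setIntegral_mono hp.integrable.integrableOn (integrable_const _).integrableOn fun x => (h x).2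
  rw [setIntegral_bin_const, div_le_iff₀ hk] at h1
  rw [setIntegral_bin_const, le_div_iff₀ hk] at h2
  constructor <;> linarith

lemma bias_le {p : I → ℝ} {k : ℕ} {θ : Fin k → ℝ} (hθ : θ ∈ stdSimplex ℝ (Fin k)) :
    bias p k ≤ hellinger p (histDensity ⟨k, θ⟩) ^ 2 :=
  ciInf_le (f := fun θ : stdSimplex ℝ (Fin k) => hellinger p (histDensity ⟨k, θ.1⟩) ^ 2)
    ⟨0, by rintro _ ⟨θ, rfl⟩; positivity⟩ ⟨θ, hθ⟩

lemma le_bias {p : I → ℝ} {k : ℕ} (hk : 0 < k) {x : ℝ}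
    (h : ∀ θ ∈ stdSimplex ℝ (Fin k), x ≤ hellinger p (histDensity ⟨k, θ⟩) ^ 2) :
    x ≤ bias p k := by
  have : Nonempty (Fin k) := ⟨⟨0, hk⟩⟩
  have : Nonempty (stdSimplex ℝ (Fin k)) := inferInstance
  exact le_ciInf fun θ => h θ.1 θ.2

lemma bias_nonneg (p : I → ℝ) (k : ℕ) : 0 ≤ bias p k := Real.iInf_nonneg fun _ => sq_nonneg _

lemma hellinger_sq_le_two {p q : I → ℝ} (hp : IsDensity p) (hq : IsDensity q) :
    hellinger p q ^ 2 ≤ 2 := by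
  have h := integral_sqrt_mul_sqrt hp.1 hp.2.1 hp.integrable hq.1 hq.2.1 hq.integrable
  have h0 : 0 ≤ ∫ x, √(p x) * √(q x) := integral_nonneg fun x => by positivity
  rw [h, hp.integral_eq_one, hq.integral_eq_one] at h0
  linarith

lemma bias_le_two {p : I → ℝ} (hp : IsDensity p) {k : ℕ} (hk : 0 < k) : bias p k ≤ 2 :=
  (bias_le (binMass_mem_stdSimplex hp hk)).trans
    (hellinger_sq_le_two hp (isDensity_histDensity (binMass_mem_stdSimplex hp hk)))

lemma integrable_sq_sub_of_bounded {p q : I → ℝ} (hp : Measurable p) (hq : Measurable q) {A B : ℝ}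
    (hpA : ∀ x, |p x| ≤ A) (hqB : ∀ x, |q x| ≤ B) : Integrable fun x => (p x - q x) ^ 2 := by
  refine Integrable.of_bound ((hp.sub hq).pow_const 2).aestronglyMeasurable ((A + B) ^ 2)
    (.of_forall fun x => ?_)
  rw [Real.norm_of_nonneg (sq_nonneg _), ← sq_abs]
  exact pow_le_pow_left₀ (abs_nonneg _)
    ((abs_sub _ _).trans (add_le_add (hpA x) (hqB x))) 2

lemma setIntegral_sq_sub_mean_le {p : I → ℝ} (hp : IsDensity p) {C : ℝ} (hC : ∀ x, p x ≤ C)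
    {k : ℕ} (j : Fin k) (c : ℝ) :
    ∫ x in bin k j, (p x - k * binMass p k j) ^ 2 ≤ ∫ x in bin k j, (p x - c) ^ 2 := by
  have hk : (0 : ℝ) < k := by exact_mod_cast j.pos
  set m := k * binMass p k j with hm
  have hpa : ∀ x, |p x| ≤ C := fun x => by rw [abs_of_nonneg (hp.2.1 x)]; exact hC x
  have hi (d : ℝ) : Integrable fun x => (p x - d) ^ 2 :=
    integrable_sq_sub_of_bounded hp.1 measurable_const hpa fun _ => le_rfl
  have h : ∫ x in bin k j, ((p x - c) ^ 2 - (p x - m) ^ 2) = (m - c) ^ 2 / k := by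
    have e : ∀ x, (p x - c) ^ 2 - (p x - m) ^ 2 = 2 * (m - c) * p x - (m ^ 2 - c ^ 2) := by
      intro x; ring
    simp_rw [e]
    rw [integral_sub (hp.integrable.integrableOn.const_mul _) (integrable_const _).integrableOn,
      integral_const_mul, setIntegral_bin_const]
    change 2 * (m - c) * binMass p k j - _ = _
    have : binMass p k j = m / k := by rw [hm]; field_simp
    rw [this]; field_simp; ring
  rw [integral_sub (hi c).integrableOn (hi m).integrableOn] at h
  have : 0 ≤ (m - c) ^ 2 / k := by positivity
  linarith

lemma setIntegral_hellinger_le {p : I → ℝ} (hp : IsDensity p) {k : ℕ} (θ : Fin k → ℝ)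
    (j : Fin k) :
    ∫ x in bin k j, (√(p x) - √(k * θ j)) ^ 2 ≤ hellinger p (histDensity ⟨k, θ⟩) ^ 2 := by
  rw [hellinger_sq]
  have hi := hp.rootL2.integrable_sq_sub (rootL2_histDensity θ)
  rw [← setIntegral_congr_fun (f := fun x => (√(p x) - √(histDensity ⟨k, θ⟩ x)) ^ 2)
    (measurableSet_bin k j) fun x hx => by simp only [histDensity_of_mem θ hx]]
  exact setIntegral_le_integral hi (.of_forall fun x => sq_nonneg _)

/-- This turns the Hellinger bias into the squared `L²`-distance required by
`measure_likelihood_lt_le`, for the explicit histogram of bin averages in place of a near-minimiser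
of the bias. -/
lemma integral_sq_sub_binMass_le {p : I → ℝ} (hp : IsDensity p) {C : ℝ} (hC : ∀ x, p x ≤ C)
    {k : ℕ} (hk : 0 < k) : ∫ x, (p x - histDensity ⟨k, binMass p k⟩ x) ^ 2 ≤ 4 * C * bias p k := by
  have hC0 : 0 ≤ C := (hp.2.1 0).trans (hC 0)
  have hpa : ∀ x, |p x| ≤ C := fun x => by rw [abs_of_nonneg (hp.2.1 x)]; exact hC x
  have hi1 := integrable_sq_sub_of_bounded hp.1 (measurable_histDensity ⟨k, binMass p k⟩) hpa
    (abs_histDensity_le _)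
  have main : ∀ θ ∈ stdSimplex ℝ (Fin k), ∫ x, (p x - histDensity ⟨k, binMass p k⟩ x) ^ 2 ≤
      4 * C * hellinger p (histDensity ⟨k, θ⟩) ^ 2 := by
    intro θ hθ
    have hi2 := hp.rootL2.integrable_sq_sub (rootL2_histDensity θ)
    rw [hellinger_sq, integral_eq_sum_bin hk hi1, integral_eq_sum_bin hk hi2, Finset.mul_sum]
    refine Finset.sum_le_sum fun j _ => ?_
    rw [← integral_const_mul]
    have e1 : ∫ x in bin k j, (p x - histDensity ⟨k, binMass p k⟩ x) ^ 2 =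
        ∫ x in bin k j, (p x - k * binMass p k j) ^ 2 :=
      setIntegral_congr_fun (measurableSet_bin k j) fun x hx => by
        simp only [histDensity_of_mem _ hx]
    rw [e1]
    -- The bin average is the best constant in `L²`, so it may be compared with any other. The
    -- height `k θ j` of a competitor can exceed `C`; truncating it at `C` moves it closer to `p`
    -- and keeps the sum of roots at most `2√C`.
    refine (setIntegral_sq_sub_mean_le hp hC j (min √(k * θ j) √C ^ 2)).trans ?_
    refine setIntegral_mono_on (integrable_sq_sub_of_bounded hp.1 measurable_const hpa
      fun _ => le_rfl).integrableOn (hi2.const_mul _).integrableOn (measurableSet_bin k j) ?_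
    intro x hx
    rw [histDensity_of_mem θ hx]
    set s := √(p x)
    set w := √(k * θ j)
    have hs0 : 0 ≤ s := Real.sqrt_nonneg _
    have hw0 : 0 ≤ w := Real.sqrt_nonneg _
    have hsC : s ≤ √C := Real.sqrt_le_sqrt (hC x)
    have hps : p x = s ^ 2 := (Real.sq_sqrt (hp.2.1 x)).symm
    have hCs : √C ^ 2 = C := Real.sq_sqrt hC0
    have hm0 : 0 ≤ min w √C := le_min hw0 (Real.sqrt_nonneg _)
    have hmC : min w √C ≤ √C := min_le_right _ _
    have h1 : (s - min w √C) ^ 2 ≤ (s - w) ^ 2 := by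
      rcases le_total w √C with h | h
      · rw [min_eq_left h]
      · rw [min_eq_right h]; nlinarith
    have h2 : (s + min w √C) ^ 2 ≤ 4 * C := by
      calc (s + min w √C) ^ 2 ≤ (√C + √C) ^ 2 := by gcongr
        _ = 4 * C := by rw [← two_mul, mul_pow, hCs]; norm_num
    calc (p x - min w √C ^ 2) ^ 2 = (s + min w √C) ^ 2 * (s - min w √C) ^ 2 := by rw [hps]; ring
      _ ≤ 4 * C * (s - w) ^ 2 := by gcongr
  rcases hC0.eq_or_lt with h0 | h0
  · have := main _ (binMass_mem_stdSimplex hp hk)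
    rw [← h0] at this ⊢
    linarith
  · have : (∫ x, (p x - histDensity ⟨k, binMass p k⟩ x) ^ 2) / (4 * C) ≤ bias p k :=
      le_bias hk fun θ hθ => by
        rw [div_le_iff₀ (by positivity), mul_comm]; exact main θ hθ
    rwa [div_le_iff₀ (by positivity), mul_comm] at this

/-- Bin probabilities of histograms that are close to a density bounded away from zero and
infinity. -/
lemma bounds_of_hellinger_le {p : I → ℝ} (hp : IsDensity p) {c C : ℝ} (hc : 0 < c)
    (h : ∀ x, c ≤ p x ∧ p x ≤ C) {k : ℕ} {θ : Fin k → ℝ} {r : ℝ}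
    (hr : hellinger (histDensity ⟨k, θ⟩) p ≤ r) (hkr : k * r ^ 2 < c / 4) (j : Fin k) :
    c / 4 / k ≤ θ j ∧ θ j ≤ 4 * C / k := by
  have hk : (0 : ℝ) < k := by exact_mod_cast j.pos
  have hC : c ≤ C := (h 0).1.trans (h 0).2
  have h1 := setIntegral_hellinger_le hp θ j
  rw [hellinger_comm] at h1
  have hr2 : hellinger (histDensity ⟨k, θ⟩) p ^ 2 ≤ r ^ 2 :=
    pow_le_pow_left₀ (hellinger_nonneg _ _) hr 2
  -- A squared gap of at least `d` between the roots on a whole bin contributes at least `d / k` to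
  -- the squared Hellinger distance. A weight outside the stated range forces such a gap, of size
  -- `c/4` or `C`.
  have hlow (d : ℝ) (hd : ∀ x, d ≤ (√(p x) - √(k * θ j)) ^ 2) : d ≤ k * r ^ 2 := by
    have hi : IntegrableOn (fun x => (√(p x) - √(k * θ j)) ^ 2) (bin k j) := by
      have := (hp.rootL2.integrable_sq_sub (rootL2_histDensity θ)).integrableOn (s := bin k j)
      refine this.congr_fun (fun x hx => ?_) (measurableSet_bin k j)
      simp only [histDensity_of_mem θ hx]
    have h2 : ∫ _ in bin k j, d ≤ ∫ x in bin k j, (√(p x) - √(k * θ j)) ^ 2 :=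
      setIntegral_mono (integrable_const _).integrableOn hi hd
    rw [setIntegral_bin_const, div_le_iff₀ hk] at h2
    nlinarith
  constructor
  · by_contra hlt
    rw [not_le, lt_div_iff₀ hk] at hlt
    have : c / 4 ≤ k * r ^ 2 := by
      refine hlow _ fun x => ?_
      have h3 : √(k * θ j) ≤ √c / 2 := by
        rw [Real.sqrt_le_left (by positivity), div_pow, Real.sq_sqrt hc.le]
        linarith
      have h4 : √c ≤ √(p x) := Real.sqrt_le_sqrt (h x).1
      have h5 : √c ^ 2 = c := Real.sq_sqrt hc.le
      have : √c / 2 ≤ √(p x) - √(k * θ j) := by linarith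
      calc c / 4 = (√c / 2) ^ 2 := by rw [div_pow, h5]; norm_num
        _ ≤ _ := by gcongr
    linarith
  · by_contra hlt
    rw [not_le, div_lt_iff₀ hk] at hlt
    have : C ≤ k * r ^ 2 := by
      refine hlow _ fun x => ?_
      have hC0 : 0 ≤ C := by linarith
      have h3 : 2 * √C ≤ √(k * θ j) := by
        refine Real.le_sqrt_of_sq_le ?_
        rw [mul_pow, Real.sq_sqrt hC0]
        linarith
      have h4 : √(p x) ≤ √C := Real.sqrt_le_sqrt (h x).2
      have h5 : √C ^ 2 = C := Real.sq_sqrt hC0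
      have : √C ≤ √(k * θ j) - √(p x) := by linarith
      calc C = √C ^ 2 := h5.symm
        _ ≤ (√(k * θ j) - √(p x)) ^ 2 := by gcongr
        _ = _ := by ring
    linarith

/-- A histogram with `k` bins is also one with `kR` bins. Only refinements can be compared in this
way; the bias need not be monotone in `k`. -/
lemma bias_mul_le {p : I → ℝ} {k R : ℕ} (hk : 0 < k) (hR : 0 < R) :
    bias p (k * R) ≤ bias p k := by
  refine le_bias hk fun θ hθ => ?_
  have hk' : (0 : ℝ) < k := by exact_mod_cast hk
  have hR' : (0 : ℝ) < R := by exact_mod_cast hR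
  let θ' : Fin (k * R) → ℝ := fun i => θ i.divNat / R
  have hbin (i : Fin (k * R)) : bin (k * R) i ⊆ bin k i.divNat := by
    intro x hx
    have hdiv : ((i.divNat : ℕ) : ℕ) = (i : ℕ) / R := rfl
    have h1 : ((i.divNat : ℕ) : ℝ) * R ≤ (i : ℕ) := by
      rw [hdiv]; exact_mod_cast Nat.div_mul_le_self _ _
    have h2 : ((i : ℕ) : ℝ) + 1 ≤ (((i.divNat : ℕ) : ℝ) + 1) * R := by
      rw [hdiv]
      have := Nat.lt_div_mul_add (a := (i : ℕ)) hR
      have h3 : (i : ℕ) + 1 ≤ ((i : ℕ) / R + 1) * R := by rw [add_mul, one_mul]; omega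
      exact_mod_cast h3
    obtain ⟨hx1, hx2⟩ := hx
    push_cast at hx1 hx2
    constructor
    · refine le_trans ?_ hx1
      rw [div_le_div_iff₀ hk' (by positivity)]
      nlinarith
    · refine hx2.trans_le ?_
      rw [div_le_div_iff₀ (by positivity) hk']
      nlinarith
  have heq : histDensity ⟨k * R, θ'⟩ = histDensity ⟨k, θ⟩ := by
    funext x
    by_cases hx : (x : ℝ) < 1
    · obtain ⟨i, hi⟩ := exists_mem_bin (Nat.mul_pos hk hR) hx
      rw [histDensity_of_mem _ hi, histDensity_of_mem _ (hbin i hi)]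
      simp only [θ']
      push_cast
      field_simp
    · rw [histDensity_of_one_le _ hx, histDensity_of_one_le _ hx]
  have hθ' : θ' ∈ stdSimplex ℝ (Fin (k * R)) := by
    refine ⟨fun i => div_nonneg (hθ.1 _) hR'.le, ?_⟩
    rw [← integral_histDensity (Nat.mul_pos hk hR) θ', heq, integral_histDensity hk, hθ.2]
  rw [← heq]
  exact bias_le hθ'

lemma bias_le_of_holder {β L₀ c₀ C₀ : ℝ} (hc₀ : 0 < c₀) (hβ : 0 < β) (hL₀ : 0 < L₀) {p : I → ℝ}
    (hp : p ∈ holderDensities β L₀ c₀ C₀) {k : ℕ} (hk : 0 < k) :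
    bias p k ≤ L₀ ^ 2 / c₀ * (k : ℝ) ^ (-(2 * β)) := by
  obtain ⟨hd, hb, hL⟩ := hp
  have hk' : (0 : ℝ) < k := by exact_mod_cast hk
  refine (bias_le (binMass_mem_stdSimplex hd hk)).trans ?_
  rw [hellinger_sq]
  have hpt : ∀ᵐ x : I, (√(p x) - √(histDensity ⟨k, binMass p k⟩ x)) ^ 2 ≤
      L₀ ^ 2 / c₀ * (k : ℝ) ^ (-(2 * β)) := by
    filter_upwards [ae_coe_lt_one] with x hx
    obtain ⟨j, hj⟩ := exists_mem_bin hk hx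
    rw [histDensity_of_mem _ hj]
    set q := k * binMass p k j with hq
    have hq0 : c₀ ≤ q := (binMass_bounds hd hb j).1
    have hdiff : |p x - q| ≤ L₀ * (k : ℝ) ^ (-β) := by
      have hy : ∀ y ∈ bin k j, |p x - p y| ≤ L₀ * (k : ℝ) ^ (-β) := by
        intro y hy
        refine (hL x y).trans ?_
        have hxy : |(x : ℝ) - y| ≤ (k : ℝ)⁻¹ := by
          have e : ((j : ℝ) + 1) / k = j / k + (k : ℝ)⁻¹ := by field_simp
          have h1 := hj.1; have h2 := hj.2; have h3 := hy.1; have h4 := hy.2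
          rw [e] at h2 h4
          rw [abs_le]; constructor <;> linarith
        rw [Real.rpow_neg hk'.le, ← Real.inv_rpow hk'.le]
        gcongr
      have hup : ∫ y in bin k j, p y ≤ ∫ _ in bin k j, (p x + L₀ * (k : ℝ) ^ (-β)) :=
        setIntegral_mono_on hd.integrable.integrableOn (integrable_const _).integrableOn
          (measurableSet_bin k j) fun y hy' => by linarith [(abs_le.1 (hy y hy')).1]
      have hlo : ∫ _ in bin k j, (p x - L₀ * (k : ℝ) ^ (-β)) ≤ ∫ y in bin k j, p y :=
        setIntegral_mono_on (integrable_const _).integrableOn hd.integrable.integrableOn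
          (measurableSet_bin k j) fun y hy' => by linarith [(abs_le.1 (hy y hy')).2]
      rw [setIntegral_bin_const] at hup hlo
      change binMass p k j ≤ _ at hup
      change _ ≤ binMass p k j at hlo
      rw [le_div_iff₀ hk'] at hup
      rw [div_le_iff₀ hk'] at hlo
      rw [abs_le]; constructor <;> linarith
    have hpx := (hb x).1
    have h1 : c₀ * (√(p x) - √q) ^ 2 ≤ (p x - q) ^ 2 := by
      have e1 : p x = √(p x) ^ 2 := (Real.sq_sqrt (hd.2.1 x)).symm
      have e2 : q = √q ^ 2 := (Real.sq_sqrt (hc₀.le.trans hq0)).symm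
      have e3 : (p x - q) ^ 2 = (√(p x) + √q) ^ 2 * (√(p x) - √q) ^ 2 := by
        conv_lhs => rw [e1, e2]
        ring
      rw [e3]
      refine mul_le_mul_of_nonneg_right ?_ (sq_nonneg _)
      nlinarith [Real.sqrt_nonneg (p x), Real.sqrt_nonneg q]
    have h2 : (p x - q) ^ 2 ≤ (L₀ * (k : ℝ) ^ (-β)) ^ 2 := by
      rw [← sq_abs]; exact pow_le_pow_left₀ (abs_nonneg _) hdiff 2
    have h3 : (L₀ * (k : ℝ) ^ (-β)) ^ 2 = L₀ ^ 2 * (k : ℝ) ^ (-(2 * β)) := by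
      rw [mul_pow, ← Real.rpow_natCast, ← Real.rpow_natCast, ← Real.rpow_mul hk'.le]
      congr 2; push_cast; ring
    rw [div_mul_eq_mul_div, le_div_iff₀ hc₀, ← h3]
    linarith
  calc ∫ x, (√(p x) - √(histDensity ⟨k, binMass p k⟩ x)) ^ 2
      ≤ ∫ _ : I, L₀ ^ 2 / c₀ * (k : ℝ) ^ (-(2 * β)) :=
        integral_mono_ae (hd.rootL2.integrable_sq_sub (rootL2_histDensity _))
          (integrable_const _) hpt
    _ = _ := by simp

lemma holderDensities_anti {β β' L₀ c₀ C₀ : ℝ} (hβ : 0 < β) (h : β ≤ β') (hL₀ : 0 < L₀) :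
    holderDensities β' L₀ c₀ C₀ ⊆ holderDensities β L₀ c₀ C₀ := by
  rintro p ⟨h1, h2, h3⟩
  refine ⟨h1, h2, fun x y => (h3 x y).trans ?_⟩
  refine mul_le_mul_of_nonneg_left ?_ hL₀.le
  have hxy : |(x : ℝ) - y| ≤ 1 := by
    rw [abs_le]; constructor <;> linarith [x.2.1, x.2.2, y.2.1, y.2.2]
  rcases (abs_nonneg ((x : ℝ) - y)).eq_or_lt with h0 | h0
  · rw [← h0, Real.zero_rpow hβ.ne', Real.zero_rpow (hβ.trans_le h).ne']
  · exact Real.rpow_le_rpow_of_exponent_ge h0 hxy h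

/-! ### The oracle number of bins -/

lemma oracleBins_mem {κ : ℕ} (hκ : 1 ≤ κ) {p : I → ℝ} (hp : IsDensity p) {n : ℕ} (hn : 2 ≤ n) :
    κ ≤ oracleBins κ p n ∧
      bias p (oracleBins κ p n) ≤ oracleBins κ p n * Real.log n / n := by
  have hn' : (2 : ℝ) ≤ n := by exact_mod_cast hn
  have hl : 0 < Real.log n := Real.log_pos (by linarith)
  have hne : {k : ℕ | κ ≤ k ∧ bias p k ≤ k * Real.log n / n}.Nonempty := by
    obtain ⟨m, hm⟩ := exists_nat_ge (2 * n / Real.log n)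
    refine ⟨max κ m, le_max_left _ _, (bias_le_two hp (by omega)).trans ?_⟩
    rw [le_div_iff₀ (by linarith), ← div_le_iff₀ hl]
    exact hm.trans (by exact_mod_cast le_max_right _ _)
  exact Nat.sInf_mem hne

lemma lt_bias_of_lt_oracleBins {κ : ℕ} {p : I → ℝ} {n k : ℕ} (hk : κ ≤ k)
    (hlt : k < oracleBins κ p n) : k * Real.log n / n < bias p k := by
  by_contra h
  rw [not_lt] at h
  exact Nat.notMem_of_lt_sInf hlt ⟨hk, h⟩

lemma log_div_anti {m n : ℕ} (hm : 3 ≤ m) (hmn : m ≤ n) :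
    Real.log n / n ≤ Real.log m / m := by
  have h3 : Real.exp 1 ≤ 3 := by linarith [Real.exp_one_lt_d9]
  have hm' : (3 : ℝ) ≤ m := by exact_mod_cast hm
  have hmn' : (m : ℝ) ≤ n := by exact_mod_cast hmn
  exact Real.log_div_self_antitoneOn (h3.trans hm') (h3.trans (hm'.trans hmn')) hmn'

lemma oracleBins_mono {κ : ℕ} (hκ : 1 ≤ κ) {p : I → ℝ} (hp : IsDensity p) {m n : ℕ} (hm : 3 ≤ m)
    (hmn : m ≤ n) : oracleBins κ p m ≤ oracleBins κ p n := by
  obtain ⟨h1, h2⟩ := oracleBins_mem hκ hp (n := n) (by omega)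
  refine Nat.sInf_le ⟨h1, h2.trans ?_⟩
  rw [mul_div_assoc, mul_div_assoc]
  exact mul_le_mul_of_nonneg_left (log_div_anti hm hmn) (Nat.cast_nonneg _)

/-- The polished tail is assumed from some `n` on that may depend on `p`. Since `k_n` increases with
`n`, the condition at a large sample size contains those at smaller ones, and so becomes uniform
over the class. -/
lemma polishedTailAt_of_polishedTail {κ : ℕ} (hκ : 1 ≤ κ) {R₀ k₀ : ℕ} {τ : ℝ} {p : I → ℝ}
    (hp : p ∈ polishedTail κ R₀ k₀ τ) {n : ℕ} (hn : 3 ≤ n) : p ∈ polishedTailAt κ R₀ k₀ τ n := by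
  obtain ⟨N, hN⟩ := eventually_atTop.1 (show ∀ᶠ n in atTop, p ∈ polishedTailAt κ R₀ k₀ τ n from hp)
  have h := hN (max n N) (le_max_right _ _)
  exact ⟨h.1, fun k hk hkn => h.2 k hk (hkn.trans (oracleBins_mono hκ h.1 hn (le_max_left _ _)))⟩

/-- Under the polished tail condition the number of bins cannot be much smaller than the oracle
number of bins if the bias is of the order of the oracle rate. -/
lemma exists_oracleBins_le_mul {κ : ℕ} (hκ : 1 ≤ κ) {R₀ k₀ : ℕ} {τ : ℝ} (hR₀ : 1 < R₀)
    (hτ : 0 < τ) (hτ1 : τ < 1) {D : ℝ} (hD : 0 < D) :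
    ∃ N : ℕ, 0 < N ∧ ∀ p ∈ polishedTail κ R₀ k₀ τ, ∀ n, 3 ≤ n → ∀ k, κ ≤ k →
      bias p k ≤ D * (oracleBins κ p n * Real.log n / n) → oracleBins κ p n ≤ N * k := by
  have hR0 : (0 : ℝ) < R₀ := by positivity
  -- After `m` reductions by `τ` the bias has lost the factor `D` and the factor `R₀` of the final
  -- overshoot.
  obtain ⟨m, hm⟩ := exists_pow_lt_of_lt_one (show 0 < (R₀ * D)⁻¹ by positivity) hτ1
  -- The factor `R₀ ^ k₀` lifts `k` above `k₀`, where the polished tail applies; `R₀ ^ m` leaves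
  -- room for `m` reductions before `K` is reached.
  refine ⟨R₀ ^ (k₀ + m), by positivity, fun p hp n hn k hk hb => ?_⟩
  obtain ⟨hd, hpol⟩ := polishedTailAt_of_polishedTail hκ hp hn
  have hn' : (3 : ℝ) ≤ n := by exact_mod_cast hn
  have hl : 0 < Real.log n := Real.log_pos (by linarith)
  have hK1 := (oracleBins_mem hκ hd (n := n) (by omega)).1
  set K := oracleBins κ p n
  by_contra hlt
  rw [not_le] at hlt
  set k' := k * R₀ ^ k₀
  have hkk' : k ≤ k' := Nat.le_mul_of_pos_right _ (by positivity)
  have hk₀' : k₀ ≤ k' := by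
    have : k₀ < R₀ ^ k₀ := Nat.lt_pow_self hR₀
    calc k₀ ≤ 1 * R₀ ^ k₀ := by omega
      _ ≤ k' := Nat.mul_le_mul_right _ (by omega)
  have hk'm : k' * R₀ ^ m < K := by
    calc k' * R₀ ^ m = R₀ ^ (k₀ + m) * k := by simp only [k']; ring
      _ < K := hlt
  -- The first power that reaches `K` is `j = J + 1`: the number of bins `k' R₀^J` is still below
  -- `K`, but within a factor `R₀` of it.
  have hex : ∃ i, K ≤ k' * R₀ ^ i := by
    obtain ⟨i, hi⟩ := pow_unbounded_of_one_lt K hR₀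
    exact ⟨i, hi.le.trans (Nat.le_mul_of_pos_left _ (by omega))⟩
  set j := Nat.find hex
  have hj : K ≤ k' * R₀ ^ j := Nat.find_spec hex
  have hmj : m < j := by
    by_contra h
    rw [not_lt] at h
    have : k' * R₀ ^ j ≤ k' * R₀ ^ m := Nat.mul_le_mul_left _ (Nat.pow_le_pow_right (by omega) h)
    omega
  obtain ⟨J, hJ⟩ : ∃ J, j = J + 1 := ⟨j - 1, by omega⟩
  have hbelow (i : ℕ) (hi : i ≤ J) : k' * R₀ ^ i < K := by
    have := Nat.find_min hex (show i < j by omega)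
    omega
  have hiter (i : ℕ) (hi : i ≤ J) : bias p (k' * R₀ ^ i) ≤ τ ^ i * bias p k' := by
    induction i with
    | zero => simp
    | succ i ih =>
      have h1 := hpol (k' * R₀ ^ i) (hk₀'.trans (Nat.le_mul_of_pos_right _ (by positivity)))
        (hbelow i (by omega)).le
      calc bias p (k' * R₀ ^ (i + 1)) = bias p (k' * R₀ ^ i * R₀) := by rw [pow_succ, ← Nat.mul_assoc k']
        _ ≤ τ * bias p (k' * R₀ ^ i) := h1
        _ ≤ τ * (τ ^ i * bias p k') := mul_le_mul_of_nonneg_left (ih (by omega)) hτ.le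
        _ = τ ^ (i + 1) * bias p k' := by rw [pow_succ]; ring
  -- Below `K` the bias exceeds `k log n / n`, here with `k = k' R₀^J ≥ K / R₀`; the iterated
  -- polished tail bounds the same bias by `τ^m D K log n / n`. The choice of `m` makes these
  -- incompatible.
  have h2 := lt_bias_of_lt_oracleBins (κ := κ) (p := p) (n := n) (k := k' * R₀ ^ J)
    (hk.trans (hkk'.trans (Nat.le_mul_of_pos_right _ (by positivity)))) (hbelow J le_rfl)
  have h3 : bias p (k' * R₀ ^ J) ≤ τ ^ m * (D * (K * Real.log n / n)) := by
    refine (hiter J le_rfl).trans ?_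
    have h4 : bias p k' ≤ bias p k := bias_mul_le (by omega) (by positivity)
    have h5 : τ ^ J ≤ τ ^ m := pow_le_pow_of_le_one hτ.le hτ1.le (by omega)
    exact mul_le_mul h5 (h4.trans hb) (bias_nonneg _ _) (by positivity)
  have h6 : (K : ℝ) ≤ (k' * R₀ ^ J : ℕ) * R₀ := by
    have : K ≤ k' * R₀ ^ J * R₀ := by rw [mul_assoc, ← pow_succ, ← hJ]; exact hj
    exact_mod_cast this
  have hx : 0 < Real.log n / n := by positivity
  have hK0 : (0 : ℝ) < K := by exact_mod_cast (show 0 < K by omega)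
  have h7 : (k' * R₀ ^ J : ℕ) * (Real.log n / n) < τ ^ m * D * K * (Real.log n / n) := by
    calc _ = (k' * R₀ ^ J : ℕ) * Real.log n / n := by ring
      _ < _ := h2.trans_le h3
      _ = _ := by ring
  have h8 := lt_of_mul_lt_mul_right h7 hx.le
  have h9 : τ ^ m * (R₀ * D) < 1 := by
    have := mul_lt_mul_of_pos_right hm (show 0 < R₀ * D by positivity)
    rwa [inv_mul_cancel₀ (by positivity)] at this
  have h10 : (K : ℝ) < K := by
    calc (K : ℝ) ≤ (k' * R₀ ^ J : ℕ) * R₀ := h6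
      _ < τ ^ m * D * K * R₀ := mul_lt_mul_of_pos_right h8 hR0
      _ = τ ^ m * (R₀ * D) * K := by ring
      _ < 1 * K := mul_lt_mul_of_pos_right h9 hK0
      _ = K := one_mul _
  exact lt_irrefl _ h10

/-- The oracle number of bins for Hölder densities. -/
lemma exists_oracleBins_le {κ : ℕ} (hκ : 1 ≤ κ) {L₀ c₀ : ℝ} (C₀ : ℝ) (hL₀ : 0 < L₀)
    (hc₀ : 0 < c₀) :
    ∃ K : ℝ, 0 < K ∧ ∀ n : ℕ, 3 ≤ n → ∀ β, 0 < β → ∀ p ∈ holderDensities β L₀ c₀ C₀,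
      (oracleBins κ p n : ℝ) ≤ K * ((n : ℝ) / Real.log n) ^ (1 / (1 + 2 * β)) := by
  -- The constant must make the candidate number of bins at least `κ` and also absorb the constant
  -- of the Hölder bias bound.
  set M : ℝ := max κ (L₀ ^ 2 / c₀)
  have hκ' : (1 : ℝ) ≤ κ := by exact_mod_cast hκ
  have hMκ : (κ : ℝ) ≤ M := le_max_left _ _
  have hM1 : 1 ≤ M := hκ'.trans hMκ
  have hML : L₀ ^ 2 / c₀ ≤ M := le_max_right _ _
  refine ⟨M + 1, by linarith, fun n hn β hβ p hp => ?_⟩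
  have hn' : (3 : ℝ) ≤ n := by exact_mod_cast hn
  have hn0 : (0 : ℝ) < n := by linarith
  have hl : 0 < Real.log n := Real.log_pos (by linarith)
  set x : ℝ := n / Real.log n with hx
  have hx1 : 1 ≤ x := by
    rw [hx, one_le_div hl]
    linarith [Real.log_le_sub_one_of_pos hn0]
  have hx0 : 0 < x := by linarith
  set e : ℝ := 1 / (1 + 2 * β) with he
  have he0 : 0 < e := by positivity
  have hxe : 1 ≤ x ^ e := Real.one_le_rpow hx1 he0.le
  -- This order of `k` balances the bias bound `k^(-2β)` against `k log n / n = k / x`. Rounding up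
  -- accounts for `M + 1` in place of `M`.
  set k := ⌈M * x ^ e⌉₊
  have hk1 : M * x ^ e ≤ k := Nat.le_ceil _
  have hk2 : (k : ℝ) ≤ (M + 1) * x ^ e := by
    have := (Nat.ceil_lt_add_one (show 0 ≤ M * x ^ e by positivity)).le
    linarith
  have hκk : κ ≤ k := by
    have : (κ : ℝ) ≤ k := hMκ.trans (le_trans (by nlinarith) hk1)
    exact_mod_cast this
  have hk0 : 0 < k := by omega
  have hk0' : (0 : ℝ) < k := by exact_mod_cast hk0
  refine le_trans ?_ hk2
  have hle : oracleBins κ p n ≤ k := by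
    refine Nat.sInf_le ⟨hκk, (bias_le_of_holder hc₀ hβ hL₀ hp hk0).trans ?_⟩
    have h1 : M * x ≤ (k : ℝ) ^ (1 + 2 * β) := by
      have h2 : (x ^ e) ^ (1 + 2 * β) = x := by
        rw [← Real.rpow_mul hx0.le, he, one_div, inv_mul_cancel₀ (by positivity), Real.rpow_one]
      calc M * x ≤ M ^ (1 + 2 * β) * x := by
            gcongr
            exact Real.self_le_rpow_of_one_le hM1 (by linarith)
        _ = (M * x ^ e) ^ (1 + 2 * β) := by
            rw [Real.mul_rpow (by linarith) (by positivity), h2]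
        _ ≤ (k : ℝ) ^ (1 + 2 * β) := by gcongr
    rw [Real.rpow_add hk0', Real.rpow_one] at h1
    rw [Real.rpow_neg hk0'.le]
    have hkb : 0 < (k : ℝ) ^ (2 * β) := Real.rpow_pos_of_pos hk0' _
    rw [← div_eq_mul_inv, div_le_iff₀ hkb]
    refine hML.trans ?_
    have h3 : (k : ℝ) * Real.log n / n * (k : ℝ) ^ (2 * β) = (k * (k : ℝ) ^ (2 * β)) / x := by
      rw [hx]; field_simp
    rw [h3, le_div_iff₀ hx0]
    exact h1
  exact_mod_cast hle

lemma rate_oracleBins_le {κ : ℕ} (hκ : 1 ≤ κ) {p : I → ℝ} (hp : IsDensity p) {n : ℕ}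
    (hn : 2 ≤ n) : rate p n (oracleBins κ p n) ≤ √2 * √(oracleBins κ p n * Real.log n / n) := by
  rw [rate, ← Real.sqrt_mul (by norm_num)]
  refine Real.sqrt_le_sqrt ?_
  have := (oracleBins_mem hκ hp hn).2
  linarith

/-- The model with one bin contains only the uniform density, so its posterior is a point mass. The
separation `δ` from the uniform density serves to rule this model out. -/
lemma hellinger_hist_one {p : I → ℝ} {θ : Fin 1 → ℝ} (hθ : θ ∈ stdSimplex ℝ (Fin 1)) :
    hellinger (histDensity ⟨1, θ⟩) p = hellinger p fun _ => 1 := by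
  rw [hellinger_comm]
  unfold hellinger
  congr 1
  refine integral_congr_ae ?_
  filter_upwards [ae_coe_lt_one] with x hx
  obtain ⟨j, hj⟩ := exists_mem_bin one_pos hx
  have h0 : θ 0 = 1 := by simpa using hθ.2
  rw [histDensity_of_mem θ hj, Subsingleton.elim j 0, h0]
  simp

/-! ### Maximum likelihood -/

/-- The maximum likelihood histogram, and a lower bound for the likelihood around it. -/
lemma exists_mle {n k : ℕ} (hn : 0 < n) (hk : 0 < k) {y : Fin n → I}
    (hy : ∀ i, (y i : ℝ) < 1) :
    ∃ m ∈ stdSimplex ℝ (Fin k),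
      (∀ θ ∈ stdSimplex ℝ (Fin k),
        jointDensity (histDensity ⟨k, θ⟩) y ≤ jointDensity (histDensity ⟨k, m⟩) y) ∧
      ∀ θ ∈ stdSimplex ℝ (Fin k), (∀ j, 0 < θ j) → jointDensity (histDensity ⟨k, m⟩) y ≤
        Real.exp (n * ∑ j, (m j - θ j) ^ 2 / θ j) * jointDensity (histDensity ⟨k, θ⟩) y := by
  classical
  have hn' : (0 : ℝ) < n := by exact_mod_cast hn
  have hk' : (0 : ℝ) < k := by exact_mod_cast hk
  choose idx hidx using fun i => exists_mem_bin hk (hy i)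
  have hJ (θ : Fin k → ℝ) : jointDensity (histDensity ⟨k, θ⟩) y = ∏ i, (k * θ (idx i)) :=
    Finset.prod_congr rfl fun i _ => histDensity_of_mem θ (hidx i)
  let m (j : Fin k) : ℝ := ((Finset.univ.filter fun i => idx i = j).card : ℝ) / n
  have hsum (f : Fin k → ℝ) : ∑ i, f (idx i) = n * ∑ j, m j * f j := by
    rw [← Finset.sum_fiberwise Finset.univ idx, Finset.mul_sum]
    refine Finset.sum_congr rfl fun j _ => ?_
    rw [Finset.sum_congr rfl fun i hi => by rw [(Finset.mem_filter.1 hi).2], Finset.sum_const,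
      nsmul_eq_mul]
    simp only [m]
    field_simp
  have hm0 (j) : 0 ≤ m j := by simp only [m]; positivity
  have hmpos (i : Fin n) : 0 < m (idx i) := by
    refine div_pos ?_ hn'
    exact_mod_cast Finset.card_pos.2 ⟨i, by simp⟩
  have hm1 : ∑ j, m j = 1 := by
    have := hsum fun _ => 1
    simp only [Finset.sum_const, Finset.card_univ, Fintype.card_fin, nsmul_eq_mul, mul_one] at this
    nlinarith
  -- The inequality `x ≤ exp(x - 1)` in each factor yields both the maximality of the empirical
  -- frequencies and the quadratic bound on the loss of likelihood around them.
  have hcomp (a b : Fin k → ℝ) (ha : ∀ j, 0 ≤ a j) (hb : ∀ i, 0 < b (idx i)) :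
      ∏ i, (k * a (idx i)) ≤ Real.exp (∑ i, (a (idx i) / b (idx i) - 1)) *
        ∏ i, (k * b (idx i)) := by
    rw [Real.exp_sum, ← Finset.prod_mul_distrib]
    refine Finset.prod_le_prod (fun i _ => mul_nonneg hk'.le (ha _)) fun i _ => ?_
    have h1 := Real.add_one_le_exp (a (idx i) / b (idx i) - 1)
    have h2 := hb i
    calc k * a (idx i) = (a (idx i) / b (idx i) - 1 + 1) * (k * b (idx i)) := by
          field_simp; ring
      _ ≤ _ := by gcongr
  refine ⟨m, ⟨hm0, hm1⟩, fun θ hθ => ?_, fun θ hθ hpos => ?_⟩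
  · rw [hJ, hJ]
    refine (hcomp θ m hθ.1 hmpos).trans ?_
    have hle : ∑ i, (θ (idx i) / m (idx i) - 1) ≤ 0 := by
      rw [hsum fun j => θ j / m j - 1]
      refine mul_nonpos_of_nonneg_of_nonpos hn'.le ?_
      -- Bins without observations contribute `0` on the left and `θ j ≥ 0` on the right; this is
      -- why only an inequality holds.
      have : ∑ j, m j * (θ j / m j - 1) ≤ ∑ j, (θ j - m j) := by
        refine Finset.sum_le_sum fun j _ => ?_
        rcases (hm0 j).eq_or_lt with h | h
        · rw [← h]; simpa using hθ.1 j
        · refine le_of_eq ?_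
          field_simp
      rw [Finset.sum_sub_distrib, hθ.2, hm1, sub_self] at this
      exact this
    have h3 : 0 ≤ ∏ i, (k * m (idx i)) :=
      Finset.prod_nonneg fun i _ => mul_nonneg hk'.le (hmpos i).le
    exact mul_le_of_le_one_left h3 (Real.exp_le_one_iff.2 hle)
  · rw [hJ, hJ]
    refine (hcomp m θ hm0 fun i => hpos _).trans (le_of_eq ?_)
    congr 2
    rw [hsum fun j => m j / θ j - 1]
    congr 1
    -- Subtracting `m j - θ j`, whose sum is zero, completes the exponent to the χ²-distance.
    have : ∑ j, (m j - θ j) ^ 2 / θ j = ∑ j, (m j * (m j / θ j - 1) - (m j - θ j)) := by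
      refine Finset.sum_congr rfl fun j _ => ?_
      have := (hpos j).ne'
      field_simp
    rw [this, Finset.sum_sub_distrib, Finset.sum_sub_distrib (f := m), hθ.2, hm1]
    ring

/-! ### Small Hellinger balls -/

lemma sum_sq_sub_le {k : ℕ} (hk : 0 < k) {C : ℝ} {θ θ' : Fin k → ℝ} (h0 : ∀ j, 0 ≤ θ j)
    (h0' : ∀ j, 0 ≤ θ' j) (h : ∀ j, θ j ≤ 4 * C / k) (h' : ∀ j, θ' j ≤ 4 * C / k) :
    ∑ j, (θ j - θ' j) ^ 2 ≤
      16 * C / k * hellinger (histDensity ⟨k, θ⟩) (histDensity ⟨k, θ'⟩) ^ 2 := by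
  rw [hellinger_hist_sq hk, Finset.mul_sum]
  refine Finset.sum_le_sum fun j _ => ?_
  have e1 := Real.sq_sqrt (h0 j)
  have e2 := Real.sq_sqrt (h0' j)
  have e3 : (θ j - θ' j) ^ 2 = (√(θ j) + √(θ' j)) ^ 2 * (√(θ j) - √(θ' j)) ^ 2 := by
    conv_lhs => rw [← e1, ← e2]
    ring
  rw [e3]
  refine mul_le_mul_of_nonneg_right ?_ (sq_nonneg _)
  have h1 : (√(θ j) + √(θ' j)) ^ 2 ≤ 2 * (θ j + θ' j) := by
    nlinarith [sq_nonneg (√(θ j) - √(θ' j))]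
  have h2 := h j
  have h3 := h' j
  have e4 : 16 * C / k = 2 * (4 * C / k + 4 * C / k) := by ring
  rw [e4]
  linarith

/-- Prior and posterior bounds compare a small set of histograms close to `p` to a ball around a
histogram `m` close to `p`. -/
lemma dirichlet_le_of_hellinger_diam_le {p : I → ℝ} (hp : IsDensity p) {c C : ℝ} (hc : 0 < c)
    (hpb : ∀ x, c ≤ p x ∧ p x ≤ C) {k : ℕ} (hk : 0 < k) {a : Fin k → ℝ} {C₁ : ℝ}
    (ha : ∀ j, 0 < a j) (haC : ∀ j, a j ≤ C₁) {r d ρ : ℝ} (hkr : k * r ^ 2 < c / 4)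
    (hd : 0 < d) (hρ : 0 < ρ) (hρk : ρ ≤ c / 8 / k) {A : Set (Fin k → ℝ)}
    (hA : ∀ θ ∈ A, θ ∈ stdSimplex ℝ (Fin k) ∧ hellinger (histDensity ⟨k, θ⟩) p ≤ r)
    (hAd : ∀ θ ∈ A, ∀ θ' ∈ A, hellinger (histDensity ⟨k, θ⟩) (histDensity ⟨k, θ'⟩) ≤ d)
    {m : Fin k → ℝ} (hm1 : ∑ j, m j = 1) (hm : ∀ j, c / 4 / k ≤ m j ∧ m j ≤ 4 * C / k) :
    dirichlet a A ≤
      ENNReal.ofReal ((64 * C / c) ^ ((C₁ + 1) * k) * (4 * √C * d / (√k * ρ)) ^ (k - 1)) *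
        dirichlet a {θ | ∑ j, θ j = 1 ∧ ∑ j, (θ j - m j) ^ 2 ≤ ρ ^ 2} := by
  have hk' : (0 : ℝ) < k := by exact_mod_cast hk
  have hC : 0 < C := hc.trans_le ((hpb 0).1.trans (hpb 0).2)
  have hcC : c ≤ C := (hpb 0).1.trans (hpb 0).2
  rcases A.eq_empty_or_nonempty with rfl | ⟨θ₁, hθ₁⟩
  · simp
  have hb (θ) (hθ : θ ∈ A) := bounds_of_hellinger_le hp hc hpb (hA θ hθ).2 hkr
  -- Chosen so that `t ρ = 4 √C d / √k`, the Euclidean radius that `sum_sq_sub_le` assigns to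
  -- Hellinger distance `d`.
  set t := 4 * √C * d / (√k * ρ) with ht
  have hCs := Real.sqrt_pos.2 hC
  have hks := Real.sqrt_pos.2 hk'
  have ht0 : 0 < t := by positivity
  -- The values `u = c/8` and `v = 8C` leave the margins around `[c/4, 4C]` that the dilation
  -- requires at `m`.
  have h := dirichlet_ball_le hk ha haC (u := c / 8) (v := 8 * C) (t := t) (ρ := ρ)
    (by positivity) ht0 hρ.le hρk (hA θ₁ hθ₁).1.2 hm1 fun j => by
      refine ⟨le_trans (le_of_eq (by ring)) (hm j).1, (hm j).2.trans ?_⟩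
      gcongr
      linarith
  have e : 8 * C / (c / 8) = 64 * C / c := by field_simp; norm_num
  rw [e] at h
  refine (measure_mono fun θ hθ => ?_).trans h
  refine ⟨(hA θ hθ).1.2, fun j => ⟨le_trans ?_ (hb θ hθ j).1, (hb θ hθ j).2.trans ?_⟩, ?_⟩
  · gcongr; norm_num
  · gcongr; norm_num
  · refine (sum_sq_sub_le hk (hA θ hθ).1.1 (hA θ₁ hθ₁).1.1 (fun j => (hb θ hθ j).2)
      fun j => (hb θ₁ hθ₁ j).2).trans ?_
    have e2 : (t * ρ) ^ 2 = 16 * C / k * d ^ 2 := by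
      have e3 : t * ρ = 4 * √C * d / √k := by rw [ht]; field_simp
      rw [e3, div_pow, mul_pow, mul_pow, Real.sq_sqrt hC.le, Real.sq_sqrt hk'.le]
      ring
    rw [e2]
    gcongr
    · exact hellinger_nonneg _ _
    · exact hAd θ hθ θ₁ hθ₁

/-- The ball is compared with one around the uniform weights of the largest admissible radius
`c/(8k)`, whose mass is bounded by one. The uniform weights are admissible since `c ≤ 1 ≤ C` for
bounds on a density. -/
lemma dirichlet_hellinger_ball_le {p : I → ℝ} (hp : IsDensity p) {c C : ℝ} (hc : 0 < c)
    (hpb : ∀ x, c ≤ p x ∧ p x ≤ C) {k : ℕ} (hk : 0 < k) {a : Fin k → ℝ} {C₁ : ℝ}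
    (ha : ∀ j, 0 < a j) (haC : ∀ j, a j ≤ C₁) {r : ℝ} (hr : 0 < r) (hkr : k * r ^ 2 < c / 4)
    {A : Set (Fin k → ℝ)}
    (hA : ∀ θ ∈ A, θ ∈ stdSimplex ℝ (Fin k) ∧ hellinger (histDensity ⟨k, θ⟩) p ≤ r) :
    dirichlet a A ≤
      ENNReal.ofReal ((64 * C / c) ^ ((C₁ + 1) * k) * (64 * √C / c * (√k * r)) ^ (k - 1)) := by
  have hk' : (0 : ℝ) < k := by exact_mod_cast hk
  have hks := Real.sqrt_pos.2 hk'
  have := isProbabilityMeasure_dirichlet ha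
  have hc1 : c ≤ 1 := by
    have := integral_mono (integrable_const c) hp.integrable fun x => (hpb x).1
    simpa [hp.integral_eq_one] using this
  have hC1 : 1 ≤ C := by
    have := integral_mono hp.integrable (integrable_const C) fun x => (hpb x).2
    simpa [hp.integral_eq_one] using this
  have h := dirichlet_le_of_hellinger_diam_le hp hc hpb hk ha haC hkr (d := 2 * r)
    (ρ := c / 8 / k) (by positivity) (by positivity) le_rfl hA
    (fun θ hθ θ' hθ' => by
      have h1 := hellinger_triangle (rootL2_histDensity θ) hp.rootL2 (rootL2_histDensity θ')
      rw [hellinger_comm p] at h1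
      linarith [(hA θ hθ).2, (hA θ' hθ').2])
    (m := fun _ => (k : ℝ)⁻¹) (by simp [hk'.ne']) fun j => by
      rw [inv_eq_one_div]
      constructor <;> gcongr <;> linarith
  refine h.trans ((mul_le_mul_right prob_le_one _).trans (le_of_eq ?_))
  rw [mul_one]
  congr 3
  have e : (k : ℝ) = √k * √k := (Real.mul_self_sqrt hk'.le).symm
  have e2 : 4 * √C * (2 * r) / (√k * (c / 8 / k)) = 64 * √C / c * (k / √k * r) := by
    field_simp; norm_num
  rw [e2]
  congr 2
  rw [div_eq_iff hks.ne']; exact e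

/-- The likelihood on `A` is bounded by its maximum. On the Euclidean ball of radius `1/√n` around
the maximiser `m` it loses at most `exp(8k/c)`, because the χ²-distance there is at most
`(1/n)/(c/(8k))`. The prior masses of `A` and this ball are then compared by dilation. -/
lemma setLIntegral_likelihood_le_of_hellinger_diam_le {p : I → ℝ} (hp : IsDensity p) {c C : ℝ}
    (hc : 0 < c) (hpb : ∀ x, c ≤ p x ∧ p x ≤ C) {n k : ℕ} (hn : 0 < n) (hk : 0 < k)
    {a : Fin k → ℝ} {C₁ : ℝ} (ha : ∀ j, 0 < a j) (haC : ∀ j, a j ≤ C₁) {r d : ℝ}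
    (hkr : k * r ^ 2 < c / 4) (hd : 0 < d) (hkn : k ≤ c / 8 * √n) {A : Set (Fin k → ℝ)}
    (hAm : MeasurableSet A)
    (hA : ∀ θ ∈ A, θ ∈ stdSimplex ℝ (Fin k) ∧ hellinger (histDensity ⟨k, θ⟩) p ≤ r)
    (hAd : ∀ θ ∈ A, ∀ θ' ∈ A, hellinger (histDensity ⟨k, θ⟩) (histDensity ⟨k, θ'⟩) ≤ d)
    {y : Fin n → I} {m : Fin k → ℝ} (hm : m ∈ stdSimplex ℝ (Fin k))
    (hmr : hellinger (histDensity ⟨k, m⟩) p ≤ r)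
    (hmax : ∀ θ ∈ stdSimplex ℝ (Fin k),
      jointDensity (histDensity ⟨k, θ⟩) y ≤ jointDensity (histDensity ⟨k, m⟩) y)
    (hmle : ∀ θ ∈ stdSimplex ℝ (Fin k), (∀ j, 0 < θ j) → jointDensity (histDensity ⟨k, m⟩) y ≤
        Real.exp (n * ∑ j, (m j - θ j) ^ 2 / θ j) * jointDensity (histDensity ⟨k, θ⟩) y) :
    ∫⁻ θ in A, likelihood y ⟨k, θ⟩ ∂(dirichlet a) ≤
      ENNReal.ofReal ((64 * C / c) ^ ((C₁ + 1) * k) * (4 * √C * d * √n / √k) ^ (k - 1) *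
        Real.exp (8 / c * k)) * ∫⁻ θ, likelihood y ⟨k, θ⟩ ∂(dirichlet a) := by
  have hk' : (0 : ℝ) < k := by exact_mod_cast hk
  have hn' : (0 : ℝ) < n := by exact_mod_cast hn
  have hks := Real.sqrt_pos.2 hk'
  have hns := Real.sqrt_pos.2 hn'
  have hC : 0 < C := hc.trans_le ((hpb 0).1.trans (hpb 0).2)
  have hmb := bounds_of_hellinger_le hp hc hpb hmr hkr
  set ρ : ℝ := 1 / √n with hρ
  have hρ0 : 0 < ρ := by positivity
  have hρk : ρ ≤ c / 8 / k := by
    rw [hρ, div_le_div_iff₀ hns hk']; linarith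
  set B := {θ : Fin k → ℝ | ∑ j, θ j = 1 ∧ ∑ j, (θ j - m j) ^ 2 ≤ ρ ^ 2} with hB
  have hBm : MeasurableSet B :=
    (measurableSet_eq_fun (f := fun θ : Fin k → ℝ => ∑ j, θ j) (by fun_prop)
      measurable_const).inter
      (measurableSet_le (f := fun θ : Fin k → ℝ => ∑ j, (θ j - m j) ^ 2) (by fun_prop)
        measurable_const)
  have h := dirichlet_le_of_hellinger_diam_le hp hc hpb hk ha haC hkr hd hρ0 hρk hA hAd hm.2 hmb
  set Jm := jointDensity (histDensity ⟨k, m⟩) y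
  have h1 : ∫⁻ θ in A, likelihood y ⟨k, θ⟩ ∂(dirichlet a) ≤ ENNReal.ofReal Jm * dirichlet a A := by
    rw [← setLIntegral_const]
    refine setLIntegral_mono' hAm fun θ hθ => ?_
    rw [likelihood_eq y (hA θ hθ).1.1]
    exact ENNReal.ofReal_le_ofReal (hmax θ (hA θ hθ).1)
  have h2 : ENNReal.ofReal Jm * dirichlet a B ≤ ENNReal.ofReal (Real.exp (8 / c * k)) *
      ∫⁻ θ, likelihood y ⟨k, θ⟩ ∂(dirichlet a) := by
    rw [← setLIntegral_const, ← lintegral_const_mul _ (measurable_likelihood y k)]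
    refine le_trans (setLIntegral_mono' hBm fun θ hθ => ?_) (setLIntegral_le_lintegral _ _)
    have hlow (j) : c / 8 / k ≤ θ j := by
      have h3 : (θ j - m j) ^ 2 ≤ ρ ^ 2 :=
        (Finset.single_le_sum (f := fun j => (θ j - m j) ^ 2)
          (fun i _ => sq_nonneg _) (Finset.mem_univ j)).trans hθ.2
      have h4 := (abs_le_of_sq_le_sq' h3 hρ0.le).1
      have h5 := (hmb j).1
      have e : c / 4 / k = c / 8 / k + c / 8 / k := by ring
      linarith
    have hu : 0 < c / 8 / k := by positivity
    have hpos (j) : 0 < θ j := hu.trans_le (hlow j)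
    have hθs : θ ∈ stdSimplex ℝ (Fin k) := ⟨fun j => (hpos j).le, hθ.1⟩
    rw [likelihood_eq y hθs.1, ← ENNReal.ofReal_mul (Real.exp_pos _).le]
    refine ENNReal.ofReal_le_ofReal ((hmle θ hθs hpos).trans ?_)
    refine mul_le_mul_of_nonneg_right (Real.exp_le_exp.2 ?_)
      (jointDensity_nonneg (histDensity_nonneg hθs.1) y)
    have h6 : ∑ j, (m j - θ j) ^ 2 / θ j ≤ (1 / n) / (c / 8 / k) := by
      calc ∑ j, (m j - θ j) ^ 2 / θ j ≤ ∑ j, (θ j - m j) ^ 2 / (c / 8 / k) := by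
            refine Finset.sum_le_sum fun j _ => ?_
            rw [show (m j - θ j) ^ 2 = (θ j - m j) ^ 2 by ring]
            gcongr
            exact hlow j
        _ = (∑ j, (θ j - m j) ^ 2) / (c / 8 / k) := (Finset.sum_div _ _ _).symm
        _ ≤ (1 / n) / (c / 8 / k) := by
            gcongr
            refine hθ.2.trans (le_of_eq ?_)
            rw [hρ, div_pow, Real.sq_sqrt hn'.le, one_pow]
    calc (n : ℝ) * ∑ j, (m j - θ j) ^ 2 / θ j ≤ n * ((1 / n) / (c / 8 / k)) := by gcongr
      _ = 8 / c * k := by field_simp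
  have e : 4 * √C * d / (√k * ρ) = 4 * √C * d * √n / √k := by rw [hρ]; field_simp
  rw [e] at h
  calc ∫⁻ θ in A, likelihood y ⟨k, θ⟩ ∂(dirichlet a)
      ≤ ENNReal.ofReal Jm * dirichlet a A := h1
    _ ≤ ENNReal.ofReal Jm * (ENNReal.ofReal ((64 * C / c) ^ ((C₁ + 1) * k) *
          (4 * √C * d * √n / √k) ^ (k - 1)) * dirichlet a B) := mul_le_mul_right h _
    _ = ENNReal.ofReal ((64 * C / c) ^ ((C₁ + 1) * k) * (4 * √C * d * √n / √k) ^ (k - 1)) *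
          (ENNReal.ofReal Jm * dirichlet a B) := by ring
    _ ≤ ENNReal.ofReal ((64 * C / c) ^ ((C₁ + 1) * k) * (4 * √C * d * √n / √k) ^ (k - 1)) *
          (ENNReal.ofReal (Real.exp (8 / c * k)) *
            ∫⁻ θ, likelihood y ⟨k, θ⟩ ∂(dirichlet a)) := mul_le_mul_right h2 _
    _ = _ := by rw [← mul_assoc, ← ENNReal.ofReal_mul' (Real.exp_pos _).le]

/-! ### The posterior -/

/-- The parameters of the histograms with `k` bins. -/
abbrev histMk (k : ℕ) (θ : Fin k → ℝ) : HistParam := ⟨k, θ⟩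

lemma measurable_histMk (k : ℕ) : Measurable (histMk k) :=
  fun _ hs => MeasurableSpace.measurableSet_iInf.1 hs k

lemma measurable_histParam {β : Type*} [MeasurableSpace β] {f : HistParam → β}
    (h : ∀ k, Measurable fun θ : Fin k → ℝ => f ⟨k, θ⟩) : Measurable f :=
  fun _ hs => MeasurableSpace.measurableSet_iInf.2 fun k => h k hs

lemma measurable_likelihood_histParam {n : ℕ} (y : Fin n → I) : Measurable (likelihood y) :=
  measurable_histParam fun k => measurable_likelihood y k

/-- This puts the empirical Bayes posterior into the hierarchical form, with a prior on the number
of bins that is a point mass at the data-dependent value. -/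
lemma binPrior_eq_hierPrior (a : (k : ℕ) → Fin k → ℝ) (k : ℕ) :
    binPrior a k = hierPrior (Measure.dirac k) a := by
  ext s hs
  rw [hierPrior, Measure.sum_apply _ hs, tsum_eq_single k]
  · simp
  · intro k' hk'
    simp [hk'.symm]

lemma setLIntegral_hierPrior (ν : Measure ℕ) (a : (k : ℕ) → Fin k → ℝ) {n : ℕ}
    (y : Fin n → I) {s : Set HistParam} (hs : MeasurableSet s) :
    ∫⁻ θ in s, likelihood y θ ∂(hierPrior ν a) =
      ∑' k, ν {k} * ∫⁻ θ in histMk k ⁻¹' s, likelihood y ⟨k, θ⟩ ∂(dirichlet (a k)) := by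
  rw [hierPrior, Measure.restrict_sum _ hs, lintegral_sum_measure]
  refine tsum_congr fun k => ?_
  rw [Measure.restrict_smul, lintegral_smul_measure, smul_eq_mul,
    show binPrior a k = (dirichlet (a k)).map (histMk k) from rfl,
    Measure.restrict_map (measurable_histMk k) hs,
    lintegral_map (measurable_likelihood_histParam y) (measurable_histMk k)]

lemma marginal_hierPrior (ν : Measure ℕ) (a : (k : ℕ) → Fin k → ℝ) {n : ℕ} (y : Fin n → I) :
    marginal (hierPrior ν a) y =
      ∑' k, ν {k} * ∫⁻ θ, likelihood y ⟨k, θ⟩ ∂(dirichlet (a k)) := by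
  rw [marginal, ← setLIntegral_univ, setLIntegral_hierPrior ν a y MeasurableSet.univ]
  simp

lemma marginal_binPrior (a : (k : ℕ) → Fin k → ℝ) (k : ℕ) {n : ℕ} (y : Fin n → I) :
    marginal (binPrior a k) y = ∫⁻ θ, likelihood y ⟨k, θ⟩ ∂(dirichlet (a k)) := by
  rw [marginal, show binPrior a k = (dirichlet (a k)).map (histMk k) from rfl,
    lintegral_map (measurable_likelihood_histParam y) (measurable_histMk k)]

lemma histPosterior_hierPrior_apply (ν : Measure ℕ) (a : (k : ℕ) → Fin k → ℝ) {n : ℕ}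
    (y : Fin n → I) {s : Set HistParam} (hs : MeasurableSet s) :
    histPosterior (hierPrior ν a) y s = (marginal (hierPrior ν a) y)⁻¹ *
      ∑' k, ν {k} * ∫⁻ θ in histMk k ⁻¹' s, likelihood y ⟨k, θ⟩ ∂(dirichlet (a k)) := by
  rw [histPosterior, Measure.smul_apply, smul_eq_mul, withDensity_apply _ hs,
    setLIntegral_hierPrior ν a y hs]

lemma histPosterior_univ {π : Measure HistParam} {n : ℕ} {y : Fin n → I}
    (h0 : marginal π y ≠ 0) (ht : marginal π y ≠ ⊤) : histPosterior π y univ = 1 := by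
  rw [histPosterior, Measure.smul_apply, smul_eq_mul, withDensity_apply _ MeasurableSet.univ,
    setLIntegral_univ]
  exact ENNReal.inv_mul_cancel h0 ht

/-- The radius of the Hellinger ball on which the posterior concentrates. -/
def postRadius (D : ℝ) (M K n : ℕ) : ℝ := √(D * ((M + 1) * (K * Real.log n)) / n)

/-- The set of histograms on which the posterior concentrates. -/
def concentrationSet (κ : ℕ) (p : I → ℝ) (D : ℝ) (M K n : ℕ) : Set HistParam :=
  {θ | κ ≤ θ.1 ∧ θ.1 ≤ M * K ∧ θ.2 ∈ stdSimplex ℝ (Fin θ.1) ∧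
    hellinger (histDensity θ) p ≤ postRadius D M K n}

lemma measurableSet_concentrationSet (κ : ℕ) {p : I → ℝ} (hp : Measurable p) (D : ℝ)
    (M K n : ℕ) : MeasurableSet (concentrationSet κ p D M K n) := by
  refine MeasurableSpace.measurableSet_iInf.2 fun k => ?_
  exact ((MeasurableSet.const (κ ≤ k)).inter ((MeasurableSet.const (k ≤ M * K)).inter
    ((isClosed_stdSimplex ℝ (Fin k)).measurableSet.inter
      (measurableSet_le (measurable_hellinger_hist hp k) measurable_const))))

/-- The properties of a sample on which the posterior is well behaved. -/
structure RegularSample (κ : ℕ) (a : (k : ℕ) → Fin k → ℝ) (ν : Measure ℕ) (p : I → ℝ)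
    (D E η : ℝ) (M K : ℕ) {n : ℕ} (y : Fin n → I) : Prop where
  lt_one : ∀ i, (y i : ℝ) < 1
  likelihood_le : ∀ k, κ ≤ k → k ≤ M * K → ∀ θ ∈ stdSimplex ℝ (Fin k),
    √(D * (k * Real.log n + K * Real.log n) / n) ≤ hellinger (histDensity ⟨k, θ⟩) p →
      jointDensity (histDensity ⟨k, θ⟩) y ≤
        Real.exp (-(D / 8 * (K * Real.log n))) * jointDensity p y
  le_marginal : ENNReal.ofReal (Real.exp (-(E * (K * Real.log n))) * jointDensity p y) ≤
    marginal (hierPrior ν a) y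
  marginal_ne_top : marginal (hierPrior ν a) y ≠ ⊤
  tail : ∑' k, (if k ≤ M * K then 0 else
      ν {k} * ∫⁻ θ, likelihood y ⟨k, θ⟩ ∂(dirichlet (a k))) ≤
    ENNReal.ofReal η * marginal (hierPrior ν a) y

namespace RegularSample

variable {κ : ℕ} {a : (k : ℕ) → Fin k → ℝ} {ν : Measure ℕ} {p : I → ℝ} {D E η : ℝ} {M K n : ℕ}
  {y : Fin n → I}

lemma marginal_ne_zero (h : RegularSample κ a ν p D E η M K y) (hp : ∀ x, 0 < p x) :
    marginal (hierPrior ν a) y ≠ 0 := by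
  have h1 : 0 < ENNReal.ofReal (Real.exp (-(E * (K * Real.log n))) * jointDensity p y) :=
    ENNReal.ofReal_pos.2 (mul_pos (Real.exp_pos _) (jointDensity_pos hp y))
  exact (h1.trans_le h.le_marginal).ne'

lemma likelihood_le_marginal (h : RegularSample κ a ν p D E η M K y) :
    ENNReal.ofReal (Real.exp (-(D / 8 * (K * Real.log n))) * jointDensity p y) ≤
      ENNReal.ofReal (Real.exp (-((D / 8 - E) * (K * Real.log n)))) *
        marginal (hierPrior ν a) y := by
  refine le_trans (le_of_eq ?_) (mul_le_mul_right h.le_marginal _)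
  rw [← ENNReal.ofReal_mul (Real.exp_pos _).le, ← mul_assoc (Real.exp _) (Real.exp _),
    ← Real.exp_add]
  congr 3
  ring

lemma sqrt_le_postRadius (hD : 0 ≤ D) {k : ℕ} (hn : 1 ≤ n) (hk : k ≤ M * K) :
    √(D * (k * Real.log n + K * Real.log n) / n) ≤ postRadius D M K n := by
  refine Real.sqrt_le_sqrt ?_
  have hl : 0 ≤ Real.log n := Real.log_nonneg (by exact_mod_cast hn)
  have hk' : (k : ℝ) ≤ M * K := by exact_mod_cast hk
  gcongr
  nlinarith [mul_le_mul_of_nonneg_right hk' hl]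

/-- If every contribution to the posterior mass of a set is bounded by a fraction of the marginal
likelihood, then so is the posterior mass. -/
lemma histPosterior_le_of_forall [IsProbabilityMeasure ν]
    (h : RegularSample κ a ν p D E η M K y) (hp : ∀ x, 0 < p x) {s : Set HistParam}
    (hs : MeasurableSet s) {ζ : ℝ} (hζ : 0 ≤ ζ) (g : ℕ → ℝ≥0∞)
    (hg : ∑' k, g k ≤ ENNReal.ofReal ζ * marginal (hierPrior ν a) y)
    (hsk : ∀ k, ν {k} * ∫⁻ θ in histMk k ⁻¹' s, likelihood y ⟨k, θ⟩ ∂(dirichlet (a k)) ≤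
      ν {k} * ENNReal.ofReal (Real.exp (-(D / 8 * (K * Real.log n))) * jointDensity p y) + g k) :
    histPosterior (hierPrior ν a) y s ≤
      ENNReal.ofReal (ζ + Real.exp (-((D / 8 - E) * (K * Real.log n)))) := by
  rw [histPosterior_hierPrior_apply ν a y hs]
  have hsum : ∑' k, ν {k} = 1 := by
    rw [← measure_univ (μ := ν), ← Measure.tsum_indicator_apply_singleton ν univ MeasurableSet.univ]
    simp
  have h1 : ∑' k, ν {k} * ∫⁻ θ in histMk k ⁻¹' s, likelihood y ⟨k, θ⟩ ∂(dirichlet (a k)) ≤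
      ENNReal.ofReal (ζ + Real.exp (-((D / 8 - E) * (K * Real.log n)))) *
        marginal (hierPrior ν a) y := by
    refine (ENNReal.tsum_le_tsum hsk).trans ?_
    rw [ENNReal.tsum_add, ENNReal.tsum_mul_right, hsum, one_mul,
      ENNReal.ofReal_add hζ (Real.exp_pos _).le, add_mul, add_comm]
    exact add_le_add hg h.likelihood_le_marginal
  calc _ ≤ (marginal (hierPrior ν a) y)⁻¹ *
        (ENNReal.ofReal (ζ + Real.exp (-((D / 8 - E) * (K * Real.log n)))) *
        marginal (hierPrior ν a) y) := mul_le_mul_right h1 _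
    _ = _ := by
      rw [mul_left_comm, ENNReal.inv_mul_cancel (h.marginal_ne_zero hp) h.marginal_ne_top, mul_one]

/-- Posterior contraction. -/
lemma histPosterior_compl_le [IsProbabilityMeasure ν]
    (h : RegularSample κ a ν p D E η M K y) (hκ : 1 ≤ κ) (hn : 1 ≤ n) (hD : 0 ≤ D) (hη : 0 ≤ η)
    (hν : ∀ k < κ, ν {k} = 0) (ha : ∀ k, κ ≤ k → ∀ j, 0 < a k j) (hpm : Measurable p)
    (hp : ∀ x, 0 < p x) :
    histPosterior (hierPrior ν a) y (concentrationSet κ p D M K n)ᶜ ≤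
      ENNReal.ofReal (η + Real.exp (-((D / 8 - E) * (K * Real.log n)))) := by
  have hm := (measurableSet_concentrationSet κ hpm D M K n).compl
  refine h.histPosterior_le_of_forall hp hm hη _ h.tail fun k => ?_
  rcases lt_or_ge k κ with hk | hk
  · simp [hν k hk]
  split_ifs with hkM
  swap
  · refine le_trans ?_ le_add_self
    exact mul_le_mul_right (setLIntegral_le_lintegral _ _) _
  rw [add_zero]
  gcongr
  have := isProbabilityMeasure_dirichlet (ha k hk)
  set x := ENNReal.ofReal (Real.exp (-(D / 8 * (K * Real.log n))) * jointDensity p y)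
  have hae : ∀ᵐ θ ∂(dirichlet (a k)).restrict
      (histMk k ⁻¹' (concentrationSet κ p D M K n)ᶜ), likelihood y ⟨k, θ⟩ ≤ x := by
    rw [ae_restrict_iff' (measurable_histMk k hm)]
    filter_upwards [ae_dirichlet_mem_stdSimplex (by omega) (ha k hk)] with θ hθ hθc
    have hR : postRadius D M K n < hellinger (histDensity ⟨k, θ⟩) p := by
      by_contra hle
      exact hθc ⟨hk, hkM, hθ, not_lt.1 hle⟩
    rw [likelihood_eq y hθ.1]
    exact ENNReal.ofReal_le_ofReal
      (h.likelihood_le k hk hkM θ hθ ((sqrt_le_postRadius hD hn hkM).trans hR.le))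
  refine (lintegral_mono_ae hae).trans ?_
  rw [lintegral_const, Measure.restrict_apply_univ]
  exact mul_le_of_le_one_right' prob_le_one

/-- The posterior mass of a set of small Hellinger diameter. -/
lemma histPosterior_le_of_diam [IsProbabilityMeasure ν]
    (h : RegularSample κ a ν p D E η M K y) (hκ : 1 ≤ κ) (hn : 1 ≤ n) (hD : 0 ≤ D)
    (hν : ∀ k < κ, ν {k} = 0) {C₁ : ℝ} (ha : ∀ k, κ ≤ k → ∀ j, 0 < a k j ∧ a k j ≤ C₁)
    (hpd : IsDensity p) {c C : ℝ} (hc : 0 < c) (hpb : ∀ x, c ≤ p x ∧ p x ≤ C)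
    (hR : (M * K : ℕ) * postRadius D M K n ^ 2 < c / 4) (hMn : (M * K : ℕ) ≤ c / 8 * √n)
    {s : Set HistParam} (hs : MeasurableSet s) (hsc : s ⊆ concentrationSet κ p D M K n) {d ζ : ℝ}
    (hd : 0 < d) (hζ : 0 ≤ ζ)
    (hsd : ∀ θ ∈ s, ∀ θ' ∈ s, hellinger (histDensity θ) (histDensity θ') ≤ d)
    (hsζ : ∀ θ ∈ s, (64 * C / c) ^ ((C₁ + 1) * θ.1) * (4 * √C * d * √n / √θ.1) ^ (θ.1 - 1) *
        Real.exp (8 / c * θ.1) ≤ ζ) :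
    histPosterior (hierPrior ν a) y s ≤
      ENNReal.ofReal (ζ + Real.exp (-((D / 8 - E) * (K * Real.log n)))) := by
  have hp : ∀ x, 0 < p x := fun x => hc.trans_le (hpb x).1
  refine h.histPosterior_le_of_forall hp hs hζ
    (fun k => ENNReal.ofReal ζ * (ν {k} * ∫⁻ θ, likelihood y ⟨k, θ⟩ ∂(dirichlet (a k)))) ?_ ?_
  · rw [ENNReal.tsum_mul_left, ← marginal_hierPrior]
  intro k
  rcases lt_or_ge k κ with hk | hk
  · simp [hν k hk]
  rcases (histMk k ⁻¹' s : Set (Fin k → ℝ)).eq_empty_or_nonempty with he | ⟨θ₀, hθ₀⟩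
  · simp [he]
  have hkM : k ≤ M * K := (hsc hθ₀).2.1
  have hkM' : (k : ℝ) ≤ (M * K : ℕ) := by exact_mod_cast hkM
  have := isProbabilityMeasure_dirichlet fun j => (ha k hk j).1
  have hsm := measurable_histMk k hs
  obtain ⟨m, hm, hmax, hmle⟩ := exists_mle (by omega : 0 < n) (by omega : 0 < k) h.lt_one
  set x := ENNReal.ofReal (Real.exp (-(D / 8 * (K * Real.log n))) * jointDensity p y) with hx
  -- If the maximum likelihood histogram lies outside the contraction radius, the maximal likelihood
  -- is itself negligible and so is the whole model. Otherwise the small-ball estimate around it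
  -- applies.
  rcases le_or_gt (hellinger (histDensity ⟨k, m⟩) p) (postRadius D M K n) with hmR | hmR
  · refine le_trans ?_ le_add_self
    rw [mul_left_comm]
    gcongr
    refine (setLIntegral_likelihood_le_of_hellinger_diam_le hpd hc hpb (by omega) (by omega)
      (fun j => (ha k hk j).1) (fun j => (ha k hk j).2) (r := postRadius D M K n) (d := d) ?_ hd
      (hkM'.trans hMn) hsm (fun θ hθ => (hsc hθ).2.2) (fun θ hθ θ' hθ' => hsd _ hθ _ hθ')
      hm hmR hmax hmle).trans ?_
    · exact (mul_le_mul_of_nonneg_right hkM' (sq_nonneg _)).trans_lt hR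
    · exact mul_le_mul_left (ENNReal.ofReal_le_ofReal (hsζ _ hθ₀)) _
  · refine le_trans ?_ le_self_add
    gcongr
    have hmx := h.likelihood_le k hk hkM m hm ((sqrt_le_postRadius hD hn hkM).trans hmR.le)
    calc ∫⁻ θ in histMk k ⁻¹' s, likelihood y ⟨k, θ⟩ ∂(dirichlet (a k))
        ≤ ∫⁻ _ in histMk k ⁻¹' s, x ∂(dirichlet (a k)) := by
          refine setLIntegral_mono' hsm fun θ hθ => ?_
          rw [likelihood_eq y (hsc hθ).2.2.1.1]
          exact ENNReal.ofReal_le_ofReal ((hmax θ (hsc hθ).2.2.1).trans hmx)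
      _ ≤ x := by
          rw [setLIntegral_const]
          exact mul_le_of_le_one_right' prob_le_one

end RegularSample

/-! ### Probabilities of the regularity events -/

lemma one_le_log {n : ℕ} (hn : 3 ≤ n) : 1 ≤ Real.log n := by
  have hn' : (3 : ℝ) ≤ n := by exact_mod_cast hn
  rw [Real.le_log_iff_exp_le (by linarith)]
  linarith [Real.exp_one_lt_d9]

lemma exp_neg_two_mul_log {n : ℕ} (hn : 0 < n) : Real.exp (-(2 * Real.log n)) = 1 / n ^ 2 := by
  have hn' : (0 : ℝ) < n := by exact_mod_cast hn
  rw [Real.exp_neg, two_mul, Real.exp_add, Real.exp_log hn', one_div, sq]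

/-- In the squared radius `D (k + K) log n / n`, the part with `k` outweighs the at most `n^(3k)`
grid points. Since `D / 16 ≥ 4`, each `k` fails with probability at most `2/n²`, and the union is
over `k ≤ n`. -/
lemma measure_exists_likelihood_gt_le_two_div {p : I → ℝ} (hp : IsDensity p) (hp0 : ∀ x, 0 < p x)
    {n : ℕ} (hn : 3 ≤ n) {D : ℝ} (hD : 64 ≤ D) {K : ℕ} (hK : 1 ≤ K) :
    sampleLaw p n {y | ¬ ∀ k, 1 ≤ k → k ≤ n → ∀ θ ∈ stdSimplex ℝ (Fin k),
      √(D * (k * Real.log n + K * Real.log n) / n) ≤ hellinger (histDensity ⟨k, θ⟩) p →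
        jointDensity (histDensity ⟨k, θ⟩) y ≤
          Real.exp (-(D / 8 * (k * Real.log n + K * Real.log n))) * jointDensity p y} ≤
      ENNReal.ofReal (2 / n) := by
  have hn' : (3 : ℝ) ≤ n := by exact_mod_cast hn
  have hn0 : (0 : ℝ) < n := by linarith
  have hl := one_le_log hn
  have hK' : (1 : ℝ) ≤ K := by exact_mod_cast hK
  let r (k : ℕ) : ℝ := √(D * (k * Real.log n + K * Real.log n) / n)
  have hr (k : ℕ) : n * r k ^ 2 = D * (k * Real.log n + K * Real.log n) := by
    simp only [r]
    rw [Real.sq_sqrt (by positivity)]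
    field_simp
  let bad (k : ℕ) : Set (Fin n → I) := {y | ∃ θ ∈ stdSimplex ℝ (Fin k),
    r k ≤ hellinger (histDensity ⟨k, θ⟩) p ∧
      Real.exp (-(n * r k ^ 2 / 8)) * jointDensity p y < jointDensity (histDensity ⟨k, θ⟩) y}
  have hsub : {y : Fin n → I | ¬ ∀ k, 1 ≤ k → k ≤ n → ∀ θ ∈ stdSimplex ℝ (Fin k),
      √(D * (k * Real.log n + K * Real.log n) / n) ≤ hellinger (histDensity ⟨k, θ⟩) p →
        jointDensity (histDensity ⟨k, θ⟩) y ≤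
          Real.exp (-(D / 8 * (k * Real.log n + K * Real.log n))) * jointDensity p y} ⊆
      ⋃ k ∈ Finset.Icc 1 n, bad k := by
    intro y hy
    change ¬ _ at hy
    push Not at hy
    obtain ⟨k, hk1, hkn, θ, hθ, hrθ, hlt⟩ := hy
    refine mem_biUnion (show k ∈ Finset.Icc 1 n from Finset.mem_Icc.2 ⟨hk1, hkn⟩)
      ⟨θ, hθ, hrθ, ?_⟩
    rw [hr, mul_div_right_comm]
    exact hlt
  refine (measure_mono hsub).trans ((measure_biUnion_finset_le _ _).trans ?_)
  have hbad : ∀ k ∈ Finset.Icc 1 n, sampleLaw p n (bad k) ≤ ENNReal.ofReal (2 / n ^ 2) := by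
    intro k hk
    obtain ⟨hk1, hkn⟩ := Finset.mem_Icc.1 hk
    have hk1' : (1 : ℝ) ≤ k := by exact_mod_cast hk1
    have hkn' : (k : ℝ) ≤ n := by exact_mod_cast hkn
    refine (measure_exists_likelihood_gt_le hp hp0 (by omega) (by omega) (Real.sqrt_nonneg _)
      ?_).trans (ENNReal.ofReal_le_ofReal ?_)
    · change 4 ≤ n * r k ^ 2
      rw [hr]
      have hkl : 1 ≤ k * Real.log n := by nlinarith
      have hKl : 1 ≤ K * Real.log n := by nlinarith
      nlinarith
    · change _ * Real.exp (1 / 2 - n * r k ^ 2 / 16) ≤ _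
      rw [hr]
      have h1 : ((n * k + 1 : ℕ) : ℝ) ^ k ≤ Real.exp (3 * (k * Real.log n)) := by
        have h2 : ((n * k + 1 : ℕ) : ℝ) ≤ Real.exp (3 * Real.log n) := by
          have : Real.exp (3 * Real.log n) = (n : ℝ) ^ 3 := by
            rw [show (3 : ℝ) * Real.log n = ((3 : ℕ) : ℝ) * Real.log n by norm_num,
              Real.exp_nat_mul, Real.exp_log hn0]
          rw [this]
          push_cast
          nlinarith [mul_le_mul_of_nonneg_left hkn' hn0.le, mul_pos hn0 hn0]
        calc ((n * k + 1 : ℕ) : ℝ) ^ k ≤ Real.exp (3 * Real.log n) ^ k := by gcongr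
          _ = _ := by rw [← Real.exp_nat_mul]; congr 1; ring
      calc ((n * k + 1 : ℕ) : ℝ) ^ k *
            Real.exp (1 / 2 - D * (k * Real.log n + K * Real.log n) / 16)
          ≤ Real.exp (3 * (k * Real.log n)) *
            Real.exp (1 / 2 - D * (k * Real.log n + K * Real.log n) / 16) := by gcongr
        _ ≤ Real.exp (1 / 2 + -(2 * Real.log n)) := by
            rw [← Real.exp_add, Real.exp_le_exp]
            have hkl : Real.log n ≤ k * Real.log n := by nlinarith
            have hKl : Real.log n ≤ K * Real.log n := by nlinarith
            nlinarith
        _ ≤ 2 / n ^ 2 := by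
            rw [Real.exp_add, exp_neg_two_mul_log (by omega), mul_one_div]
            gcongr
            have h3 : Real.exp (1 / 2) ^ 2 = Real.exp 1 := by
              rw [← Real.exp_nat_mul]; norm_num
            nlinarith [Real.exp_one_lt_d9, Real.exp_pos (1 / 2)]
  refine (Finset.sum_le_card_nsmul _ _ _ hbad).trans (le_of_eq ?_)
  rw [Nat.card_Icc, nsmul_eq_mul, Nat.add_sub_cancel, ← ENNReal.ofReal_natCast,
    ← ENNReal.ofReal_mul hn0.le]
  congr 1
  field_simp

/-- The evidence for the oracle model: prior mass near the bin probabilities of `p`, combined with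
the χ²-bound for the corresponding histogram, whose bias is at most `K log n / n` by definition of
`K`. -/
lemma exists_le_lintegral_likelihood {c₀ C₀ : ℝ} (hc₀ : 0 < c₀) {κ : ℕ} (hκ : 1 ≤ κ)
    {a : (k : ℕ) → Fin k → ℝ} {s c₁ C₁ : ℝ} (hs : 0 ≤ s) (hc₁ : 0 < c₁)
    (ha : ∀ k, κ ≤ k → ∀ j : Fin k, c₁ * (k : ℝ) ^ (-s) ≤ a k j ∧ a k j ≤ C₁) :
    ∃ E : ℝ, 0 < E ∧ ∀ n, 3 ≤ n → ∀ p, IsDensity p → (∀ x, c₀ ≤ p x ∧ p x ≤ C₀) →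
      oracleBins κ p n ≤ n →
      sampleLaw p n {y | ¬ ENNReal.ofReal
          (Real.exp (-(E * (oracleBins κ p n * Real.log n))) * jointDensity p y) ≤
        ∫⁻ θ, likelihood y ⟨oracleBins κ p n, θ⟩ ∂(dirichlet (a (oracleBins κ p n)))} ≤
      ENNReal.ofReal (1 / n) := by
  obtain ⟨E, hE, hdir⟩ := exists_dirichlet_lower hc₀ hc₁ hs (C := C₀) (C₁ := C₁)
  set G := max (4 * C₀ / c₀) 0
  have hG : 0 ≤ G := le_max_right _ _
  -- `E` pays for the prior mass and `G` for the bias; one further unit covers the factor `exp(-1)`,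
  -- and the other the slack in Markov's inequality that gives probability `1/n`.
  refine ⟨E + G + 2, by positivity, fun n hn p hp hpb hKn => ?_⟩
  have hn' : (3 : ℝ) ≤ n := by exact_mod_cast hn
  have hn0 : (0 : ℝ) < n := by linarith
  have hl := one_le_log hn
  have hor := oracleBins_mem hκ hp (n := n) (by omega)
  set K := oracleBins κ p n
  have hK1 : 1 ≤ K := hκ.trans hor.1
  have hK1' : (1 : ℝ) ≤ K := by exact_mod_cast hK1
  set T : ℝ := K * Real.log n
  have hTl : Real.log n ≤ T := by simp only [T]; nlinarith
  have hT1 : 1 ≤ T := hl.trans hTl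
  have hbm := binMass_mem_stdSimplex hp (k := K) (by omega)
  have hp0 : ∀ x, 0 < p x := fun x => hc₀.trans_le (hpb x).1
  have hC₀ : 0 ≤ C₀ := (hp0 0).le.trans (hpb 0).2
  have hdir' := hdir K n (by omega) (by omega) hKn (a K) (ha K hor.1) _ hbm.2
    fun j => binMass_bounds hp hpb j
  have hi : Integrable fun x => (p x - histDensity ⟨K, binMass p K⟩ x) ^ 2 :=
    integrable_sq_sub_of_bounded hp.1 (measurable_histDensity _)
      (fun x => by rw [abs_of_nonneg (hp.2.1 x)]; exact (hpb x).2) (abs_histDensity_le _)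
  have hmeas := measure_likelihood_lt_le hp (isDensity_histDensity hbm) hc₀ hp0
    (fun x hx => by
      obtain ⟨j, hj⟩ := exists_mem_bin (by omega : 0 < K) hx
      rw [histDensity_of_mem _ hj]
      exact (binMass_bounds hp hpb j).1) hi
    (integral_sq_sub_binMass_le hp (fun x => (hpb x).2) (by omega)) n ((G + 1) * T)
  refine (measure_mono fun y hy => ?_).trans (hmeas.trans (ENNReal.ofReal_le_ofReal ?_))
  · by_contra hge
    refine hy ?_
    have hge' : Real.exp (-((G + 1) * T)) * jointDensity p y ≤
      jointDensity (histDensity ⟨K, binMass p K⟩) y := not_lt.1 hge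
    refine le_trans (ENNReal.ofReal_le_ofReal ?_)
      (le_lintegral_likelihood_dirichlet (by omega) hbm.1 hdir' (Real.exp_pos _).le y)
    calc Real.exp (-((E + G + 2) * T)) * jointDensity p y
        ≤ Real.exp (-(E * T)) * Real.exp (-1) * (Real.exp (-((G + 1) * T)) * jointDensity p y) := by
          rw [← mul_assoc (Real.exp (-(E * T)) * Real.exp (-1)) _ (jointDensity p y),
            ← Real.exp_add, ← Real.exp_add]
          have := (jointDensity_pos hp0 y).le
          gcongr
          nlinarith
      _ ≤ _ := by gcongr
  · have h1 : n * (4 * C₀ * bias p K) / c₀ ≤ G * T := by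
      have h2 : n * bias p K ≤ T := by
        have := hor.2
        rw [le_div_iff₀ hn0] at this
        linarith
      calc n * (4 * C₀ * bias p K) / c₀ = 4 * C₀ / c₀ * (n * bias p K) := by ring
        _ ≤ G * T := by
          gcongr
          · exact mul_nonneg hn0.le (bias_nonneg _ _)
          · exact le_max_left _ _
    calc Real.exp (n * (4 * C₀ * bias p K) / c₀ - (G + 1) * T) ≤ Real.exp (-Real.log n) := by
          rw [Real.exp_le_exp]; linarith
      _ = 1 / n := by rw [Real.exp_neg, Real.exp_log hn0, one_div]

lemma eventually_mul_log_le_rpow (A : ℝ) {δ : ℝ} (hδ : 0 < δ) :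
    ∀ᶠ n : ℕ in atTop, A * Real.log n ≤ (n : ℝ) ^ δ := by
  have h := (isLittleO_log_rpow_atTop hδ).comp_tendsto tendsto_natCast_atTop_atTop
  have h2 := h.bound (show 0 < (|A| + 1)⁻¹ by positivity)
  filter_upwards [h2, eventually_ge_atTop 3] with n hn hn3
  have hl := one_le_log hn3
  have hpow : 0 ≤ (n : ℝ) ^ δ := by positivity
  simp only [Function.comp_apply] at hn
  rw [Real.norm_of_nonneg (by linarith), Real.norm_of_nonneg hpow, ← div_eq_inv_mul,
    le_div_iff₀ (by positivity)] at hn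
  calc A * Real.log n ≤ (|A| + 1) * Real.log n := by
        gcongr
        linarith [le_abs_self A]
    _ ≤ _ := by linarith

lemma eventually_mul_oracleBins_le {κ : ℕ} (hκ : 1 ≤ κ) {β₀ L₀ c₀ : ℝ} (C₀ : ℝ) (hβ₀ : 0 < β₀)
    (hL₀ : 0 < L₀) (hc₀ : 0 < c₀) {H : ℝ} (hH : 1 / (1 + 2 * β₀) < H) (A : ℝ) :
    ∀ᶠ n : ℕ in atTop, ∀ p ∈ holderDensities β₀ L₀ c₀ C₀,
      A * (oracleBins κ p n * Real.log n) ≤ (n : ℝ) ^ H := by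
  obtain ⟨B, hB, hor⟩ := exists_oracleBins_le hκ C₀ hL₀ hc₀
  filter_upwards [eventually_mul_log_le_rpow (|A| * B) (sub_pos.2 hH), eventually_ge_atTop 3]
    with n hn hn3 p hp
  have hn' : (3 : ℝ) ≤ n := by exact_mod_cast hn3
  have hl := one_le_log hn3
  have hK := hor n hn3 β₀ hβ₀ p hp
  have h1 : ((n : ℝ) / Real.log n) ^ (1 / (1 + 2 * β₀)) ≤ (n : ℝ) ^ (1 / (1 + 2 * β₀)) := by
    have : (n : ℝ) / Real.log n ≤ n := div_le_self (by linarith) hl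
    gcongr
  have h2 : (oracleBins κ p n : ℝ) ≤ B * (n : ℝ) ^ (1 / (1 + 2 * β₀)) :=
    hK.trans (by gcongr)
  calc A * (oracleBins κ p n * Real.log n) ≤ |A| * (oracleBins κ p n * Real.log n) := by
        gcongr
        exact le_abs_self A
    _ ≤ |A| * (B * (n : ℝ) ^ (1 / (1 + 2 * β₀)) * Real.log n) := by gcongr
    _ = |A| * B * Real.log n * (n : ℝ) ^ (1 / (1 + 2 * β₀)) := by ring
    _ ≤ (n : ℝ) ^ (H - 1 / (1 + 2 * β₀)) * (n : ℝ) ^ (1 / (1 + 2 * β₀)) := by gcongr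
    _ = (n : ℝ) ^ H := by rw [← Real.rpow_add (by linarith)]; congr 1; ring

lemma rpow_eq_exp_mul_log {n : ℕ} (hn : 0 < n) (x : ℝ) :
    (n : ℝ) ^ x = Real.exp (x * Real.log n) := by
  rw [Real.rpow_def_of_pos (by exact_mod_cast hn), mul_comm]

/-- Overfitting models are penalised by the prior: for `k ≤ n^H` with `H < 1/2` the quantity `√k r`
is polynomially small, so the ball of radius `r` has prior mass `n^(-2γk)`, and Markov's inequality
spends half of the exponent. -/
lemma measure_exists_setLIntegral_gt_le {p : I → ℝ} (hp : IsDensity p) {c C : ℝ} (hc : 0 < c)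
    (hpb : ∀ x, c ≤ p x ∧ p x ≤ C) {a : (k : ℕ) → Fin k → ℝ} {C₁ : ℝ} {n : ℕ} (hn : 3 ≤ n)
    {D γ H : ℝ} (hD : 0 < D) {K M : ℕ} (hK : 1 ≤ K) (hM : 1 ≤ M) (hγ : 0 < γ)
    (ha : ∀ k, K ≤ k → ∀ j, 0 < a k j ∧ a k j ≤ C₁)
    (hγH : γ = (1 - 2 * H) / 16) (hγM : 2 ≤ γ * M) (hH : H ≤ 1)
    (h1 : (64 * C / c) ^ (C₁ + 1) ≤ (n : ℝ) ^ γ)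
    (h2 : 64 * √C / c * √(2 * D * Real.log n) ≤ (n : ℝ) ^ (2 * γ))
    (h3 : 2 * D * Real.log n < c / 4 * (n : ℝ) ^ (16 * γ)) :
    sampleLaw p n {y | ¬ ∀ k, M * K < k → (k : ℝ) ≤ (n : ℝ) ^ H →
      ∫⁻ θ in {θ | θ ∈ stdSimplex ℝ (Fin k) ∧ hellinger (histDensity ⟨k, θ⟩) p ≤
        √(D * (k * Real.log n + K * Real.log n) / n)}, likelihood y ⟨k, θ⟩ ∂(dirichlet (a k)) ≤
      ENNReal.ofReal (Real.exp (-(γ * (k * Real.log n))) * jointDensity p y)} ≤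
      ENNReal.ofReal (1 / n) := by
  have hn' : (3 : ℝ) ≤ n := by exact_mod_cast hn
  have hn0 : (0 : ℝ) < n := by linarith
  have hl := one_le_log hn
  have hp0 : ∀ x, 0 < p x := fun x => hc.trans_le (hpb x).1
  have hC : 0 < C := (hp0 0).trans_le (hpb 0).2
  let A (k : ℕ) : Set (Fin k → ℝ) := {θ | θ ∈ stdSimplex ℝ (Fin k) ∧
    hellinger (histDensity ⟨k, θ⟩) p ≤ √(D * (k * Real.log n + K * Real.log n) / n)}
  let bad (k : ℕ) : Set (Fin n → I) := {y |
    ENNReal.ofReal (Real.exp (-(γ * (k * Real.log n))) * jointDensity p y) <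
      ∫⁻ θ in A k, likelihood y ⟨k, θ⟩ ∂(dirichlet (a k))}
  let S : Finset ℕ := (Finset.Icc 1 n).filter fun k => M * K < k ∧ (k : ℝ) ≤ (n : ℝ) ^ H
  have hsub : {y : Fin n → I | ¬ ∀ k, M * K < k → (k : ℝ) ≤ (n : ℝ) ^ H →
      ∫⁻ θ in A k, likelihood y ⟨k, θ⟩ ∂(dirichlet (a k)) ≤
      ENNReal.ofReal (Real.exp (-(γ * (k * Real.log n))) * jointDensity p y)} ⊆
      ⋃ k ∈ S, bad k := by
    intro y hy
    change ¬ _ at hy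
    push Not at hy
    obtain ⟨k, hk1, hkn, hlt⟩ := hy
    have hkn2 : (k : ℝ) ≤ n := by
      calc (k : ℝ) ≤ (n : ℝ) ^ H := hkn
        _ ≤ (n : ℝ) ^ (1 : ℝ) := Real.rpow_le_rpow_of_exponent_le (by linarith) hH
        _ = n := Real.rpow_one _
    refine mem_biUnion (show k ∈ S from Finset.mem_filter.2
      ⟨Finset.mem_Icc.2 ⟨by omega, by exact_mod_cast hkn2⟩, hk1, hkn⟩) hlt
  refine (measure_mono hsub).trans ((measure_biUnion_finset_le _ _).trans ?_)
  have hbad : ∀ k ∈ S, sampleLaw p n (bad k) ≤ ENNReal.ofReal (1 / n ^ 2) := by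
    intro k hk
    obtain ⟨hk0, hk1, hkH⟩ := Finset.mem_filter.1 hk
    have hMK : K ≤ M * K := Nat.le_mul_of_pos_left _ hM
    have hMM : M ≤ M * K := Nat.le_mul_of_pos_right _ hK
    have hk2 : 2 ≤ k := by omega
    have hak := ha k (by omega)
    have hk2' : (2 : ℝ) ≤ k := by exact_mod_cast hk2
    have hKk : (K : ℝ) ≤ k := by exact_mod_cast (by omega : K ≤ k)
    have hMk : (M : ℝ) ≤ k := by exact_mod_cast (by omega : M ≤ k)
    have hK' : (1 : ℝ) ≤ K := by exact_mod_cast hK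
    have := isProbabilityMeasure_dirichlet fun j => (hak j).1
    set r := √(D * (k * Real.log n + K * Real.log n) / n) with hr
    have hr0 : 0 < r := by rw [hr]; positivity
    -- From `K ≤ k` and `k ≤ n^H`, `k r² ≤ 2 D log n · n^(2H - 1)`, and `2H - 1 = -16γ`.
    have hkr : k * r ^ 2 ≤ 2 * D * Real.log n * (n : ℝ) ^ (-(16 * γ)) := by
      have e : (n : ℝ) ^ (-(16 * γ)) = ((n : ℝ) ^ H) ^ 2 / n := by
        rw [← Real.rpow_natCast, ← Real.rpow_mul hn0.le, hγH,
          show -(16 * ((1 - 2 * H) / 16)) = H * ((2 : ℕ) : ℝ) - 1 by push_cast; ring,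
          Real.rpow_sub_one hn0.ne']
      rw [hr, Real.sq_sqrt (by positivity), e]
      calc (k : ℝ) * (D * (k * Real.log n + K * Real.log n) / n)
          ≤ k * (D * (k * Real.log n + k * Real.log n) / n) := by gcongr
        _ = 2 * D * Real.log n * ((k : ℝ) ^ 2 / n) := by ring
        _ ≤ _ := by gcongr
    have hpos16 : 0 < (n : ℝ) ^ (16 * γ) := by positivity
    have hkr4 : k * r ^ 2 < c / 4 := by
      refine hkr.trans_lt ?_
      rw [Real.rpow_neg hn0.le, ← div_eq_mul_inv, div_lt_iff₀ hpos16]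
      exact h3
    have hdir := dirichlet_hellinger_ball_le hp hc hpb (by omega : 0 < k) (fun j => (hak j).1)
      (fun j => (hak j).2) hr0 hkr4 (A := A k) fun θ hθ => hθ
    have hbase : 64 * √C / c * (√k * r) ≤ (n : ℝ) ^ (-(6 * γ)) := by
      have e1 : √k * r ≤ √(2 * D * Real.log n) * (n : ℝ) ^ (-(8 * γ)) := by
        have e2 : (n : ℝ) ^ (-(16 * γ)) = ((n : ℝ) ^ (-(8 * γ))) ^ 2 := by
          rw [← Real.rpow_natCast, ← Real.rpow_mul hn0.le]
          congr 1; push_cast; ring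
        rw [e2] at hkr
        refine abs_le_of_sq_le_sq' ?_ (by positivity) |>.2
        rw [mul_pow, mul_pow, Real.sq_sqrt (Nat.cast_nonneg k),
          Real.sq_sqrt (show 0 ≤ 2 * D * Real.log n by positivity)]
        exact hkr
      calc 64 * √C / c * (√k * r) ≤
            64 * √C / c * (√(2 * D * Real.log n) * (n : ℝ) ^ (-(8 * γ))) := by gcongr
        _ = (64 * √C / c * √(2 * D * Real.log n)) * (n : ℝ) ^ (-(8 * γ)) := by ring
        _ ≤ (n : ℝ) ^ (2 * γ) * (n : ℝ) ^ (-(8 * γ)) := by gcongr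
        _ = (n : ℝ) ^ (-(6 * γ)) := by rw [← Real.rpow_add hn0]; congr 1; ring
    have hbound : (64 * C / c) ^ ((C₁ + 1) * k) * (64 * √C / c * (√k * r)) ^ (k - 1) ≤
        Real.exp (-(2 * γ * (k * Real.log n))) := by
      have hks : ((k - 1 : ℕ) : ℝ) = k - 1 := by
        rw [Nat.cast_sub (by omega)]; norm_num
      calc (64 * C / c) ^ ((C₁ + 1) * k) * (64 * √C / c * (√k * r)) ^ (k - 1)
          ≤ ((n : ℝ) ^ γ) ^ k * ((n : ℝ) ^ (-(6 * γ))) ^ (k - 1) := by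
            rw [Real.rpow_mul (by positivity), Real.rpow_natCast]
            gcongr
        _ = Real.exp (k * (γ * Real.log n) + (k - 1) * (-(6 * γ) * Real.log n)) := by
            rw [rpow_eq_exp_mul_log (by omega), rpow_eq_exp_mul_log (by omega), ← Real.exp_nat_mul,
              ← Real.exp_nat_mul, ← Real.exp_add, hks]
        -- The exponent is `k - 6(k - 1) ≤ -2k`, which holds from `k = 2` on.
        _ ≤ _ := by
            rw [Real.exp_le_exp]
            have : 0 ≤ γ * Real.log n := by positivity
            nlinarith
    refine (measure_setLIntegral_likelihood_gt_le hp hp0 (dirichlet (a k))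
      (ae_dirichlet_mem_stdSimplex (by omega) fun j => (hak j).1) (A k)
      (Real.exp_pos (-(γ * (k * Real.log n))))).trans ?_
    refine (ENNReal.div_le_div_right (hdir.trans (ENNReal.ofReal_le_ofReal hbound)) _).trans ?_
    rw [← ENNReal.ofReal_div_of_pos (Real.exp_pos _), ← Real.exp_sub,
      ← exp_neg_two_mul_log (by omega)]
    refine ENNReal.ofReal_le_ofReal (Real.exp_le_exp.2 ?_)
    -- Markov's inequality leaves `n^(-γk)`, and `γ M ≤ γ k` with `γ M ≥ 2` makes this at most
    -- `n^(-2)`, enough for a union over at most `n` values of `k`.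
    have h4 : 2 ≤ γ * k := hγM.trans (by gcongr)
    nlinarith
  refine (Finset.sum_le_card_nsmul _ _ _ hbad).trans ?_
  have hcard : (S.card : ℝ) ≤ n := by
    have := (Finset.card_filter_le (Finset.Icc 1 n)
      fun k => M * K < k ∧ (k : ℝ) ≤ (n : ℝ) ^ H)
    rw [Nat.card_Icc, Nat.add_sub_cancel] at this
    exact_mod_cast this
  rw [nsmul_eq_mul, ← ENNReal.ofReal_natCast, ← ENNReal.ofReal_mul (Nat.cast_nonneg _)]
  refine ENNReal.ofReal_le_ofReal ?_
  calc (S.card : ℝ) * (1 / (n : ℝ) ^ 2) ≤ n * (1 / (n : ℝ) ^ 2) := by gcongr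
    _ = 1 / (n : ℝ) := by field_simp

/-- The likelihood bounds that hold with high probability, whatever the weights of the numbers
of bins. -/
structure SampleBounds (a : (k : ℕ) → Fin k → ℝ) (p : I → ℝ) (D E γ H : ℝ) (M K : ℕ) {n : ℕ}
    (y : Fin n → I) : Prop where
  lt_one : ∀ i, (y i : ℝ) < 1
  likelihood_le : ∀ k, 1 ≤ k → k ≤ n → ∀ θ ∈ stdSimplex ℝ (Fin k),
    √(D * (k * Real.log n + K * Real.log n) / n) ≤ hellinger (histDensity ⟨k, θ⟩) p →
      jointDensity (histDensity ⟨k, θ⟩) y ≤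
        Real.exp (-(D / 8 * (k * Real.log n + K * Real.log n))) * jointDensity p y
  le_marginal : ENNReal.ofReal (Real.exp (-(E * (K * Real.log n))) * jointDensity p y) ≤
    ∫⁻ θ, likelihood y ⟨K, θ⟩ ∂(dirichlet (a K))
  marginal_le : ∀ k, M * K < k → (k : ℝ) ≤ (n : ℝ) ^ H →
    ∫⁻ θ, likelihood y ⟨k, θ⟩ ∂(dirichlet (a k)) ≤
      ENNReal.ofReal (2 * Real.exp (-(γ * (k * Real.log n))) * jointDensity p y)

lemma lintegral_likelihood_le {p : I → ℝ} (hp : IsDensity p) (hp0 : ∀ x, 0 < p x) {n k : ℕ}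
    (hk : 0 < k) {a : Fin k → ℝ} (ha : ∀ j, 0 < a j) {r x₁ x₂ : ℝ} (hx₁ : 0 ≤ x₁)
    {y : Fin n → I}
    (h1 : ∫⁻ θ in {θ | θ ∈ stdSimplex ℝ (Fin k) ∧ hellinger (histDensity ⟨k, θ⟩) p ≤ r},
      likelihood y ⟨k, θ⟩ ∂(dirichlet a) ≤ ENNReal.ofReal (x₁ * jointDensity p y))
    (h2 : ∀ θ ∈ stdSimplex ℝ (Fin k), r ≤ hellinger (histDensity ⟨k, θ⟩) p →
      jointDensity (histDensity ⟨k, θ⟩) y ≤ x₂ * jointDensity p y) (hx : x₂ ≤ x₁) :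
    ∫⁻ θ, likelihood y ⟨k, θ⟩ ∂(dirichlet a) ≤
      ENNReal.ofReal (2 * x₁ * jointDensity p y) := by
  have := isProbabilityMeasure_dirichlet ha
  have hJ := (jointDensity_pos hp0 y).le
  set A := {θ | θ ∈ stdSimplex ℝ (Fin k) ∧ hellinger (histDensity ⟨k, θ⟩) p ≤ r} with hA
  have hAm : MeasurableSet A := (isClosed_stdSimplex ℝ (Fin k)).measurableSet.inter
    (measurableSet_le (measurable_hellinger_hist hp.1 k) measurable_const)
  rw [← lintegral_add_compl _ hAm, show 2 * x₁ * jointDensity p y =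
    x₁ * jointDensity p y + x₁ * jointDensity p y by ring,
    ENNReal.ofReal_add (by positivity) (by positivity)]
  refine add_le_add h1 ?_
  have hae : ∀ᵐ θ ∂(dirichlet a).restrict Aᶜ, likelihood y ⟨k, θ⟩ ≤
      ENNReal.ofReal (x₁ * jointDensity p y) := by
    rw [ae_restrict_iff' hAm.compl]
    filter_upwards [ae_dirichlet_mem_stdSimplex hk ha] with θ hθ hθA
    rw [likelihood_eq y hθ.1]
    refine ENNReal.ofReal_le_ofReal ((h2 θ hθ ?_).trans (by gcongr))
    by_contra hlt
    exact hθA ⟨hθ, (not_le.1 hlt).le⟩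
  refine (lintegral_mono_ae hae).trans ?_
  rw [lintegral_const, Measure.restrict_apply_univ]
  exact mul_le_of_le_one_right' prob_le_one

/-- The order of quantifiers matters: `E` is fixed before `H`, `D` and `M`, so that `D` can later be
taken large compared with `E`. The failure probabilities `0`, `2/n`, `1/n` and `1/n` add up to
`4/n`. -/
lemma exists_eventually_sampleBounds {β₀ L₀ c₀ : ℝ} (C₀ : ℝ) (hβ₀ : 0 < β₀) (hL₀ : 0 < L₀)
    (hc₀ : 0 < c₀) {κ : ℕ} (hκ : 1 ≤ κ) {a : (k : ℕ) → Fin k → ℝ} {s c₁ C₁ : ℝ} (hs : 0 ≤ s)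
    (hc₁ : 0 < c₁)
    (ha : ∀ k, κ ≤ k → ∀ j : Fin k, c₁ * (k : ℝ) ^ (-s) ≤ a k j ∧ a k j ≤ C₁) :
    ∃ E : ℝ, 0 < E ∧ ∀ H : ℝ, 1 / (1 + 2 * β₀) < H → H < 1 / 2 → ∀ D : ℝ, 64 ≤ D → ∀ M : ℕ,
      2 ≤ (1 - 2 * H) / 16 * M → ∀ᶠ n : ℕ in atTop, ∀ p ∈ holderDensities β₀ L₀ c₀ C₀,
        sampleLaw p n {y | ¬ SampleBounds a p D E ((1 - 2 * H) / 16) H M (oracleBins κ p n) y} ≤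
          ENNReal.ofReal (4 / n) := by
  obtain ⟨E, hE, hlow⟩ := exists_le_lintegral_likelihood hc₀ hκ hs hc₁ ha (C₀ := C₀)
  refine ⟨E, hE, fun H hH hH2 D hD M hM => ?_⟩
  have hH0 : 0 < H := lt_trans (by positivity) hH
  set γ : ℝ := (1 - 2 * H) / 16 with hγ
  have hγ0 : 0 < γ := by rw [hγ]; linarith
  have hM1 : 1 ≤ M := by
    by_contra h
    have : M = 0 := by omega
    rw [this] at hM
    norm_num at hM
  filter_upwards [eventually_ge_atTop 3, eventually_mul_log_le_rpow ((64 * C₀ / c₀) ^ (C₁ + 1)) hγ0,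
    eventually_mul_log_le_rpow (64 * √C₀ / c₀ * (2 * D)) (show 0 < 2 * γ by positivity),
    eventually_mul_log_le_rpow (8 * D / c₀ + 1) (show 0 < 16 * γ by positivity),
    eventually_mul_oracleBins_le hκ C₀ hβ₀ hL₀ hc₀ hH 1] with n hn hn1 hn2 hn3 hn4 p hp
  have hKH := hn4 p hp
  obtain ⟨hd, hpb, -⟩ := hp
  have hl := one_le_log hn
  have hn' : (3 : ℝ) ≤ n := by exact_mod_cast hn
  have hn0 : (0 : ℝ) < n := by linarith
  have hp0 : ∀ x, 0 < p x := fun x => hc₀.trans_le (hpb x).1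
  have hC₀ : 0 < C₀ := (hp0 0).trans_le (hpb 0).2
  have hor := oracleBins_mem hκ hd (n := n) (by omega)
  set K := oracleBins κ p n
  have hK1 : 1 ≤ K := hκ.trans hor.1
  have hHn : (n : ℝ) ^ H ≤ n := by
    calc (n : ℝ) ^ H ≤ (n : ℝ) ^ (1 : ℝ) :=
          Real.rpow_le_rpow_of_exponent_le (by linarith) (by linarith)
      _ = n := Real.rpow_one _
  have hKn : K ≤ n := by
    have h1 : (K : ℝ) ≤ n := by
      have : (0 : ℝ) ≤ K := Nat.cast_nonneg _
      nlinarith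
    exact_mod_cast h1
  have hak (k : ℕ) (hk : K ≤ k) (j : Fin k) : 0 < a k j ∧ a k j ≤ C₁ := by
    have h0 : (0 : ℝ) < k := by exact_mod_cast j.pos
    have h := ha k (hor.1.trans hk) j
    exact ⟨lt_of_lt_of_le (by positivity) h.1, h.2⟩
  have hbig : (64 * C₀ / c₀) ^ (C₁ + 1) ≤ (n : ℝ) ^ γ := by
    have : 0 ≤ (64 * C₀ / c₀) ^ (C₁ + 1) := by positivity
    nlinarith
  have hev1 := measure_exists_likelihood_gt_le_two_div hd hp0 hn hD hK1
  have hev2 := hlow n hn p hd hpb hKn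
  have hev3 := measure_exists_setLIntegral_gt_le hd hc₀ hpb hn (D := D) (H := H) (by linarith) hK1
    hM1 hγ0 hak hγ hM (by linarith) hbig (by
      refine le_trans ?_ hn2
      have h5 : √(2 * D * Real.log n) ≤ 2 * D * Real.log n := by
        rw [Real.sqrt_le_left (by positivity)]
        nlinarith [mul_le_mul hD hl zero_le_one (by linarith)]
      calc 64 * √C₀ / c₀ * √(2 * D * Real.log n) ≤ 64 * √C₀ / c₀ * (2 * D * Real.log n) := by
            gcongr
        _ = _ := by ring) (by
      have h6 : c₀ / 4 * ((8 * D / c₀ + 1) * Real.log n) ≤ c₀ / 4 * (n : ℝ) ^ (16 * γ) := by gcongr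
      refine lt_of_lt_of_le ?_ h6
      have h7 : c₀ / 4 * ((8 * D / c₀ + 1) * Real.log n) =
        2 * D * Real.log n + c₀ / 4 * Real.log n := by field_simp; ring
      rw [h7]
      have : 0 < c₀ / 4 * Real.log n := by positivity
      linarith)
  have hev0 : sampleLaw p n {y | ¬ ∀ i, (y i : ℝ) < 1} = 0 := ae_sampleLaw_lt_one hd n
  refine (measure_mono (t := {y | ¬ ∀ i, (y i : ℝ) < 1} ∪ (_ ∪ (_ ∪ _))) fun y hy => ?_).trans
    ((measure_union_le _ _).trans (add_le_add hev0.le ((measure_union_le _ _).trans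
      (add_le_add hev1 ((measure_union_le _ _).trans (add_le_add hev2 hev3))))))|>.trans ?_
  · by_contra hcon
    simp only [mem_union, not_or] at hcon
    obtain ⟨q0, q1, q2, q3⟩ := hcon
    have q0' := not_not.1 q0
    have q1' := not_not.1 q1
    have q2' := not_not.1 q2
    have q3' := not_not.1 q3
    refine hy ⟨q0', q1', q2', fun k hk1 hk2 => ?_⟩
    have hMK : K ≤ M * K := Nat.le_mul_of_pos_left _ hM1
    have hkn : k ≤ n := by exact_mod_cast hk2.trans hHn
    refine lintegral_likelihood_le hd hp0 (by omega) (fun j => (hak k (by omega) j).1)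
      (Real.exp_pos _).le (q3' k hk1 hk2) (q1' k (by omega) hkn) (Real.exp_le_exp.2 ?_)
    have h8 : γ ≤ D / 8 := by rw [hγ]; linarith
    have h9 : 0 ≤ (k : ℝ) * Real.log n := by positivity
    have h10 : 0 ≤ (K : ℝ) * Real.log n := by positivity
    nlinarith
  · rw [zero_add, ← ENNReal.ofReal_add (by positivity) (by positivity),
      ← ENNReal.ofReal_add (by positivity) (by positivity)]
    refine ENNReal.ofReal_le_ofReal (le_of_eq ?_)
    ring

/-! ### The prior on the number of bins -/

/-- The properties of the geometric and Poisson priors that matter: exponentially small tails,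
and not too small masses. -/
structure BinPriorBounds (κ : ℕ) (ν : Measure ℕ) (ρ B G : ℝ) : Prop where
  isProbabilityMeasure : IsProbabilityMeasure ν
  eq_zero : ∀ k < κ, ν {k} = 0
  pos : 0 < ρ
  lt_one : ρ < 1
  one_le : 1 ≤ B
  nonneg : 0 ≤ G
  le : ∀ k, ν {k} ≤ ENNReal.ofReal (B * ρ ^ (4 * k))
  ge : ∀ n, 3 ≤ n → ∀ k, 1 ≤ k → κ ≤ k → k ≤ n →
    ENNReal.ofReal (Real.exp (-(G * (k * Real.log n)))) ≤ ν {k}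

/-- The lower bound `(g/k)^k` is weak enough to hold for both geometric and Poisson weights, yet
costs only `exp(-O(k log n))`. Conditioning changes constants only. -/
lemma exists_binPriorBounds_cond {μ : Measure ℕ} [IsProbabilityMeasure μ] {w : ℕ → ℝ}
    (hμ : ∀ k, μ {k} = ENNReal.ofReal (w k)) (hw : ∀ k, 0 < w k) {ρ B g : ℝ} (hρ : 0 < ρ)
    (hρ1 : ρ < 1) (hB : ∀ k, w k ≤ B * ρ ^ (4 * k)) (hg : 0 < g)
    (hgw : ∀ k : ℕ, 1 ≤ k → (g / k) ^ k ≤ w k) (κ : ℕ) :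
    ∃ B G : ℝ, BinPriorBounds κ (cond μ (Ici κ)) ρ B G := by
  have hm : MeasurableSet (Ici κ) := .of_discrete
  have hne : μ (Ici κ) ≠ 0 := by
    have h1 : 0 < μ {κ} := by rw [hμ]; exact ENNReal.ofReal_pos.2 (hw κ)
    exact (h1.trans_le (measure_mono (by simp))).ne'
  have hnt : μ (Ici κ) ≠ ⊤ := measure_ne_top _ _
  set c := (μ (Ici κ)).toReal
  have hc : 0 < c := ENNReal.toReal_pos hne hnt
  have hμc : μ (Ici κ) = ENNReal.ofReal c := (ENNReal.ofReal_toReal hnt).symm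
  refine ⟨max (c⁻¹ * B) 1, |Real.log g| + 1, cond_isProbabilityMeasure hne, fun k hk => ?_, hρ, hρ1,
    le_max_right _ _, by positivity, fun k => ?_, fun n hn k hk1 hk hkn => ?_⟩
  · rw [cond_apply hm, show Ici κ ∩ {k} = ∅ by ext; simp; omega, measure_empty, mul_zero]
  · rw [cond_apply hm, hμc, ← ENNReal.ofReal_inv_of_pos hc]
    calc ENNReal.ofReal c⁻¹ * μ (Ici κ ∩ {k}) ≤ ENNReal.ofReal c⁻¹ * μ {k} :=
          mul_le_mul_right (measure_mono inter_subset_right) _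
      _ = ENNReal.ofReal (c⁻¹ * w k) := by rw [hμ, ENNReal.ofReal_mul (by positivity)]
      _ ≤ _ := by
        refine ENNReal.ofReal_le_ofReal ?_
        calc c⁻¹ * w k ≤ c⁻¹ * (B * ρ ^ (4 * k)) := by gcongr; exact hB k
          _ = c⁻¹ * B * ρ ^ (4 * k) := by ring
          _ ≤ _ := by gcongr; exact le_max_left _ _
  · rw [cond_apply hm, show Ici κ ∩ {k} = {k} from inter_eq_right.2 (by simpa using hk), hμ]
    have h1 : (1 : ℝ≥0∞) ≤ (μ (Ici κ))⁻¹ := ENNReal.one_le_inv.2 prob_le_one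
    refine le_trans (ENNReal.ofReal_le_ofReal ?_) (le_mul_of_one_le_left' h1)
    refine le_trans ?_ (hgw k hk1)
    have hk0 : (0 : ℝ) < k := by exact_mod_cast hk1
    have hl := one_le_log hn
    have hkl : Real.log k ≤ Real.log n := Real.log_le_log hk0 (by exact_mod_cast hkn)
    rw [← Real.exp_log (show 0 < g / k by positivity), ← Real.exp_nat_mul, Real.exp_le_exp,
      Real.log_div hg.ne' hk0.ne']
    have h2 : -((|Real.log g| + 1) * Real.log n) ≤ Real.log g - Real.log k := by
      have := neg_abs_le (Real.log g)
      nlinarith [abs_nonneg (Real.log g)]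
    calc -((|Real.log g| + 1) * (k * Real.log n)) = k * -((|Real.log g| + 1) * Real.log n) := by ring
      _ ≤ _ := by gcongr

lemma IsBinNumberPrior.exists_bounds {κ : ℕ} {ν : Measure ℕ} (h : IsBinNumberPrior κ ν) :
    ∃ ρ B G : ℝ, BinPriorBounds κ ν ρ B G := by
  rcases h with ⟨q, hq0, hq1, rfl⟩ | ⟨r, hr, rfl⟩
  · have h0 : (0 : ℝ) < q := unitInterval.pos_iff_ne_zero.2 hq0
    have h1 : (q : ℝ) < 1 := unitInterval.lt_one_iff_ne_one.2 hq1
    -- Bernoulli's inequality gives `1 - q ≤ (1 - q/4)^4`, which provides the four factors of `ρ`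
    -- per bin.
    refine ⟨1 - q / 4, exists_binPriorBounds_cond (w := fun k => (1 - q : ℝ) ^ k * q) (B := 1)
      (g := (1 - q) * q)
      (geometricMeasure_singleton hq0) (geometricMeasure_pos hq0 hq1) (by linarith) (by linarith)
      (fun k => ?_) (by nlinarith) (fun k hk => ?_) κ⟩
    · have h2 : (1 - q : ℝ) ≤ (1 - q / 4) ^ 4 := by
        have := one_add_mul_le_pow (show (-2 : ℝ) ≤ -(q / 4) by linarith) 4
        push_cast at this
        calc (1 - q : ℝ) = 1 + 4 * -(q / 4) := by ring
          _ ≤ _ := this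
          _ = _ := by ring
      have h3 : (0 : ℝ) ≤ 1 - q := by linarith
      rw [one_mul, pow_mul]
      calc (1 - q : ℝ) ^ k * q ≤ (1 - q : ℝ) ^ k * 1 := by gcongr
        _ ≤ _ := by rw [mul_one]; gcongr
    · have h3 : (0 : ℝ) ≤ 1 - q := by linarith
      have hk' : (1 : ℝ) ≤ k := by exact_mod_cast hk
      calc ((1 - q : ℝ) * q / k) ^ k ≤ ((1 - q : ℝ) * q) ^ k := by
            gcongr
            exact div_le_self (by positivity) hk'
        _ = (1 - q : ℝ) ^ k * (q : ℝ) ^ k := mul_pow _ _ _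
        _ ≤ _ := by
            gcongr
            exact pow_le_of_le_one h0.le h1.le (by omega)
  · have hr' : (0 : ℝ) < r := hr
    -- Since `(1/2)^4 = 1/16`, the bound `r^k / k! ≤ exp(16 r) (1/2)^(4k)` is one term of the
    -- exponential series at `16 r`.
    refine ⟨1 / 2, exists_binPriorBounds_cond (B := Real.exp (16 * r)) (g := Real.exp (-r) * r)
      (poissonMeasure_singleton r) (fun k => by positivity) (by norm_num) (by norm_num)
      (fun k => ?_) (by positivity) (fun k hk => ?_) κ⟩
    · have h1 := Real.pow_div_factorial_le_exp (16 * r : ℝ) (by positivity) k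
      have h2 : Real.exp (-r) ≤ 1 := Real.exp_le_one_iff.2 (by linarith)
      calc Real.exp (-r) * (r : ℝ) ^ k / k.factorial ≤ 1 * (r : ℝ) ^ k / k.factorial := by gcongr
        _ = (16 * r : ℝ) ^ k / k.factorial * (1 / 2) ^ (4 * k) := by
            rw [pow_mul, mul_pow, show ((1 : ℝ) / 2) ^ 4 = 1 / 16 by norm_num, one_div, inv_pow]
            field_simp
        _ ≤ _ := by gcongr
    · have hk' : (1 : ℝ) ≤ k := by exact_mod_cast hk
      have hf : (k.factorial : ℝ) ≤ (k : ℝ) ^ k := by exact_mod_cast Nat.factorial_le_pow k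
      have he : Real.exp (-r) ^ k ≤ Real.exp (-r) :=
        pow_le_of_le_one (Real.exp_pos _).le (Real.exp_le_one_iff.2 (by linarith)) (by omega)
      rw [div_pow, mul_pow]
      gcongr

/-! ### Regular samples -/

lemma lintegral_likelihood_ne_top {n k : ℕ} (hk : 0 < k) {a : Fin k → ℝ} (ha : ∀ j, 0 < a j)
    (y : Fin n → I) : ∫⁻ θ, likelihood y ⟨k, θ⟩ ∂(dirichlet a) ≠ ⊤ := by
  have := isProbabilityMeasure_dirichlet ha
  have hae : ∀ᵐ θ ∂(dirichlet a), likelihood y ⟨k, θ⟩ ≤ ENNReal.ofReal k ^ n := by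
    filter_upwards [ae_dirichlet_mem_stdSimplex hk ha] with θ hθ
    calc likelihood y ⟨k, θ⟩ ≤ ∏ _i : Fin n, ENNReal.ofReal k := by
          refine Finset.prod_le_prod' fun i _ => ENNReal.ofReal_le_ofReal ?_
          have h0 : ∑ j : Fin k, (if (j : ℝ) / k ≤ y i ∧ (y i : ℝ) < ((j : ℝ) + 1) / k
              then θ j else 0) ≤ ∑ j, θ j := by
            refine Finset.sum_le_sum fun j _ => ?_
            split_ifs
            exacts [le_rfl, hθ.1 j]
          rw [hθ.2] at h0
          exact mul_le_of_le_one_right (Nat.cast_nonneg k) h0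
      _ = _ := by simp
  refine ((lintegral_mono_ae hae).trans_lt ?_).ne
  rw [lintegral_const, measure_univ, mul_one]
  exact ENNReal.pow_lt_top ENNReal.ofReal_lt_top

namespace SampleBounds

variable {κ : ℕ} {a : (k : ℕ) → Fin k → ℝ} {p : I → ℝ} {D E γ H : ℝ} {M K n : ℕ} {y : Fin n → I}

lemma likelihood_le_of_le (h : SampleBounds a p D E γ H M K y) (hκ : 1 ≤ κ) (hn : 3 ≤ n)
    (hD : 0 ≤ D) (hMK : M * K ≤ n) (hp0 : ∀ x, 0 < p x) (k : ℕ) (hk : κ ≤ k) (hkM : k ≤ M * K) :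
    ∀ θ ∈ stdSimplex ℝ (Fin k),
    √(D * (k * Real.log n + K * Real.log n) / n) ≤ hellinger (histDensity ⟨k, θ⟩) p →
      jointDensity (histDensity ⟨k, θ⟩) y ≤
        Real.exp (-(D / 8 * (K * Real.log n))) * jointDensity p y := by
  intro θ hθ hr
  refine (h.likelihood_le k (by omega) (by omega) θ hθ hr).trans ?_
  have := (jointDensity_pos hp0 y).le
  have hl := one_le_log hn
  have : 0 ≤ k * Real.log n := by positivity
  gcongr
  linarith

/-- A maximiser `k > M K` would need a marginal likelihood of at least `exp(-E K log n)`, the lower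
bound for the oracle model, whereas overfitting models have at most `2 exp(-γ k log n)`; as `γ M ≥ E
+ 2`, this is impossible. The tail sum over `k > M K` is then zero. -/
lemma regularSample_dirac (h : SampleBounds a p D E γ H M K y) (hκ : 1 ≤ κ) (hn : 3 ≤ n)
    (hD : 0 ≤ D) (hMK : M * K ≤ n) (hp0 : ∀ x, 0 < p x) (hK : 1 ≤ K) (hE : E + 2 ≤ γ * M)
    (hγ : 0 < γ) (ha : ∀ k, κ ≤ k → ∀ j, 0 < a k j) {k : ℕ} (hk : κ ≤ k)
    (hkH : (k : ℝ) ≤ (n : ℝ) ^ H)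
    (hmax : ∫⁻ θ, likelihood y ⟨K, θ⟩ ∂(dirichlet (a K)) ≤
      ∫⁻ θ, likelihood y ⟨k, θ⟩ ∂(dirichlet (a k))) (η : ℝ) :
    RegularSample κ a (Measure.dirac k) p D E η M K y := by
  have hl := one_le_log hn
  have hJ := jointDensity_pos hp0 y
  have hZ : marginal (hierPrior (Measure.dirac k) a) y =
      ∫⁻ θ, likelihood y ⟨k, θ⟩ ∂(dirichlet (a k)) := by
    rw [← binPrior_eq_hierPrior, marginal_binPrior]
  have hkM : k ≤ M * K := by
    by_contra hlt
    rw [not_le] at hlt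
    have h1 := (h.le_marginal.trans hmax).trans (h.marginal_le k hlt hkH)
    rw [ENNReal.ofReal_le_ofReal_iff (by positivity), mul_le_mul_iff_left₀ hJ] at h1
    have h2 : ((M * K : ℕ) : ℝ) ≤ k := by exact_mod_cast hlt.le
    push_cast at h2
    have hK' : (1 : ℝ) ≤ K := by exact_mod_cast hK
    have hT : 1 ≤ K * Real.log n := by nlinarith
    have h3 : (E + 2) * (K * Real.log n) ≤ γ * (k * Real.log n) :=
      calc (E + 2) * (K * Real.log n) ≤ γ * M * (K * Real.log n) := by gcongr
        _ = γ * (M * K * Real.log n) := by ring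
        _ ≤ _ := by gcongr
    have h4 : 2 * Real.exp (-(γ * (k * Real.log n))) < Real.exp (-(E * (K * Real.log n))) := by
      calc 2 * Real.exp (-(γ * (k * Real.log n))) < Real.exp 1 * Real.exp (-(γ * (k * Real.log n))) := by
            gcongr
            linarith [Real.exp_one_gt_d9]
        _ ≤ _ := by rw [← Real.exp_add, Real.exp_le_exp]; nlinarith
    linarith
  refine ⟨h.lt_one, h.likelihood_le_of_le hκ hn hD hMK hp0, ?_, ?_, ?_⟩
  · rw [hZ]; exact h.le_marginal.trans hmax
  · rw [hZ]; exact lintegral_likelihood_ne_top (by omega) (ha k hk) y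
  · refine le_trans (le_of_eq ?_) zero_le
    rw [ENNReal.tsum_eq_zero]
    intro i
    split_ifs with hi
    · rfl
    · have : k ≠ i := by omega
      simp [this]

/-- The tail over `k > M K` is split at `n^H`: below, the marginal likelihoods are small; above, the
prior weights are. The constant `E` grows by `G`, the price of the prior weight of `K`. -/
lemma regularSample_of_binPriorBounds (h : SampleBounds a p D E γ H M K y) (hκ : 1 ≤ κ)
    (hn : 3 ≤ n) (hD : 0 ≤ D) (hMK : M * K ≤ n) (hp0 : ∀ x, 0 < p x) (hK : κ ≤ K) (hKn : K ≤ n)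
    (hγ : 0 < γ) (ha : ∀ k, κ ≤ k → ∀ j, 0 < a k j) {ν : Measure ℕ} {ρ B G : ℝ}
    (hν : BinPriorBounds κ ν ρ B G) (hE : E + G + 2 ≤ γ * M)
    (hH : B / (1 - ρ) * ρ ^ ((n : ℝ) ^ H) ≤ Real.exp (-((E + G + 2) * (K * Real.log n))))
    (hbig : ∀ k, κ ≤ k → (n : ℝ) ^ H < k → ∫⁻ θ, likelihood y ⟨k, θ⟩ ∂(dirichlet (a k)) ≤
      ENNReal.ofReal ((ρ ^ (2 * k))⁻¹ * jointDensity p y)) :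
    RegularSample κ a ν p D (E + G) (1 / n) M K y := by
  have := hν.isProbabilityMeasure
  have hρ := hν.pos
  have hρ1 := hν.lt_one
  have hB := hν.one_le
  have hl := one_le_log hn
  have hn' : (3 : ℝ) ≤ n := by exact_mod_cast hn
  have hJ := jointDensity_pos hp0 y
  have hK' : (1 : ℝ) ≤ K := by exact_mod_cast hκ.trans hK
  set T : ℝ := K * Real.log n with hT
  have hTl : Real.log n ≤ T := by rw [hT]; nlinarith
  set m : ℕ → ℝ≥0∞ := fun k => ∫⁻ θ, likelihood y ⟨k, θ⟩ ∂(dirichlet (a k)) with hm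
  set x := Real.exp (-((E + G + 2) * T)) with hx
  have hZ : marginal (hierPrior ν a) y = ∑' k, ν {k} * m k := marginal_hierPrior ν a y
  have hsum : ∑' k, ν {k} = 1 := by
    rw [← measure_univ (μ := ν), ← Measure.tsum_indicator_apply_singleton ν univ MeasurableSet.univ]
    simp
  have hlow : ENNReal.ofReal (Real.exp (-((E + G) * T)) * jointDensity p y) ≤
      marginal (hierPrior ν a) y := by
    rw [hZ]
    refine le_trans ?_ (ENNReal.le_tsum K)
    calc ENNReal.ofReal (Real.exp (-((E + G) * T)) * jointDensity p y)
        = ENNReal.ofReal (Real.exp (-(G * T))) *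
          ENNReal.ofReal (Real.exp (-(E * T)) * jointDensity p y) := by
          rw [← ENNReal.ofReal_mul (Real.exp_pos _).le, ← mul_assoc (Real.exp _) (Real.exp _),
            ← Real.exp_add]
          congr 3; ring
      _ ≤ _ := mul_le_mul' (hν.ge n hn K (hκ.trans hK) hK hKn) h.le_marginal
  have hterm : ∀ k, (if k ≤ M * K then 0 else ν {k} * m k) ≤
      ν {k} * ENNReal.ofReal (2 * x * jointDensity p y) +
        ENNReal.ofReal (B * ρ ^ ((n : ℝ) ^ H) * jointDensity p y) * ENNReal.ofReal ρ ^ k := by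
    intro k
    rcases lt_or_ge k κ with hk | hk
    · simp [hν.eq_zero k hk]
    split_ifs with hkM
    · exact zero_le
    rw [not_le] at hkM
    rcases le_or_gt (k : ℝ) ((n : ℝ) ^ H) with hkH | hkH
    · refine le_trans ?_ le_self_add
      refine mul_le_mul_right ((h.marginal_le k hkM hkH).trans (ENNReal.ofReal_le_ofReal ?_)) _
      have h2 : ((M * K : ℕ) : ℝ) ≤ k := by exact_mod_cast hkM.le
      push_cast at h2
      have h3 : (E + G + 2) * T ≤ γ * (k * Real.log n) :=
        calc (E + G + 2) * T ≤ γ * M * (K * Real.log n) := by rw [hT]; gcongr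
          _ = γ * (M * K * Real.log n) := by ring
          _ ≤ _ := by gcongr
      rw [hx]
      gcongr
    · refine le_trans ?_ le_add_self
      refine (mul_le_mul' (hν.le k) (hbig k hk hkH)).trans ?_
      rw [← ENNReal.ofReal_pow hρ.le, ← ENNReal.ofReal_mul (by positivity),
        ← ENNReal.ofReal_mul (by positivity)]
      refine ENNReal.ofReal_le_ofReal ?_
      have h4 : ρ ^ k ≤ ρ ^ ((n : ℝ) ^ H) := by
        rw [← Real.rpow_natCast]
        exact Real.rpow_le_rpow_of_exponent_ge hρ hρ1.le hkH.le
      -- Of the four factors `ρ^k`, two are spent on the Markov bound for the marginal likelihood,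
      -- one yields `ρ^(n^H)`, and one makes the series over `k` converge.
      calc B * ρ ^ (4 * k) * ((ρ ^ (2 * k))⁻¹ * jointDensity p y)
          = B * ρ ^ k * jointDensity p y * ρ ^ k := by
            rw [show 4 * k = k + k + 2 * k by ring, pow_add, pow_add]
            field_simp
        _ ≤ _ := by gcongr
  have htail : ∑' k, (if k ≤ M * K then 0 else ν {k} * m k) ≤
      ENNReal.ofReal (3 * x * jointDensity p y) := by
    refine (ENNReal.tsum_le_tsum hterm).trans ?_
    rw [ENNReal.tsum_add, ENNReal.tsum_mul_right, hsum, one_mul, ENNReal.tsum_mul_left,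
      ENNReal.tsum_geometric, ← ENNReal.ofReal_one, ← ENNReal.ofReal_sub _ hρ.le,
      ← ENNReal.ofReal_inv_of_pos (by linarith), ← ENNReal.ofReal_mul (by positivity),
      ← ENNReal.ofReal_add (by positivity)
        (mul_nonneg (by positivity) (inv_nonneg.2 (by linarith)))]
    refine ENNReal.ofReal_le_ofReal ?_
    have h5 : B * ρ ^ ((n : ℝ) ^ H) * jointDensity p y * (1 - ρ)⁻¹ ≤ x * jointDensity p y := by
      calc _ = B / (1 - ρ) * ρ ^ ((n : ℝ) ^ H) * jointDensity p y := by
            rw [div_eq_mul_inv]; ring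
        _ ≤ _ := by gcongr
    linarith
  refine ⟨h.lt_one, h.likelihood_le_of_le hκ hn hD hMK hp0, hlow, ?_, ?_⟩
  · have h6 : ∑' k, ν {k} * m k = ∑' k, (if k ≤ M * K then ν {k} * m k else 0) +
        ∑' k, (if k ≤ M * K then 0 else ν {k} * m k) := by
      rw [← ENNReal.tsum_add]
      refine tsum_congr fun k => ?_
      split_ifs <;> simp
    rw [hZ, h6]
    refine ENNReal.add_ne_top.2 ⟨?_, (htail.trans_lt ENNReal.ofReal_lt_top).ne⟩
    rw [tsum_eq_sum (s := Finset.range (M * K + 1)) fun k hk => if_neg fun hle =>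
      hk (Finset.mem_range.2 (by omega))]
    refine ENNReal.sum_ne_top.2 fun k _ => ?_
    split_ifs
    · rcases lt_or_ge k κ with hk | hk
      · simp [hν.eq_zero k hk]
      · exact ENNReal.mul_ne_top (measure_ne_top _ _)
          (lintegral_likelihood_ne_top (by omega) (ha k hk) y)
    · exact ENNReal.zero_ne_top
  · refine htail.trans (le_trans ?_ (mul_le_mul_right hlow _))
    rw [← ENNReal.ofReal_mul (by positivity)]
    refine ENNReal.ofReal_le_ofReal ?_
    -- The surplus `exp(-2T)` is at most `n^(-2)`, and `n ≥ 3` absorbs the factor `3`.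
    have h7 : 3 * x ≤ 1 / n * Real.exp (-((E + G) * T)) := by
      have h8 : x = Real.exp (-(2 * T)) * Real.exp (-((E + G) * T)) := by
        rw [hx, ← Real.exp_add]; congr 1; ring
      have h9 : Real.exp (-(2 * T)) ≤ 1 / (n : ℝ) ^ 2 := by
        rw [← exp_neg_two_mul_log (by omega), Real.exp_le_exp]; linarith
      rw [h8, ← mul_assoc]
      gcongr
      calc 3 * Real.exp (-(2 * T)) ≤ n * (1 / (n : ℝ) ^ 2) := by gcongr
        _ = 1 / n := by field_simp
    calc 3 * x * jointDensity p y ≤ 1 / n * Real.exp (-((E + G) * T)) * jointDensity p y := by gcongr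
      _ = _ := by ring

end SampleBounds

/-- Markov's inequality for the marginal likelihoods of very large numbers of bins. -/
lemma measure_exists_lintegral_likelihood_gt_le {p : I → ℝ} (hp : IsDensity p)
    (hp0 : ∀ x, 0 < p x) {κ : ℕ} (hκ : 1 ≤ κ) {a : (k : ℕ) → Fin k → ℝ}
    (ha : ∀ k, κ ≤ k → ∀ j, 0 < a k j) {ρ : ℝ} (hρ : 0 < ρ) (hρ1 : ρ < 1) (n : ℕ) (N : ℝ) :
    sampleLaw p n {y | ¬ ∀ k, κ ≤ k → N < k → ∫⁻ θ, likelihood y ⟨k, θ⟩ ∂(dirichlet (a k)) ≤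
      ENNReal.ofReal ((ρ ^ (2 * k))⁻¹ * jointDensity p y)} ≤
      ENNReal.ofReal ((1 - ρ)⁻¹ * ρ ^ N) := by
  let bad (k : ℕ) : Set (Fin n → I) := {y | κ ≤ k ∧ N < k ∧
    ENNReal.ofReal ((ρ ^ (2 * k))⁻¹ * jointDensity p y) <
      ∫⁻ θ, likelihood y ⟨k, θ⟩ ∂(dirichlet (a k))}
  refine (measure_mono (t := ⋃ k, bad k) fun y hy => ?_).trans
    ((measure_iUnion_le _).trans ?_)
  · change ¬ _ at hy
    push Not at hy
    obtain ⟨k, hk⟩ := hy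
    exact mem_iUnion.2 ⟨k, hk⟩
  have hbad (k : ℕ) : sampleLaw p n (bad k) ≤ ENNReal.ofReal (ρ ^ N) * ENNReal.ofReal ρ ^ k := by
    by_cases hk : κ ≤ k ∧ N < k
    swap
    · have : bad k = ∅ := eq_empty_of_forall_notMem fun y hy => hk ⟨hy.1, hy.2.1⟩
      simp [this]
    have := isProbabilityMeasure_dirichlet (ha k hk.1)
    have h := measure_setLIntegral_likelihood_gt_le hp hp0 (n := n) (dirichlet (a k))
      (ae_dirichlet_mem_stdSimplex (by omega) (ha k hk.1)) univ
      (show 0 < (ρ ^ (2 * k))⁻¹ by positivity)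
    simp only [Measure.restrict_univ] at h
    refine (measure_mono fun y hy => hy.2.2).trans (h.trans ?_)
    rw [measure_univ, ← ENNReal.ofReal_one, ← ENNReal.ofReal_div_of_pos (by positivity), one_div,
      inv_inv, ← ENNReal.ofReal_pow hρ.le, ← ENNReal.ofReal_mul (by positivity)]
    refine ENNReal.ofReal_le_ofReal ?_
    have h4 : ρ ^ k ≤ ρ ^ N := by
      rw [← Real.rpow_natCast]
      exact Real.rpow_le_rpow_of_exponent_ge hρ hρ1.le hk.2.le
    rw [two_mul, pow_add]
    gcongr
  refine (ENNReal.tsum_le_tsum hbad).trans ?_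
  rw [ENNReal.tsum_mul_left, ENNReal.tsum_geometric, ← ENNReal.ofReal_one,
    ← ENNReal.ofReal_sub _ hρ.le, ← ENNReal.ofReal_inv_of_pos (by linarith),
    ← ENNReal.ofReal_mul (by positivity), mul_comm]

/-- The samples on which the hierarchical or empirical Bayes posterior `μ` is well behaved. -/
def IsRegularPosterior (κ : ℕ) (a : (k : ℕ) → Fin k → ℝ) (μ : Measure HistParam) (p : I → ℝ)
    (D E η : ℝ) (M K : ℕ) {n : ℕ} (y : Fin n → I) : Prop :=
  ∃ ν : Measure ℕ, IsProbabilityMeasure ν ∧ (∀ k < κ, ν {k} = 0) ∧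
    μ = histPosterior (hierPrior ν a) y ∧ RegularSample κ a ν p D E η M K y

lemma pos_of_rpow_neg_mul_le {κ : ℕ} {a : (k : ℕ) → Fin k → ℝ} {s c₁ C₁ : ℝ} (hc₁ : 0 < c₁)
    (ha : ∀ k, κ ≤ k → ∀ j : Fin k, c₁ * (k : ℝ) ^ (-s) ≤ a k j ∧ a k j ≤ C₁) (k : ℕ) (hk : κ ≤ k)
    (j : Fin k) : 0 < a k j ∧ a k j ≤ C₁ := by
  have h0 : (0 : ℝ) < k := by exact_mod_cast j.pos
  have h := ha k hk j
  exact ⟨lt_of_lt_of_le (by positivity) h.1, h.2⟩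

/-- The condition `β₀ > 1/2` leaves room for an exponent `H` between `1/(1 + 2β₀)` and `1/2`: then
`K log n` is of smaller order than `n^H`, while models with up to `n^H` bins remain penalised by the
Dirichlet prior. -/
lemma exists_eventually_isRegularPosterior {β₀ L₀ c₀ : ℝ} (C₀ : ℝ) (hβ₀ : 1 / 2 < β₀)
    (hL₀ : 0 < L₀) (hc₀ : 0 < c₀) {κ : ℕ} (hκ : 1 ≤ κ) {a : (k : ℕ) → Fin k → ℝ} {s c₁ C₁ : ℝ}
    (hs : 0 ≤ s) (hc₁ : 0 < c₁)
    (ha : ∀ k, κ ≤ k → ∀ j : Fin k, c₁ * (k : ℝ) ^ (-s) ≤ a k j ∧ a k j ≤ C₁)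
    {post : (n : ℕ) → (Fin n → I) → Measure HistParam}
    (hpost : IsHierarchicalPosterior κ a post ∨
      IsEmpiricalPosterior κ a (holderDensities β₀ L₀ c₀ C₀) post) :
    ∃ E : ℝ, 0 < E ∧ ∀ D : ℝ, 64 ≤ D → ∃ M : ℕ, 1 ≤ M ∧ ∀ᶠ n : ℕ in atTop,
      ∀ p ∈ holderDensities β₀ L₀ c₀ C₀,
        sampleLaw p n {y | ¬ IsRegularPosterior κ a (post n y) p D E (1 / n) M
          (oracleBins κ p n) y} ≤ ENNReal.ofReal (5 / n) := by
  have hβ : 0 < β₀ := by linarith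
  have hb : 1 / (1 + 2 * β₀) < 1 / 2 := by
    rw [one_div_lt_one_div (by linarith) (by norm_num)]
    linarith
  have ha0 := fun k hk j => (pos_of_rpow_neg_mul_le hc₁ ha k hk j).1
  obtain ⟨E, hE, hS⟩ := exists_eventually_sampleBounds C₀ hβ hL₀ hc₀ hκ hs hc₁ ha
  have hM (H G : ℝ) (hH : H < 1 / 2) : ∃ M : ℕ, 1 ≤ M ∧ E + G + 2 ≤ (1 - 2 * H) / 16 * M ∧
      2 ≤ (1 - 2 * H) / 16 * M := by
    have hγ : 0 < (1 - 2 * H) / 16 := by linarith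
    obtain ⟨M, hM⟩ := exists_nat_ge ((E + |G| + 2) / ((1 - 2 * H) / 16))
    rw [div_le_iff₀ hγ] at hM
    have h0 := le_abs_self G
    have h1 := abs_nonneg G
    refine ⟨M, ?_, by linarith, by linarith⟩
    by_contra h
    have h2 : M = 0 := by omega
    rw [h2] at hM
    norm_num at hM
    linarith
  have hK {H : ℝ} (hH : 1 / (1 + 2 * β₀) < H) (hH1 : H < 1 / 2) (M : ℕ) : ∀ᶠ n : ℕ in atTop,
      ∀ p ∈ holderDensities β₀ L₀ c₀ C₀, M * oracleBins κ p n ≤ n := by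
    filter_upwards [eventually_mul_oracleBins_le hκ C₀ hβ hL₀ hc₀ hH M, eventually_ge_atTop 3]
      with n hn hn3 p hp
    have hn' : (3 : ℝ) ≤ n := by exact_mod_cast hn3
    have h1 : ((M * oracleBins κ p n : ℕ) : ℝ) ≤ n := by
      push_cast
      calc (M : ℝ) * oracleBins κ p n ≤ M * (oracleBins κ p n * Real.log n) := by
            gcongr
            exact le_mul_of_one_le_right (Nat.cast_nonneg _) (one_le_log hn3)
        _ ≤ (n : ℝ) ^ H := hn p hp
        _ ≤ (n : ℝ) ^ (1 : ℝ) := Real.rpow_le_rpow_of_exponent_le (by linarith) (by linarith)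
        _ = n := Real.rpow_one _
    exact_mod_cast h1
  rcases hpost with ⟨ν, hν, hpost⟩ | ⟨Kbar, khat, ⟨⟨H', hH', hKbar⟩, hKbar'⟩, hmmle, hpost⟩
  · obtain ⟨ρ, B, G, hbd⟩ := hν.exists_bounds
    have hρ := hbd.pos
    have hρ1 := hbd.lt_one
    have hB := hbd.one_le
    refine ⟨E + G, by linarith [hbd.nonneg], fun D hD => ?_⟩
    obtain ⟨H, hH, hH1⟩ := exists_between hb
    obtain ⟨M, hM1, hM2, hM3⟩ := hM H G hH1
    have hlog : 0 < -Real.log ρ := by linarith [Real.log_neg hρ hρ1]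
    refine ⟨M, hM1, ?_⟩
    filter_upwards [hS H hH hH1 D hD M hM3, hK hH hH1 M, hK hH hH1 1,
      eventually_mul_oracleBins_le hκ C₀ hβ hL₀ hc₀ hH
        ((|Real.log (B / (1 - ρ))| + (E + G + 2)) / -Real.log ρ), eventually_ge_atTop 3]
      with n hSn hMn hKn hlarge hn p hp
    have hn0 : (0 : ℝ) < n := by positivity
    have hl := one_le_log hn
    have hSn' := hSn p hp
    have hMn' := hMn p hp
    have hKn' := hKn p hp
    have hlarge' := hlarge p hp
    obtain ⟨hd, hpb, -⟩ := hp
    have hp0 : ∀ x, 0 < p x := fun x => hc₀.trans_le (hpb x).1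
    have hor := (oracleBins_mem hκ hd (n := n) (by omega)).1
    set K := oracleBins κ p n
    have hK' : (1 : ℝ) ≤ K := by exact_mod_cast hκ.trans hor
    have hTl : Real.log n ≤ K * Real.log n := by nlinarith
    have hρn : B / (1 - ρ) * ρ ^ ((n : ℝ) ^ H) ≤
        Real.exp (-((E + G + 2) * (K * Real.log n))) := by
      have h1ρ : 0 < 1 - ρ := by linarith
      rw [div_mul_eq_mul_div, div_le_iff₀ hlog] at hlarge'
      rw [Real.rpow_def_of_pos hρ, ← Real.exp_log (show 0 < B / (1 - ρ) by positivity),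
        ← Real.exp_add, Real.exp_le_exp]
      have := le_abs_self (Real.log (B / (1 - ρ)))
      have := abs_nonneg (Real.log (B / (1 - ρ)))
      nlinarith
    refine (measure_mono (t := _ ∪ _) fun y hy => ?_).trans ((measure_union_le _ _).trans
      ((add_le_add hSn' (measure_exists_lintegral_likelihood_gt_le hd hp0 hκ ha0 hρ hρ1 n
        ((n : ℝ) ^ H))).trans ?_))
    · by_contra hcon
      rw [mem_union, not_or] at hcon
      have h1 := not_not.1 hcon.1
      have h2 := not_not.1 hcon.2
      exact hy ⟨ν, hbd.isProbabilityMeasure, hbd.eq_zero, hpost n y,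
        h1.regularSample_of_binPriorBounds hκ hn (by linarith) hMn' hp0 hor (by linarith)
          (by linarith) ha0 hbd hM2 hρn h2⟩
    · have h3 : (1 - ρ)⁻¹ * ρ ^ ((n : ℝ) ^ H) ≤ 1 / n := by
        have h1ρ : 0 < 1 - ρ := by linarith
        calc (1 - ρ)⁻¹ * ρ ^ ((n : ℝ) ^ H) = 1 / (1 - ρ) * ρ ^ ((n : ℝ) ^ H) := by rw [one_div]
          _ ≤ B / (1 - ρ) * ρ ^ ((n : ℝ) ^ H) := by gcongr
          _ ≤ _ := hρn
          _ ≤ Real.exp (-Real.log n) := by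
            rw [Real.exp_le_exp]
            nlinarith [hbd.nonneg]
          _ = 1 / n := by rw [Real.exp_neg, Real.exp_log hn0, one_div]
      refine (add_le_add le_rfl (ENNReal.ofReal_le_ofReal h3)).trans (le_of_eq ?_)
      rw [← ENNReal.ofReal_add (by positivity) (by positivity)]
      congr 1
      ring
  · refine ⟨E, hE, fun D hD => ?_⟩
    -- Here `H` must also exceed the exponent `H'` of the search range, so that `khat` falls where
    -- the overfitting bound applies.
    obtain ⟨H, hH, hH1⟩ := exists_between (max_lt hb hH')
    have hHb : 1 / (1 + 2 * β₀) < H := (le_max_left _ _).trans_lt hH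
    obtain ⟨M, hM1, hM2, hM3⟩ := hM H 0 hH1
    refine ⟨M, hM1, ?_⟩
    filter_upwards [hS H hHb hH1 D hD M hM3, hK hHb hH1 M, hKbar, hKbar', hmmle,
      eventually_ge_atTop 3] with n hSn hMn hKb hKb' hmm hn p hp
    have hn' : (3 : ℝ) ≤ n := by exact_mod_cast hn
    have hSn' := hSn p hp
    have hMn' := hMn p hp
    have hKb'' := hKb' p hp
    obtain ⟨hd, hpb, -⟩ := hp
    have hp0 : ∀ x, 0 < p x := fun x => hc₀.trans_le (hpb x).1
    have hor := (oracleBins_mem hκ hd (n := n) (by omega)).1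
    refine (measure_mono fun y hy => ?_).trans (hSn'.trans (ENNReal.ofReal_le_ofReal ?_))
    · by_contra hcon
      have h1 := not_not.1 hcon
      obtain ⟨hk, hmax⟩ := hmm y
      have h2 := hmax _ ⟨hor, hKb''⟩
      rw [marginal_binPrior, marginal_binPrior] at h2
      have h3 : (khat n y : ℝ) ≤ (n : ℝ) ^ H :=
        calc (khat n y : ℝ) ≤ Kbar n := by exact_mod_cast hk.2
          _ ≤ (n : ℝ) ^ H' := hKb
          _ ≤ (n : ℝ) ^ H := Real.rpow_le_rpow_of_exponent_le (by linarith)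
            ((le_max_right _ _).trans hH.le)
      exact hy ⟨Measure.dirac (khat n y), inferInstance,
        fun k hk' => by
          have : khat n y ≠ k := by have := hk.1; omega
          simp [this],
        by rw [hpost, binPrior_eq_hierPrior],
        h1.regularSample_dirac hκ hn (by linarith) hMn' hp0 (hκ.trans hor) (by linarith)
          (by linarith) ha0 hk.1 h3 h2 _⟩
    · gcongr
      norm_num

/-! ### Credible sets -/

namespace IsRegularPosterior

variable {κ : ℕ} {a : (k : ℕ) → Fin k → ℝ} {μ : Measure HistParam} {p : I → ℝ} {D E : ℝ}
  {M K n : ℕ} {y : Fin n → I}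

lemma measure_univ_eq_one {η : ℝ} (h : IsRegularPosterior κ a μ p D E η M K y)
    (hp : ∀ x, 0 < p x) : μ univ = 1 := by
  obtain ⟨ν, -, -, rfl, hr⟩ := h
  exact histPosterior_univ (hr.marginal_ne_zero hp) hr.marginal_ne_top

lemma exp_neg_le_one_div (hn : 3 ≤ n) (hK : 1 ≤ K) (hDE : E + 1 ≤ D / 8) :
    Real.exp (-((D / 8 - E) * (K * Real.log n))) ≤ 1 / n := by
  have hl := one_le_log hn
  have hn0 : (0 : ℝ) < n := by positivity
  have hK' : (1 : ℝ) ≤ K := by exact_mod_cast hK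
  have hT : Real.log n ≤ K * Real.log n := by nlinarith
  calc Real.exp (-((D / 8 - E) * (K * Real.log n))) ≤ Real.exp (-Real.log n) := by
        rw [Real.exp_le_exp]
        nlinarith
    _ = 1 / n := by rw [Real.exp_neg, Real.exp_log hn0, one_div]

lemma measure_compl_le (h : IsRegularPosterior κ a μ p D E (1 / n) M K y) (hκ : 1 ≤ κ)
    (hn : 3 ≤ n) (hD : 0 ≤ D) (hDE : E + 1 ≤ D / 8) (hK : 1 ≤ K)
    (ha : ∀ k, κ ≤ k → ∀ j, 0 < a k j) (hpm : Measurable p) (hp : ∀ x, 0 < p x) :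
    μ (concentrationSet κ p D M K n)ᶜ ≤ ENNReal.ofReal (2 / n) := by
  obtain ⟨ν, hν, hν0, rfl, hr⟩ := h
  refine (hr.histPosterior_compl_le hκ (by omega) hD (by positivity) hν0 ha hpm hp).trans
    (ENNReal.ofReal_le_ofReal ?_)
  have h1 := exp_neg_le_one_div hn hK hDE
  calc _ ≤ 1 / (n : ℝ) + 1 / n := by gcongr
    _ = 2 / n := by ring

lemma measure_le_of_diam (h : IsRegularPosterior κ a μ p D E (1 / n) M K y) (hκ : 1 ≤ κ)
    (hn : 3 ≤ n) (hD : 0 ≤ D) (hDE : E + 1 ≤ D / 8) (hK : 1 ≤ K) {C₁ : ℝ}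
    (ha : ∀ k, κ ≤ k → ∀ j, 0 < a k j ∧ a k j ≤ C₁)
    (hpd : IsDensity p) {c C : ℝ} (hc : 0 < c) (hpb : ∀ x, c ≤ p x ∧ p x ≤ C)
    (hR : (M * K : ℕ) * postRadius D M K n ^ 2 < c / 4) (hMn : (M * K : ℕ) ≤ c / 8 * √n)
    {s : Set HistParam} (hs : MeasurableSet s) (hsc : s ⊆ concentrationSet κ p D M K n) {d ζ : ℝ}
    (hd : 0 < d) (hζ : 0 ≤ ζ)
    (hsd : ∀ θ ∈ s, ∀ θ' ∈ s, hellinger (histDensity θ) (histDensity θ') ≤ d)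
    (hsζ : ∀ θ ∈ s, (64 * C / c) ^ ((C₁ + 1) * θ.1) * (4 * √C * d * √n / √θ.1) ^ (θ.1 - 1) *
        Real.exp (8 / c * θ.1) ≤ ζ) :
    μ s ≤ ENNReal.ofReal (ζ + 1 / n) := by
  obtain ⟨ν, hν, hν0, rfl, hr⟩ := h
  refine (hr.histPosterior_le_of_diam hκ (by omega) hD hν0 ha hpd hc hpb hR hMn hs hsc hd hζ hsd
    hsζ).trans (ENNReal.ofReal_le_ofReal ?_)
  gcongr
  exact exp_neg_le_one_div hn hK hDE

/-- The posterior mass of a Hellinger ball around an arbitrary density. -/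
lemma le_measure_ball (h : IsRegularPosterior κ a μ p D E (1 / n) M K y) (hκ : 1 ≤ κ)
    (hn : 3 ≤ n) (hD : 0 ≤ D) (hDE : E + 1 ≤ D / 8) (hK : 1 ≤ K)
    (ha : ∀ k, κ ≤ k → ∀ j, 0 < a k j) (hpd : IsDensity p) (hp : ∀ x, 0 < p x) {q : I → ℝ}
    (hq : IsDensity q) {α : ℝ} (hα : 2 / n ≤ α) :
    ENNReal.ofReal (1 - α) ≤
      μ {θ | hellinger (histDensity θ) q ≤ postRadius D M K n + hellinger p q} := by
  have h1 := h.measure_compl_le hκ hn hD hDE hK ha hpd.1 hp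
  have h2 : concentrationSet κ p D M K n ⊆
      {θ | hellinger (histDensity θ) q ≤ postRadius D M K n + hellinger p q} := fun θ hθ =>
    (hellinger_triangle (rootL2_histDensity θ.2) hpd.rootL2 hq.rootL2).trans
      (add_le_add hθ.2.2.2 le_rfl)
  refine le_trans ?_ (measure_mono h2)
  have h0 : (0 : ℝ) ≤ 2 / n := by positivity
  rw [ENNReal.ofReal_sub _ (h0.trans hα), ENNReal.ofReal_one, tsub_le_iff_right,
    ← h.measure_univ_eq_one hp, ← union_compl_self (concentrationSet κ p D M K n)]
  exact (measure_union_le _ _).trans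
    (add_le_add le_rfl (h1.trans (ENNReal.ofReal_le_ofReal hα)))

end IsRegularPosterior

lemma credibleRadius_le {μ : Measure HistParam} {q : I → ℝ} {α r : ℝ} (hα : α < 1)
    (h : ENNReal.ofReal (1 - α) ≤ μ {θ | hellinger (histDensity θ) q ≤ r}) :
    credibleRadius μ q α ≤ r := by
  -- The admissible radii are bounded below by zero: balls of negative radius are empty, and `1 - α`
  -- is positive.
  refine csInf_le ⟨0, fun r' hr' => ?_⟩ h
  by_contra hlt
  have he : {θ : HistParam | hellinger (histDensity θ) q ≤ r'} = ∅ :=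
    eq_empty_of_forall_notMem fun θ hθ =>
      hlt ((hellinger_nonneg _ _).trans (show hellinger (histDensity θ) q ≤ r' from hθ))
  have h0 : ENNReal.ofReal (1 - α) ≤ μ {θ | hellinger (histDensity θ) q ≤ r'} := hr'
  rw [he, measure_empty, nonpos_iff_eq_zero, ENNReal.ofReal_eq_zero] at h0
  linarith

lemma hellingerDiam_credibleSet_le {μ : Measure HistParam} {q : I → ℝ} (hq : IsDensity q)
    {α : ℝ} :
    hellingerDiam (credibleSet μ q 1 α) ≤ ENNReal.ofReal (2 * credibleRadius μ q α) := by
  refine iSup₂_le fun p hp => iSup₂_le fun p' hp' => ENNReal.ofReal_le_ofReal ?_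
  have h1 := hp.2
  have h2 := hp'.2
  rw [hellinger_comm] at h2
  linarith [hellinger_triangle hp.1.rootL2 hq.rootL2 hp'.1.rootL2]

/-- Complements are handled by subadditivity of outer measure, so none of the three events has to be
measurable. -/
lemma ofReal_one_sub_le_innerProb {Ω : Type*} [MeasurableSpace Ω] {P : Measure Ω}
    [IsProbabilityMeasure P] {A B S : Set Ω} {ε : ℝ} (hε : 0 < ε)
    (hA : ENNReal.ofReal (1 - ε / 2) ≤ innerProb P A) (hB : P Bᶜ ≤ ENNReal.ofReal (ε / 2))
    (hS : A ∩ B ⊆ S) : ENNReal.ofReal (1 - ε) ≤ innerProb P S := by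
  rcases le_or_gt 1 ε with h1 | h1
  · rw [ENNReal.ofReal_of_nonpos (by linarith)]
    exact zero_le
  have hA' : P Aᶜ ≤ ENNReal.ofReal (ε / 2) := by
    have h2 : ENNReal.ofReal (1 - ε / 2) + P Aᶜ ≤ 1 := by
      calc ENNReal.ofReal (1 - ε / 2) + P Aᶜ ≤ 1 - P Aᶜ + P Aᶜ := add_le_add hA le_rfl
        _ = 1 := tsub_add_cancel_of_le prob_le_one
    have h3 : (1 : ℝ≥0∞) = ENNReal.ofReal (1 - ε / 2) + ENNReal.ofReal (ε / 2) := by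
      rw [← ENNReal.ofReal_add (by linarith) (by linarith), sub_add_cancel, ENNReal.ofReal_one]
    rw [h3] at h2
    exact (ENNReal.add_le_add_iff_left ENNReal.ofReal_ne_top).1 h2
  have hS' : P Sᶜ ≤ ENNReal.ofReal ε := by
    calc P Sᶜ ≤ P (Aᶜ ∪ Bᶜ) := measure_mono (by
          rw [← compl_inter]; exact compl_subset_compl.2 hS)
      _ ≤ P Aᶜ + P Bᶜ := measure_union_le _ _
      _ ≤ ENNReal.ofReal (ε / 2) + ENNReal.ofReal (ε / 2) := add_le_add hA' hB
      _ = ENNReal.ofReal ε := by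
          rw [← ENNReal.ofReal_add (by linarith) (by linarith), add_halves]
  rw [innerProb, ENNReal.ofReal_sub _ hε.le, ENNReal.ofReal_one]
  exact tsub_le_tsub_left hS' _

lemma sqrt_oracleBins_mul_log_div_le {B x K : ℝ} {β n l : ℝ} (hβ : 0 < β) (hB : 0 ≤ B)
    (hl : 0 < l) (hn : 0 < n) (hx : x = n / l) (hK : K ≤ B * x ^ (1 / (1 + 2 * β))) :
    √(K * l / n) ≤ √B * x ^ (-(β / (1 + 2 * β))) := by
  have hx0 : 0 < x := by rw [hx]; positivity
  rw [Real.sqrt_le_left (by positivity), mul_pow, Real.sq_sqrt hB, ← Real.rpow_natCast,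
    ← Real.rpow_mul hx0.le]
  have h1 : K * l / n = K * x⁻¹ := by rw [hx]; field_simp
  have h2 : -(β / (1 + 2 * β)) * ((2 : ℕ) : ℝ) = 1 / (1 + 2 * β) + -1 := by
    push_cast; field_simp; ring
  rw [h1, h2, Real.rpow_add hx0, Real.rpow_neg_one, ← mul_assoc]
  gcongr

lemma postRadius_eq (D : ℝ) (M K n : ℕ) (hD : 0 ≤ D) :
    postRadius D M K n = √(D * (M + 1)) * √(K * Real.log n / n) := by
  rw [postRadius, ← Real.sqrt_mul (by positivity)]
  congr 1
  ring

/-- For `β₀ > 1/2` the exponent `1/(1 + 2β₀)` is below `1/2`. This makes all weights of nearby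
histograms comparable to `1/k` and places the Euclidean balls of radius `1/√n` inside the simplex.
-/
lemma eventually_mul_oracleBins_le_sqrt {κ : ℕ} (hκ : 1 ≤ κ) {β₀ L₀ c₀ : ℝ} (C₀ : ℝ)
    (hβ₀ : 1 / 2 < β₀) (hL₀ : 0 < L₀) (hc₀ : 0 < c₀) (A : ℝ) :
    ∀ᶠ n : ℕ in atTop, ∀ p ∈ holderDensities β₀ L₀ c₀ C₀,
      A * (oracleBins κ p n * Real.log n) ≤ √n := by
  have hb : 1 / (1 + 2 * β₀) < 1 / 2 := by
    rw [one_div_lt_one_div (by linarith) (by norm_num)]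
    linarith
  filter_upwards [eventually_mul_oracleBins_le hκ C₀ (by linarith) hL₀ hc₀ hb A] with n hn p hp
  rw [Real.sqrt_eq_rpow]
  exact hn p hp

/-- For `k ≥ 2` the expression has at least one factor `t`, and the remaining growth `A₀^k` is
absorbed by the powers of `t`. For `k = 1` it equals `A₀` whatever `t` is; hence the one-bin model
must be excluded. -/
lemma exists_ball_mass_bound (A₀ : ℝ) {b ζ : ℝ} (hb : 0 ≤ b) (hζ : 0 < ζ) :
    ∃ t : ℝ, 0 < t ∧ ∀ k : ℕ, 2 ≤ k → A₀ ^ k * (b * t) ^ (k - 1) ≤ ζ := by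
  set A := max |A₀| 1
  have hA1 : 1 ≤ A := le_max_right _ _
  have hA0 : |A₀| ≤ A := le_max_left _ _
  set z := min ζ 1
  have hz : 0 < z := lt_min hζ one_pos
  have hbA : A * (b * (z / (A ^ 2 * (b + 1)))) ≤ z / A := by
    rw [show A * (b * (z / (A ^ 2 * (b + 1)))) = z / A * (b / (b + 1)) by field_simp]
    refine mul_le_of_le_one_right (by positivity) ?_
    rw [div_le_one (by positivity)]
    linarith
  refine ⟨z / (A ^ 2 * (b + 1)), by positivity, fun k hk => ?_⟩
  obtain ⟨j, rfl⟩ := Nat.exists_eq_add_of_le hk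
  set u := b * (z / (A ^ 2 * (b + 1)))
  have hu : 0 ≤ u := by positivity
  have h1 : z / A ≤ 1 := by
    rw [div_le_one (by positivity)]
    exact (min_le_right _ _).trans hA1
  have hAu : 0 ≤ A * u := by positivity
  calc A₀ ^ (2 + j) * u ^ (2 + j - 1) ≤ A ^ (2 + j) * u ^ (2 + j - 1) := by
        refine mul_le_mul_of_nonneg_right ?_ (by positivity)
        exact (le_abs_self _).trans (abs_pow A₀ _ ▸ pow_le_pow_left₀ (abs_nonneg _) hA0 _)
    _ = A * (A * u) * (A * u) ^ j := by
        rw [show 2 + j - 1 = 1 + j by omega, mul_pow]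
        ring
    _ ≤ A * (A * u) * 1 := by
        gcongr
        exact pow_le_one₀ hAu (hbA.trans h1)
    _ ≤ A * (z / A) := by rw [mul_one]; gcongr
    _ = z := by field_simp
    _ ≤ ζ := min_le_left _ _

/-- If all the histograms on which the posterior concentrates have at least of the order of `K`
bins, then the credible radius is at least of the order of `√(K / n)`. -/
lemma IsRegularPosterior.le_credibleRadius {κ : ℕ} {a : (k : ℕ) → Fin k → ℝ}
    {μ : Measure HistParam} {p : I → ℝ} {D E : ℝ} {M K n : ℕ} {y : Fin n → I}
    (h : IsRegularPosterior κ a μ p D E (1 / n) M K y) (hκ : 1 ≤ κ)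
    (hn : 3 ≤ n) (hD : 0 ≤ D) (hDE : E + 1 ≤ D / 8) (hK : 1 ≤ K) {C₁ : ℝ}
    (ha : ∀ k, κ ≤ k → ∀ j, 0 < a k j ∧ a k j ≤ C₁)
    (hpd : IsDensity p) {c C : ℝ} (hc : 0 < c) (hpb : ∀ x, c ≤ p x ∧ p x ≤ C)
    (hR : (M * K : ℕ) * postRadius D M K n ^ 2 < c / 4) (hMn : (M * K : ℕ) ≤ c / 8 * √n)
    {q : I → ℝ} (hq : IsDensity q) {α t : ℝ} (ht : 0 < t) {N : ℕ}
    (hN : ∀ θ ∈ concentrationSet κ p D M K n, 2 ≤ θ.1 ∧ K ≤ N * θ.1)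
    (hmass : ∀ k : ℕ, 2 ≤ k → ((64 * C / c) ^ (C₁ + 1) * Real.exp (8 / c)) ^ k *
      (8 * √C * √N * t) ^ (k - 1) ≤ (1 - α) / 2)
    (hα : 2 / n ≤ α) (hα1 : 3 / n < (1 - α) / 2) :
    t * √(K / n) ≤ credibleRadius μ q α := by
  have hp0 : ∀ x, 0 < p x := fun x => hc.trans_le (hpb x).1
  have hC : 0 < C := (hp0 0).trans_le (hpb 0).2
  have hn0 : (0 : ℝ) < n := by positivity
  have hK0 : (0 : ℝ) < K := by exact_mod_cast hK
  have ha0 := fun k hk j => (ha k hk j).1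
  -- Nonemptiness of the set of admissible radii is needed, since the infimum of the empty set would
  -- be `0`; the contraction ball supplies a member.
  refine le_csInf ⟨_, h.le_measure_ball hκ hn hD hDE hK ha0 hpd hp0 hq hα⟩ fun r hr => ?_
  have hr' : ENNReal.ofReal (1 - α) ≤ μ {θ | hellinger (histDensity θ) q ≤ r} := hr
  by_contra hlt
  rw [not_le] at hlt
  -- A credible ball of radius below `t √(K/n)` is contained in `s` and the complement of the
  -- concentration set, whose masses add up to at most `(1 - α)/2 + 3/n < 1 - α`.
  set s : Set HistParam := concentrationSet κ p D M K n ∩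
    {θ | hellinger (histDensity θ) q ≤ t * √(K / n)} with hs
  have hsm : MeasurableSet s := by
    refine (measurableSet_concentrationSet κ hpd.1 D M K n).inter ?_
    exact measurableSet_le (measurable_histParam fun k => measurable_hellinger_hist hq.1 k)
      measurable_const
  have hζ : 0 ≤ (1 - α) / 2 := le_trans (by positivity) hα1.le
  have h1 : μ s ≤ ENNReal.ofReal ((1 - α) / 2 + 1 / n) := by
    refine h.measure_le_of_diam hκ hn hD hDE hK ha hpd hc hpb hR hMn hsm inter_subset_left
      (d := 2 * t * √(K / n)) (by positivity) hζ ?_ ?_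
    · intro θ hθ θ' hθ'
      have h2 : hellinger (histDensity θ) q ≤ t * √(K / n) := hθ.2
      have h3 : hellinger (histDensity θ') q ≤ t * √(K / n) := hθ'.2
      rw [hellinger_comm] at h3
      linarith [hellinger_triangle (rootL2_histDensity θ.2) hq.rootL2 (rootL2_histDensity θ'.2)]
    · intro θ hθ
      obtain ⟨hk2, hkN⟩ := hN θ hθ.1
      refine le_trans (le_of_le_of_eq (b := (64 * C / c) ^ ((C₁ + 1) * θ.1) *
        (8 * √C * √N * t) ^ (θ.1 - 1) * Real.exp (8 / c * θ.1)) ?_ ?_) (hmass θ.1 hk2)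
      · have hk0 : (0 : ℝ) < θ.1 := by positivity
        -- This is where `K ≤ N k` is used: the small-ball bound in model `k` lives on the scale
        -- `√(k/n)`.
        have h4 : √(K / n) * √n / √θ.1 ≤ √N := by
          rw [← Real.sqrt_mul (by positivity), ← Real.sqrt_div (by positivity),
            div_mul_cancel₀ _ hn0.ne']
          refine Real.sqrt_le_sqrt ?_
          rw [div_le_iff₀ hk0]
          exact_mod_cast hkN
        have h5 : 4 * √C * (2 * t * √(K / n)) * √n / √θ.1 ≤ 8 * √C * √N * t :=
          calc 4 * √C * (2 * t * √(K / n)) * √n / √θ.1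
              = 8 * √C * t * (√(K / n) * √n / √θ.1) := by ring
            _ ≤ 8 * √C * t * √N := by gcongr
            _ = _ := by ring
        gcongr
      · rw [Real.rpow_mul (by positivity), Real.rpow_natCast, mul_comm (8 / c), Real.exp_nat_mul,
          mul_pow]
        ring
  have h2 : {θ : HistParam | hellinger (histDensity θ) q ≤ r} ⊆
      s ∪ (concentrationSet κ p D M K n)ᶜ := by
    intro θ hθ
    by_cases hθc : θ ∈ concentrationSet κ p D M K n
    · exact Or.inl ⟨hθc, le_trans hθ hlt.le⟩
    · exact Or.inr hθc
  have h3 := hr'.trans ((measure_mono h2).trans ((measure_union_le _ _).trans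
    (add_le_add h1 (h.measure_compl_le hκ hn hD hDE hK ha0 hpd.1 hp0))))
  rw [← ENNReal.ofReal_add (by positivity) (by positivity),
    ENNReal.ofReal_le_ofReal_iff (by positivity)] at h3
  have h4 : (3 : ℝ) / n = 1 / n + 2 / n := by ring
  linarith

/-- A histogram within the contraction radius bounds the bias of its model by `D (M + 1) K log n /
n`, so the polished tail prevents it from having far fewer than `K` bins. If `κ = 1`, a one-bin
histogram is excluded because `p` is at distance at least `δ` from the uniform density. -/
lemma le_of_mem_polishedTail {κ : ℕ} {R₀ k₀ : ℕ} {τ β₀ L₀ c₀ C₀ δ D : ℝ} {N M n : ℕ}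
    (hD : 0 ≤ D) (hκδ : 2 ≤ κ ∨ 0 < δ) (hκ : 1 ≤ κ) {p : I → ℝ}
    (hp : p ∈ coverageClass κ R₀ k₀ τ β₀ L₀ c₀ C₀ δ)
    (hN : ∀ k, κ ≤ k → bias p k ≤ D * (M + 1) * (oracleBins κ p n * Real.log n / n) →
      oracleBins κ p n ≤ N * k)
    (hδR : 0 < δ → postRadius D M (oracleBins κ p n) n < δ) :
    ∀ θ ∈ concentrationSet κ p D M (oracleBins κ p n) n,
      2 ≤ θ.1 ∧ oracleBins κ p n ≤ N * θ.1 := by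
  rintro ⟨k, θ⟩ ⟨hk, -, hθ, hR⟩
  have hR' : hellinger (histDensity ⟨k, θ⟩) p ≤ postRadius D M (oracleBins κ p n) n := hR
  have hk' : κ ≤ k := hk
  refine ⟨?_, hN k hk ?_⟩
  · rcases hκδ with h | h
    · exact h.trans hk
    by_contra hlt
    have hk1 : k = 1 := by
      have : ¬ 2 ≤ k := hlt
      omega
    subst hk1
    rw [hellinger_hist_one hθ] at hR'
    linarith [hp.2.2, hδR h]
  · refine (bias_le hθ).trans ?_
    rw [hellinger_comm]
    have hl : 0 ≤ Real.log n := Real.log_natCast_nonneg n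
    calc hellinger (histDensity ⟨k, θ⟩) p ^ 2
        ≤ postRadius D M (oracleBins κ p n) n ^ 2 := by
          gcongr
          exact hellinger_nonneg _ _
      _ = _ := by
          rw [postRadius, Real.sq_sqrt (by positivity)]
          ring

/-- One condition on `K log n / √n` gathers all requirements on the sample size. For `δ = 0` the
term divided by `δ²` is `0` and the last conclusion is vacuous. -/
lemma postRadius_bounds {D c δ : ℝ} {M K n : ℕ} (hD : 0 < D) (hc : 0 < c) (hn : 3 ≤ n)
    (hA : (4 * M * (D * (M + 1)) / c + 8 * M / c + D * (M + 1) / δ ^ 2 + 1) * (K * Real.log n) ≤ √n)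
    : (M * K : ℕ) * postRadius D M K n ^ 2 < c / 4 ∧ (M * K : ℕ) ≤ c / 8 * √n ∧
      (0 < δ → postRadius D M K n < δ) := by
  have hn' : (3 : ℝ) ≤ n := by exact_mod_cast hn
  have hn0 : (0 : ℝ) < n := by linarith
  have hl := one_le_log hn
  have hsn : 0 < √n := Real.sqrt_pos.2 hn0
  have hsn2 : √n * √n = n := Real.mul_self_sqrt hn0.le
  set T : ℝ := K * Real.log n with hT
  have hKT : (K : ℝ) ≤ T := le_mul_of_one_le_right (Nat.cast_nonneg _) hl
  have hT0 : 0 ≤ T := by positivity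
  set x₁ := 4 * M * (D * (M + 1)) / c with hx₁
  set x₂ := 8 * M / c with hx₂
  set x₃ := D * (M + 1) / δ ^ 2 with hx₃
  have hx₁0 : 0 ≤ x₁ := by positivity
  have hx₂0 : 0 ≤ x₂ := by positivity
  have hx₃0 : 0 ≤ x₃ := by positivity
  have hp1 := mul_nonneg hx₁0 hT0
  have hp2 := mul_nonneg hx₂0 hT0
  have hp3 := mul_nonneg hx₃0 hT0
  have hR2 : postRadius D M K n ^ 2 = D * (M + 1) * T / n := by
    rw [postRadius, Real.sq_sqrt (by positivity)]
    ring
  have h1 : x₁ * T + T ≤ √n := by linarith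
  refine ⟨?_, ?_, fun hδ => ?_⟩
  -- By `h1`, `x₁ T ≤ √n - T`, and `T (√n - T) ≤ n/4`.
  · have h2 : x₁ * T * T < n := by nlinarith [sq_nonneg (√n - 2 * T)]
    rw [hR2]
    push_cast
    calc (M * K : ℝ) * (D * (M + 1) * T / n) ≤ M * T * (D * (M + 1) * T / n) := by gcongr
      _ = c / 4 * (x₁ * T * T / n) := by rw [hx₁]; field_simp
      _ < c / 4 * 1 := by
        gcongr
        rwa [div_lt_one hn0]
      _ = c / 4 := mul_one _
  · push_cast
    calc (M * K : ℝ) ≤ M * T := by gcongr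
      _ = c / 8 * (x₂ * T) := by rw [hx₂]; field_simp
      _ ≤ c / 8 * √n := by gcongr; linarith
  · refine lt_of_pow_lt_pow_left₀ 2 hδ.le ?_
    have h2 : x₃ * T < n := by nlinarith
    rw [hR2]
    calc D * (M + 1) * T / n = δ ^ 2 * (x₃ * T / n) := by rw [hx₃]; field_simp
      _ < δ ^ 2 * 1 := by
        gcongr
        rwa [div_lt_one hn0]
      _ = δ ^ 2 := mul_one _

end

/-! ### Coverage and size of the credible sets -/

theorem mainTheorem8
    -- the smoothness range, the Hölder radius and the bounds on the densities
    (β₀ L₀ c₀ C₀ : ℝ) (hβ₀ : 1 / 2 < β₀) (hβ₀' : β₀ ≤ 1) (hL₀ : 0 < L₀) (hc₀ : 0 < c₀)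
    -- the smallest number of bins in use
    (κ : ℕ) (hκ : 1 ≤ κ)
    -- the parameters of the Dirichlet priors
    (a : (k : ℕ) → Fin k → ℝ) (s c₁ C₁ : ℝ) (hs : 0 ≤ s) (hc₁ : 0 < c₁)
    (ha : ∀ k, κ ≤ k → ∀ j : Fin k, c₁ * (k : ℝ) ^ (-s) ≤ a k j ∧ a k j ≤ C₁)
    -- the hierarchical or the empirical Bayes posterior
    (post : (n : ℕ) → (Fin n → unitInterval) → Measure HistParam)
    (hpost : IsHierarchicalPosterior κ a post ∨
      IsEmpiricalPosterior κ a (holderDensities β₀ L₀ c₀ C₀) post)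
    -- the centering point and the credibility level
    (phat : (n : ℕ) → (Fin n → unitInterval) → (unitInterval → ℝ))
    (hphat : ∀ n y, IsDensity (phat n y))
    (α : ℝ) (hα : 0 < α) (hα' : α < 1) :
    -- coverage
    (∀ (R₀ k₀ : ℕ) (τ δ : ℝ), 1 < R₀ → 1 ≤ k₀ → 0 < τ → τ < 1 →
      0 ≤ δ → (2 ≤ κ ∨ 0 < δ) →
      CentersAtRate κ (coverageClass κ R₀ k₀ τ β₀ L₀ c₀ C₀ δ) phat →
      ∀ ε : ℝ, 0 < ε → ∃ L : ℝ, 0 < L ∧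
        ENNReal.ofReal (1 - ε) ≤ liminf (fun n : ℕ =>
          ⨅ p ∈ coverageClass κ R₀ k₀ τ β₀ L₀ c₀ C₀ δ, innerProb (sampleLaw p n)
            {y | p ∈ credibleSet (post n y) (phat n y) (L * √(Real.log n)) α}) atTop) ∧
    -- size
    (CentersAtRate κ (holderDensities β₀ L₀ c₀ C₀) phat →
      ∀ ε : ℝ, 0 < ε → ∃ C : ℝ, 0 < C ∧
        ENNReal.ofReal (1 - ε) ≤ liminf (fun n : ℕ =>
          ⨅ β ∈ Set.Icc β₀ 1, ⨅ p ∈ holderDensities β L₀ c₀ C₀,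
            innerProb (sampleLaw p n)
              {y | hellingerDiam (credibleSet (post n y) (phat n y) 1 α) ≤
                ENNReal.ofReal (C * ((n : ℝ) / Real.log n) ^ (-(β / (1 + 2 * β))))}) atTop) := by
  have hα1 : 0 < (1 - α) / 2 := by linarith
  have ha' := pos_of_rpow_neg_mul_le hc₁ ha
  have ha0 := fun k hk j => (ha' k hk j).1
  obtain ⟨E, hE, hreg⟩ :=
    exists_eventually_isRegularPosterior C₀ hβ₀ hL₀ hc₀ hκ hs hc₁ ha hpost
  -- The radius constant exceeds `64` for the covering bound, and `D / 8 ≥ E + 1` makes far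
  -- likelihoods smaller than the evidence of the oracle model by a factor `1/n`.
  set D : ℝ := 64 + 8 * (E + 1) with hDdef
  have hD64 : 64 ≤ D := by linarith
  have hD : 0 < D := by linarith
  have hDE : E + 1 ≤ D / 8 := by linarith
  obtain ⟨M, hM1, hreg⟩ := hreg D hD64
  have hlim (x : ℝ) {z : ℝ} (hz : 0 < z) : ∀ᶠ n : ℕ in atTop, x / n < z :=
    (tendsto_const_div_atTop_nhds_zero_nat x).eventually_lt_const hz
  refine ⟨fun R₀ k₀ τ δ hR₀ hk₀ hτ hτ1 hδ hκδ hcent ε hε => ?_, fun hcent ε hε => ?_⟩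
  · obtain ⟨Mε, hMε, hcent⟩ := hcent (ε / 2) (half_pos hε)
    obtain ⟨N, hN0, hN⟩ := exists_oracleBins_le_mul hκ (k₀ := k₀) hR₀ hτ hτ1
      (show 0 < D * (M + 1) by positivity)
    obtain ⟨t, ht, hmass⟩ := exists_ball_mass_bound
      ((64 * C₀ / c₀) ^ (C₁ + 1) * Real.exp (8 / c₀)) (show 0 ≤ 8 * √C₀ * √N by positivity) hα1
    -- The centering error is at most `Mε √2 √(K log n / n)` and the radius at least `t √(K/n)`;
    -- their ratio is this constant times `√(log n)`.
    refine ⟨Mε * √2 / t, by positivity, le_liminf_of_le (by isBoundedDefault) ?_⟩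
    filter_upwards [hcent, hreg, eventually_mul_oracleBins_le_sqrt hκ C₀ hβ₀ hL₀ hc₀
        (4 * M * (D * (M + 1)) / c₀ + 8 * M / c₀ + D * (M + 1) / δ ^ 2 + 1),
      eventually_ge_atTop 3, hlim 5 (half_pos hε), hlim 2 hα, hlim 3 hα1]
      with n hcn hrn hAn hn hn5 hn2 hn3
    refine le_iInf₂ fun p hp => ?_
    obtain ⟨hpt, hph, hpδ⟩ := hp
    have hd := hph.1
    have := hd.isProbabilityMeasure_sampleLaw n
    have hor := (oracleBins_mem hκ hd (n := n) (by omega)).1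
    obtain ⟨hR, hMn, hRδ⟩ := postRadius_bounds hD hc₀ hn (hAn p hph)
    refine ofReal_one_sub_le_innerProb hε (hcn.trans (iInf₂_le p ⟨hpt, hph, hpδ⟩))
      (B := {y | IsRegularPosterior κ a (post n y) p D E (1 / n) M (oracleBins κ p n) y})
      ((hrn p hph).trans (ENNReal.ofReal_le_ofReal hn5.le)) ?_
    rintro y ⟨hy1, hy2⟩
    have hy1' : hellinger p (phat n y) ≤ Mε * rate p n (oracleBins κ p n) := hy1
    have hrad := IsRegularPosterior.le_credibleRadius hy2 hκ hn hD.le hDE (hκ.trans hor) ha' hd hc₀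
      hph.2.1 hR hMn (hphat n y) ht (le_of_mem_polishedTail hD.le hκδ hκ ⟨hpt, hph, hpδ⟩
        (hN p hpt n hn) hRδ) hmass hn2.le hn3
    refine ⟨hd, ?_⟩
    calc hellinger p (phat n y) ≤ Mε * rate p n (oracleBins κ p n) := hy1'
      _ ≤ Mε * (√2 * √(oracleBins κ p n * Real.log n / n)) := by
        gcongr
        exact rate_oracleBins_le hκ hd (by omega)
      _ = Mε * √2 / t * √(Real.log n) * (t * √(oracleBins κ p n / n)) := by
        rw [mul_div_right_comm, Real.sqrt_mul (by positivity)]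
        field_simp
      _ ≤ _ := by gcongr
  · obtain ⟨Mε, hMε, hcent⟩ := hcent (ε / 2) (half_pos hε)
    obtain ⟨B, hB, hor⟩ := exists_oracleBins_le hκ C₀ hL₀ hc₀
    refine ⟨2 * (√(D * (M + 1)) + Mε * √2) * √B, by positivity,
      le_liminf_of_le (by isBoundedDefault) ?_⟩
    filter_upwards [hcent, hreg, eventually_ge_atTop 3, hlim 5 (half_pos hε), hlim 2 hα]
      with n hcn hrn hn hn5 hn2
    refine le_iInf₂ fun β hβ => le_iInf₂ fun p hpβ => ?_
    have hβ0 : 0 < β := by linarith [hβ.1]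
    -- Regularity and centering are used over the largest class, that of `β₀`; adaptation to `β`
    -- enters only through the bound on `k_n` for the class of `p`.
    have hph := holderDensities_anti (by linarith) hβ.1 hL₀ hpβ
    have hd := hph.1
    have := hd.isProbabilityMeasure_sampleLaw n
    have hK := (oracleBins_mem hκ hd (n := n) (by omega)).1
    have hl := one_le_log hn
    have hn0 : (0 : ℝ) < n := by positivity
    refine ofReal_one_sub_le_innerProb hε (hcn.trans (iInf₂_le p hph))
      (B := {y | IsRegularPosterior κ a (post n y) p D E (1 / n) M (oracleBins κ p n) y})
      ((hrn p hph).trans (ENNReal.ofReal_le_ofReal hn5.le)) ?_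
    rintro y ⟨hy1, hy2⟩
    have hy1' : hellinger p (phat n y) ≤ Mε * rate p n (oracleBins κ p n) := hy1
    have hrad := credibleRadius_le hα' (IsRegularPosterior.le_measure_ball hy2 hκ hn hD.le hDE
      (hκ.trans hK) ha0 hd (fun x => hc₀.trans_le (hph.2.1 x).1) (hphat n y) hn2.le)
    refine (hellingerDiam_credibleSet_le (hphat n y)).trans (ENNReal.ofReal_le_ofReal ?_)
    calc 2 * credibleRadius (post n y) (phat n y) α
        ≤ 2 * (√(D * (M + 1)) * √(oracleBins κ p n * Real.log n / n) +
          Mε * (√2 * √(oracleBins κ p n * Real.log n / n))) := by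
          rw [← postRadius_eq _ _ _ _ hD.le]
          gcongr
          refine hrad.trans (add_le_add le_rfl (hy1'.trans ?_))
          gcongr
          exact rate_oracleBins_le hκ hd (by omega)
      _ = 2 * (√(D * (M + 1)) + Mε * √2) * √(oracleBins κ p n * Real.log n / n) := by ring
      _ ≤ 2 * (√(D * (M + 1)) + Mε * √2) *
          (√B * ((n : ℝ) / Real.log n) ^ (-(β / (1 + 2 * β)))) := by
          gcongr
          exact sqrt_oracleBins_mul_log_div_le hβ0 hB.le (by linarith) hn0 rfl
            (hor n hn β hβ0 p hpβ)
      _ = _ := by ring
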